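/- **Definitions.** *Algebraic weak factorization systems.* An *algebraic weak factorization system* (awfs) on a category $\mathcal{C}$ is a pair $(\mathbb{L},\mathbb{R})$ consisting of a comonad and a monad on the arrow category $\mathcal{C}^{\mathbf 2}$ arising from one functorial factorization $f=Rf\cdot Lf$, $\operatorname{dom} f\xrightarrow{Lf}Ef\xrightarrow{Rf}\operatorname{cod} f$ (the counit of $\mathbb{L}$ is $(1,Rf)\colon Lf\Rightarrow f$, the unit of $\mathbb{R}$ is $(Lf,1)\colon f\Rightarrow Rf$, the comultiplication is $(1,\delta)$ and the multiplication is $(\mu,1)$), such that $(\delta,\mu)\colon LR\Rightarrow RL$ is a distributive law. Its underlying weak factorization system has as left (right) class the retracts of maps admitting an $\mathbb{L}$-coalgebra ($\mathbb{R}$-algebra) structure. A *morphism of awfs* $\xi\colon(\mathbb{L},\mathbb{R})\to(\mathbb{L}',\mathbb{R}')$ on $\mathcal{C}$ is a natural transformation $\xi\colon E\Rightarrow E'$ compatible with both factors such that $(1,\xi)$ is a comonad map $\mathbb{L}\Rightarrow\mathbb{L}'$ and $(\xi,1)$ is a monad map $\mathbb{R}\Rightarrow\mathbb{R}'$; it induces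 $\xi_*\colon\mathbb{L}\text{-}\mathbf{coalg}\to\mathbb{L}'\text{-}\mathbf{coalg}$. *Algebraic model structures.* An *algebraic model structure* on a complete and cocomplete category $\mathcal{M}$ is a class $\mathcal{W}$ of maps with the two-out-of-three property together with a morphism of awfs $\xi\colon(\mathbb{C}_t,\mathbb{F})\to(\mathbb{C},\mathbb{F}_t)$ whose underlying weak factorization systems are $(\mathcal{C}\cap\mathcal{W},\mathcal{F})$ and $(\mathcal{C},\mathcal{F}\cap\mathcal{W})$. An object $X$ is *cofibrant* if $\emptyset\to X$ is in $\mathcal{C}$; factoring $\emptyset\to X$ with $(\mathbb{C},\mathbb{F}_t)$ gives the cofibrant replacement $\varepsilon_X\colon QX\to X$. *Two-variable adjunctions of awfs.* Let $(\otimes,\hom_\ell,\hom_r)$ be a two-variable adjunction $\mathcal{K}\times\mathcal{M}\to\mathcal{N}$, with pushout-product $\hat\otimes$ and pullback-homs $\widehat{\hom}_\ell,\widehat{\hom}_r$. Let $(\mathbb{C}',\mathbb{F}')$, $(\mathbb{C},\mathbb{F})$, $(\mathbb{L},\mathbb{R})$ be awfs on $\mathcal{K},\mathcal{M},\mathcal{N}$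 with middle functors $Q',Q,E$. A *two-variable adjunction of awfs* $(\mathbb{C}',\mathbb{F}')\times(\mathbb{C},\mathbb{F})\to(\mathbb{L},\mathbb{R})$ consists of lifts of these functors $$\hat\otimes\colon\mathbb{C}'\text{-}\mathbf{coalg}\times\mathbb{C}\text{-}\mathbf{coalg}\to\mathbb{L}\text{-}\mathbf{coalg},\quad \widehat{\hom}_\ell\colon(\mathbb{C}'\text{-}\mathbf{coalg})^{op}\times\mathbb{R}\text{-}\mathbf{alg}\to\mathbb{F}\text{-}\mathbf{alg},\quad \widehat{\hom}_r\colon(\mathbb{C}\text{-}\mathbf{coalg})^{op}\times\mathbb{R}\text{-}\mathbf{alg}\to\mathbb{F}'\text{-}\mathbf{alg}$$ induced by a natural transformation $\lambda_{i,j}\colon Q'i\otimes Qj\to E(i\hat\otimes j)$ and its parameterized mates $\rho^\ell\colon Q\,\widehat{\hom}_\ell(i,f)\to\hom_\ell(Q'i,Ef)$, $\rho^r\colon Q'\,\widehat{\hom}_r(j,f)\to\hom_r(Qj,Ef)$. That is, for coalgebras $(i,s)$, $(j,s')$ and an algebra $(f,t)$, the coalgebra structure of $i\hat\otimes j$ is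 $\lambda_{i,j}\cdot(s\otimes s')$, and the algebra structures of $\widehat{\hom}_\ell(i,f)$ and $\widehat{\hom}_r(j,f)$ are $\hom_\ell(s,t)\cdot\rho^\ell$ and $\hom_r(s',t)\cdot\rho^r$. *Algebraic Quillen two-variable adjunctions.* An *algebraic Quillen two-variable adjunction* between algebraic model categories (with awfs $(\mathbb{C}'_t,\mathbb{F}')\to(\mathbb{C}',\mathbb{F}'_t)$ on $\mathcal{K}$, $(\mathbb{C}_t,\mathbb{F})\to(\mathbb{C},\mathbb{F}_t)$ on $\mathcal{M}$ and $(\mathbb{L}_t,\mathbb{R})\to(\mathbb{L},\mathbb{R}_t)$ on $\mathcal{N}$) is a two-variable adjunction with three specified two-variable adjunctions of awfs $$(\mathbb{C}',\mathbb{F}'_t)\times(\mathbb{C},\mathbb{F}_t)\to(\mathbb{L},\mathbb{R}_t),\quad(\mathbb{C}'_t,\mathbb{F}')\times(\mathbb{C},\mathbb{F}_t)\to(\mathbb{L}_t,\mathbb{R}),\quad(\mathbb{C}',\mathbb{F}'_t)\times(\mathbb{C}_t,\mathbb{F})\to(\mathbb{L}_t,\mathbb{R}).$$ It is *maximally coherent*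 if the lifted functors $\hat\otimes$ commute with the functors induced by the comparison maps $\xi$, i.e. the three squares of functors $\mathbb{C}'_t\text{-}\mathbf{coalg}\times\mathbb{C}\text{-}\mathbf{coalg}\to\mathbb{L}\text{-}\mathbf{coalg}$, $\mathbb{C}'\text{-}\mathbf{coalg}\times\mathbb{C}_t\text{-}\mathbf{coalg}\to\mathbb{L}\text{-}\mathbf{coalg}$ and $\mathbb{C}'_t\text{-}\mathbf{coalg}\times\mathbb{C}_t\text{-}\mathbf{coalg}\to\mathbb{L}_t\text{-}\mathbf{coalg}$ commute. *Monoidal algebraic model categories.* A *monoidal algebraic model category* is a (bi)closed monoidal category $\mathcal{M}$ with an algebraic model structure such that (i) the closed monoidal structure is equipped with the structure of an algebraic Quillen two-variable adjunction $\mathcal{M}\times\mathcal{M}\to\mathcal{M}$, and (ii) tensoring $\varepsilon_I\colon QI\to I$ ($I$ the monoidal unit) on either side with a cofibrant object gives a weak equivalence. It is *symmetric* if the monoidal category is symmetric and the lifted functors of algebraic cofibrations and algebraic trivial cofibrations commute with the symmetry: for $\mathbb{C}$-coalgebras $i,j$ the canonical isomorphism $i\hat\otimes j\cong j\hat\otimes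 i$ is one of $\mathbb{C}$-coalgebras, and for a $\mathbb{C}_t$-coalgebra $i$ and a $\mathbb{C}$-coalgebra $j$ it is one of $\mathbb{C}_t$-coalgebras. It is *maximally coherent* if its algebraic Quillen two-variable adjunction is. *Pointed objects.* Let $(\mathcal{M},\times,*)$ be a monoidal category whose unit $*$ is terminal (the monoidal product $\times$ need not be cartesian), and let $\mathcal{M}_*$ be the category of objects under $*$, with forgetful functor $U$. An algebraic model structure on $\mathcal{M}$ *lifts* to $\mathcal{M}_*$: the weak equivalences are created by $U$, and both awfs and their comparison map are lifted along $U$, so that $Ef$ is the middle object of $Uf$, based at the composite of the base point of $\operatorname{dom} f$ with $L(Uf)$. The *smash product* of $x\colon *\to X$ and $y\colon *\to Y$ is the pushout $X\wedge Y$ of $(1\times y)\vee(x\times 1)\colon X\vee Y\to X\times Y$ along $X\vee Y\to *$, where $\vee$ is the coproduct of $\mathcal{M}_*$, and $S^0=*\sqcup *$. **Theorem.** Let $\mathcal{M}$ be a monoidal algebraic model category whose monoidal unit $*$ is terminal and cofibrant. Then the smash product is the monoidal product, with unit $S^0$, of a monoidal structure on $\mathcal{M}_*$ for which the quotient maps $X\times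 Y\to X\wedge Y$ and the inclusion $*\to S^0$ of the summand that is not the base point make $U$ lax monoidal; and $\mathcal{M}_*$ with this monoidal structure and the lifted algebraic model structure carries the structure of a monoidal algebraic model category. This structure can be chosen so that, moreover, if $\mathcal{M}$ is symmetric then so is $\mathcal{M}_*$, for the symmetry of $\wedge$ induced by that of $\times$, and if $\mathcal{M}$ is maximally coherent then so is $\mathcal{M}_*$. -/

import Mathlib

open CategoryTheory Limits MonoidalCategory Opposite

universe v u v₁ u₁ v₂ u₂ v₃ u₃

namespace AlgModel

/-! ### Functorial factorizations and algebraic weak factorization systems -/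

/-- A functorial factorization: a section of the composition functor from composable pairs of
arrows to arrows.  An arrow `f` is sent to `dom f ⟶ E f ⟶ cod f`, with first factor `L f = l f` and
second factor `R f = r f`. -/
structure FunctFact (C : Type u) [Category.{v} C] where
  E : Arrow C ⥤ C
  l : ∀ f : Arrow C, f.left ⟶ E.obj f
  r : ∀ f : Arrow C, E.obj f ⟶ f.right
  l_map : ∀ {f g : Arrow C} (sq : f ⟶ g), l f ≫ E.map sq = sq.left ≫ l g
  map_r : ∀ {f g : Arrow C} (sq : f ⟶ g), E.map sq ≫ r g = r f ≫ sq.right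
  fac : ∀ f : Arrow C, l f ≫ r f = f.hom

attribute [simp] FunctFact.l_map FunctFact.map_r FunctFact.fac

namespace FunctFact

variable {C : Type u} [Category.{v} C] (F : FunctFact C)

/-- The endofunctor `L` of the arrow category. -/
@[simps] def lFun : Arrow C ⥤ Arrow C where
  obj f := Arrow.mk (F.l f)
  map sq := Arrow.homMk sq.left (F.E.map sq)

/-- The endofunctor `R` of the arrow category. -/
@[simps] def rFun : Arrow C ⥤ Arrow C where
  obj f := Arrow.mk (F.r f)
  map sq := Arrow.homMk (F.E.map sq) sq.right

/-- The component `(1, R f) : L f ⟶ f` of the canonical counit. -/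
abbrev eps (f : Arrow C) : Arrow.mk (F.l f) ⟶ f := Arrow.homMk (𝟙 _) (F.r f)

/-- The component `(L f, 1) : f ⟶ R f` of the canonical unit. -/
abbrev eta (f : Arrow C) : f ⟶ Arrow.mk (F.r f) := Arrow.homMk (F.l f) (𝟙 _)

end FunctFact

/-- An algebraic weak factorization system: a functorial factorization together with a
comultiplication `(1, δ) : L ⟶ L L` and a multiplication `(μ, 1) : R R ⟶ R` (these identity
components are forced by the (co)unit laws) making `L` a comonad and `R` a monad, such that
`(δ, μ) : L R ⟶ R L` is a distributive law.  Of the axioms of a distributive law, those involving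
the unit and the counit hold automatically, and the two others both reduce to `distrib`. -/
structure AWFS (C : Type u) [Category.{v} C] extends FunctFact C where
  δ : ∀ f : Arrow C, E.obj f ⟶ E.obj (Arrow.mk (l f))
  μ : ∀ f : Arrow C, E.obj (Arrow.mk (r f)) ⟶ E.obj f
  map_δ : ∀ {f g : Arrow C} (sq : f ⟶ g),
    E.map sq ≫ δ g = δ f ≫ E.map (toFunctFact.lFun.map sq)
  map_μ : ∀ {f g : Arrow C} (sq : f ⟶ g),
    E.map (toFunctFact.rFun.map sq) ≫ μ g = μ f ≫ E.map sq
  l_δ : ∀ f : Arrow C, l f ≫ δ f = l (Arrow.mk (l f))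
  left_counit : ∀ f : Arrow C, δ f ≫ r (Arrow.mk (l f)) = 𝟙 (E.obj f)
  right_counit : ∀ f : Arrow C, δ f ≫ E.map (toFunctFact.eps f) = 𝟙 (E.obj f)
  coassoc : ∀ f : Arrow C,
    δ f ≫ δ (Arrow.mk (l f)) =
      δ f ≫ E.map (Arrow.homMk' (f := l f) (g := l (Arrow.mk (l f))) (𝟙 _) (δ f)
        (by simp [l_δ]))
  μ_r : ∀ f : Arrow C, μ f ≫ r f = r (Arrow.mk (r f))
  left_unit : ∀ f : Arrow C, l (Arrow.mk (r f)) ≫ μ f = 𝟙 (E.obj f)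
  right_unit : ∀ f : Arrow C, E.map (toFunctFact.eta f) ≫ μ f = 𝟙 (E.obj f)
  assoc : ∀ f : Arrow C,
    μ (Arrow.mk (r f)) ≫ μ f =
      E.map (Arrow.homMk' (f := r (Arrow.mk (r f))) (g := r f) (μ f) (𝟙 _)
        (by simp [μ_r])) ≫ μ f
  distrib : ∀ f : Arrow C,
    μ f ≫ δ f =
      δ (Arrow.mk (r f)) ≫
        E.map (Arrow.homMk' (f := l (Arrow.mk (r f))) (g := r (Arrow.mk (l f))) (δ f) (μ f)
          (by simp [left_counit, left_unit])) ≫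
        μ (Arrow.mk (l f))

namespace AWFS

attribute [simp] l_δ left_counit right_counit μ_r left_unit right_unit

section

variable {C : Type u} [Category.{v} C] (A : AWFS C)

/-- The comonad on the arrow category. -/
def comonad : Comonad (Arrow C) where
  toFunctor := A.lFun
  ε :=
    { app := fun f => A.eps f
      naturality := fun f g sq => Arrow.hom_ext _ _
        ((Category.comp_id _).trans (Category.id_comp _).symm) (A.map_r sq) }
  δ :=
    { app := fun f => Arrow.homMk' (f := A.l f) (g := A.l (Arrow.mk (A.l f))) (𝟙 _) (A.δ f)
      naturality := fun f g sq => Arrow.hom_ext _ _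
        ((Category.comp_id _).trans (Category.id_comp _).symm) (A.map_δ sq) }
  coassoc f := Arrow.hom_ext _ _ rfl (A.coassoc f).symm
  left_counit f := Arrow.hom_ext _ _ (Category.comp_id _) (A.left_counit f)
  right_counit f := Arrow.hom_ext _ _ (Category.comp_id _) (A.right_counit f)

/-- The monad on the arrow category. -/
def monad : Monad (Arrow C) where
  toFunctor := A.rFun
  η :=
    { app := fun f => A.eta f
      naturality := fun f g sq => Arrow.hom_ext _ _ (A.l_map sq).symm
        ((Category.comp_id _).trans (Category.id_comp _).symm) }
  μ :=
    { app := fun f => Arrow.homMk' (f := A.r (Arrow.mk (A.r f))) (g := A.r f) (A.μ f) (𝟙 _)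
      naturality := fun f g sq => Arrow.hom_ext _ _ (A.map_μ sq)
        ((Category.comp_id _).trans (Category.id_comp _).symm) }
  assoc f := Arrow.hom_ext _ _ (A.assoc f).symm rfl
  left_unit f := Arrow.hom_ext _ _ (A.left_unit f) (Category.comp_id _)
  right_unit f := Arrow.hom_ext _ _ (A.right_unit f) (Category.comp_id _)

/-- The category of coalgebras for the comonad. -/
abbrev Coalg := A.comonad.Coalgebra

/-- The category of algebras for the monad. -/
abbrev Alg := A.monad.Algebra

/-- A coalgebra structure on a given arrow `f`, presented by its only nontrivial component
`cod f ⟶ E f`. -/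
@[ext]
structure CoalgStr (f : Arrow C) where
  s : f.right ⟶ A.E.obj f
  hom_s : f.hom ≫ s = A.l f
  counit : s ≫ A.r f = 𝟙 f.right
  coassoc : s ≫ A.δ f =
    s ≫ A.E.map (Arrow.homMk (f := f) (g := Arrow.mk (A.l f)) (𝟙 _) s (by simp [hom_s]))

/-- An algebra structure on a given arrow `f`, presented by its only nontrivial component
`E f ⟶ dom f`. -/
@[ext]
structure AlgStr (f : Arrow C) where
  t : A.E.obj f ⟶ f.left
  t_hom : t ≫ f.hom = A.r f
  unit : A.l f ≫ t = 𝟙 f.left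
  assoc : A.μ f ≫ t =
    A.E.map (Arrow.homMk (f := Arrow.mk (A.r f)) (g := f) t (𝟙 _) (by simp [t_hom])) ≫ t

attribute [simp] CoalgStr.hom_s CoalgStr.counit AlgStr.t_hom AlgStr.unit

variable {A}

/-- The nontrivial component `cod i ⟶ E i` of the structure map of a coalgebra. -/
def Coalg.s (i : A.Coalg) : i.A.right ⟶ A.E.obj i.A := i.a.right

/-- The nontrivial component `E f ⟶ dom f` of the structure map of an algebra. -/
def Alg.t (f : A.Alg) : A.E.obj f.A ⟶ f.A.left := f.a.left

lemma Coalg.a_left (i : A.Coalg) : i.a.left = 𝟙 i.A.left := by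
  have h := congrArg CommaMorphism.left i.counit
  exact (Category.comp_id i.a.left).symm.trans h

lemma Alg.a_right (f : A.Alg) : f.a.right = 𝟙 f.A.right := by
  have h := congrArg CommaMorphism.right f.unit
  exact (Category.id_comp f.a.right).symm.trans h

/-- The coalgebra given by a coalgebra structure on an arrow. -/
def CoalgStr.toCoalg {f : Arrow C} (S : A.CoalgStr f) : A.Coalg where
  A := f
  a := Arrow.homMk (f := f) (g := Arrow.mk (A.l f)) (𝟙 _) S.s
  counit := by
    ext
    · exact Category.id_comp _
    · exact S.counit
  coassoc := by
    ext
    · rfl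
    · exact S.coassoc

/-- The algebra given by an algebra structure on an arrow. -/
def AlgStr.toAlg {f : Arrow C} (S : A.AlgStr f) : A.Alg where
  A := f
  a := Arrow.homMk (f := Arrow.mk (A.r f)) (g := f) S.t (𝟙 _)
  unit := by
    ext
    · exact S.unit
    · exact Category.id_comp _
  assoc := by
    ext
    · exact S.assoc
    · rfl

/-- The coalgebra structure on the underlying arrow of a coalgebra. -/
def Coalg.str (i : A.Coalg) : A.CoalgStr i.A where
  s := Coalg.s i
  hom_s := by
    have h : i.a.left ≫ A.l i.A = i.A.hom ≫ Coalg.s i := i.a.w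
    exact h.symm.trans ((congrArg (fun z => z ≫ A.l i.A) (Coalg.a_left i)).trans
      (Category.id_comp _))
  counit := congrArg CommaMorphism.right i.counit
  coassoc := by
    have w : 𝟙 _ ≫ A.l i.A = i.A.hom ≫ Coalg.s i := by
      have h : i.a.left ≫ A.l i.A = i.A.hom ≫ Coalg.s i := i.a.w
      exact (congrArg (fun z => z ≫ A.l i.A) (Coalg.a_left i)).symm.trans h
    have h' : i.a = Arrow.homMk (f := i.A) (g := Arrow.mk (A.l i.A)) (𝟙 _) (Coalg.s i) w :=
      Arrow.hom_ext _ _ (Coalg.a_left i) rfl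
    exact (congrArg CommaMorphism.right i.coassoc).trans
      (congrArg (fun z => Coalg.s i ≫ A.E.map z) h')

/-- The algebra structure on the underlying arrow of an algebra. -/
def Alg.str (f : A.Alg) : A.AlgStr f.A where
  t := Alg.t f
  t_hom := by
    have h : Alg.t f ≫ f.A.hom = A.r f.A ≫ f.a.right := f.a.w
    exact h.trans ((congrArg (fun z => A.r f.A ≫ z) (Alg.a_right f)).trans
      (Category.comp_id _))
  unit := congrArg CommaMorphism.left f.unit
  assoc := by
    have w : Alg.t f ≫ f.A.hom = A.r f.A ≫ 𝟙 _ := by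
      have h : Alg.t f ≫ f.A.hom = A.r f.A ≫ f.a.right := f.a.w
      exact h.trans (congrArg (fun z => A.r f.A ≫ z) (Alg.a_right f))
    have h' : f.a = Arrow.homMk (f := Arrow.mk (A.r f.A)) (g := f.A) (Alg.t f) (𝟙 _) w :=
      Arrow.hom_ext _ _ rfl (Alg.a_right f)
    exact (congrArg CommaMorphism.left f.assoc).trans
      (congrArg (fun z => A.E.map z ≫ Alg.t f) h')

variable (A)

/-- The maps admitting a coalgebra structure. -/
def cellular : MorphismProperty C := fun _ _ f => Nonempty (A.CoalgStr (Arrow.mk f))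

/-- The maps admitting an algebra structure. -/
def algebraic : MorphismProperty C := fun _ _ f => Nonempty (A.AlgStr (Arrow.mk f))

/-- The left class of the underlying weak factorization system. -/
def leftClass : MorphismProperty C := A.cellular.retracts

/-- The right class of the underlying weak factorization system. -/
def rightClass : MorphismProperty C := A.algebraic.retracts

/-- The left class consists of the maps admitting a coalgebra structure for the copointed
endofunctor `L`. -/
lemma leftClass_iff {X Y : C} (f : X ⟶ Y) : A.leftClass f ↔
    ∃ s : Y ⟶ A.E.obj (Arrow.mk f), f ≫ s = A.l (Arrow.mk f) ∧ s ≫ A.r (Arrow.mk f) = 𝟙 Y := by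
  constructor
  · rintro ⟨X', Y', g, h, ⟨S⟩⟩
    have e : h.i.right ≫ h.r.right = 𝟙 Y := congrArg CommaMorphism.right h.retract
    have e' : h.i.left ≫ h.r.left = 𝟙 X := congrArg CommaMorphism.left h.retract
    have w : h.i.left ≫ g = f ≫ h.i.right := h.i.w
    have w' : g ≫ S.s = A.l (Arrow.mk g) := S.hom_s
    have w'' : S.s ≫ A.r (Arrow.mk g) = 𝟙 Y' := S.counit
    refine ⟨h.i.right ≫ S.s ≫ A.E.map h.r, ?_, ?_⟩
    · rw [← Category.assoc, ← w, Category.assoc, reassoc_of% w', A.l_map, ← Category.assoc, e']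
      exact Category.id_comp _
    · rw [Category.assoc, Category.assoc, A.map_r, ← Category.assoc S.s, w'']
      exact (congrArg _ (Category.id_comp _)).trans e
  · rintro ⟨s, hs, hs'⟩
    refine ⟨_, _, A.l (Arrow.mk f), ?_,
      ⟨⟨A.δ _, A.l_δ _, A.left_counit _, A.coassoc _⟩⟩⟩
    exact
      { i := Arrow.homMk' (f := f) (g := A.l (Arrow.mk f)) (𝟙 _) s (by simp [hs])
        r := A.eps (Arrow.mk f)
        retract := Arrow.hom_ext _ _ (Category.id_comp _) hs' }

/-- The right class consists of the maps admitting an algebra structure for the pointed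
endofunctor `R`. -/
lemma rightClass_iff {X Y : C} (f : X ⟶ Y) : A.rightClass f ↔
    ∃ t : A.E.obj (Arrow.mk f) ⟶ X, t ≫ f = A.r (Arrow.mk f) ∧ A.l (Arrow.mk f) ≫ t = 𝟙 X := by
  constructor
  · rintro ⟨X', Y', g, h, ⟨S⟩⟩
    have e : h.i.right ≫ h.r.right = 𝟙 Y := congrArg CommaMorphism.right h.retract
    have e' : h.i.left ≫ h.r.left = 𝟙 X := congrArg CommaMorphism.left h.retract
    have w : h.r.left ≫ f = g ≫ h.r.right := h.r.w
    have w' : S.t ≫ g = A.r (Arrow.mk g) := S.t_hom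
    have w'' : A.l (Arrow.mk g) ≫ S.t = 𝟙 X' := S.unit
    refine ⟨A.E.map h.i ≫ S.t ≫ h.r.left, ?_, ?_⟩
    · rw [Category.assoc, Category.assoc, w, reassoc_of% w', ← Category.assoc, A.map_r,
        Category.assoc, e]
      exact Category.comp_id _
    · rw [← Category.assoc, A.l_map, Category.assoc, ← Category.assoc (A.l _), w'']
      exact (congrArg _ (Category.id_comp _)).trans e'
  · rintro ⟨t, ht, ht'⟩
    refine ⟨_, _, A.r (Arrow.mk f), ?_,
      ⟨⟨A.μ _, A.μ_r _, A.left_unit _, A.assoc _⟩⟩⟩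
    exact
      { i := A.eta (Arrow.mk f)
        r := Arrow.homMk' (f := A.r (Arrow.mk f)) (g := f) t (𝟙 _) (by simp [ht])
        retract := Arrow.hom_ext _ _ ht' (Category.id_comp _) }

/-- A morphism of algebraic weak factorization systems on the same category. -/
structure Hom (A B : AWFS C) where
  ξ : ∀ f : Arrow C, A.E.obj f ⟶ B.E.obj f
  map_ξ : ∀ {f g : Arrow C} (sq : f ⟶ g), A.E.map sq ≫ ξ g = ξ f ≫ B.E.map sq
  l_ξ : ∀ f : Arrow C, A.l f ≫ ξ f = B.l f
  ξ_r : ∀ f : Arrow C, ξ f ≫ B.r f = A.r f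
  ξ_δ : ∀ f : Arrow C,
    ξ f ≫ B.δ f =
      A.δ f ≫ ξ (Arrow.mk (A.l f)) ≫
        B.E.map (Arrow.homMk' (f := A.l f) (g := B.l f) (𝟙 _) (ξ f) (by simp [l_ξ]))
  μ_ξ : ∀ f : Arrow C,
    A.μ f ≫ ξ f =
      ξ (Arrow.mk (A.r f)) ≫
        B.E.map (Arrow.homMk' (f := A.r f) (g := B.r f) (ξ f) (𝟙 _) (by simp [ξ_r])) ≫ B.μ f

attribute [simp] Hom.l_ξ Hom.ξ_r

/-- The functor on coalgebras induced by a morphism of algebraic weak factorization systems: its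
effect on the coalgebra structures on a fixed arrow. -/
def Hom.mapStr {A B : AWFS C} (φ : Hom A B) {f : Arrow C} (S : A.CoalgStr f) : B.CoalgStr f where
  s := S.s ≫ φ.ξ f
  hom_s := by rw [← Category.assoc, S.hom_s, φ.l_ξ]
  counit := by rw [Category.assoc, φ.ξ_r, S.counit]
  coassoc := by
    rw [Category.assoc, φ.ξ_δ, reassoc_of% S.coassoc, ← Category.assoc (A.E.map _), φ.map_ξ,
      Category.assoc, Category.assoc, ← Functor.map_comp]
    exact congrArg (fun z => S.s ≫ φ.ξ f ≫ B.E.map z)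
      (Arrow.hom_ext _ _ (Category.id_comp _) rfl)

/-- The functor on coalgebras induced by a morphism of algebraic weak factorization systems, on
objects. -/
def Hom.mapCoalg {A B : AWFS C} (φ : Hom A B) (i : A.Coalg) : B.Coalg :=
  (φ.mapStr (Coalg.str i)).toCoalg

end

/-! ### Lifting to a category of objects under a fixed object -/

section Under

variable {C : Type u} [Category.{v} C] {X : C}

/-- The underlying arrow of an arrow of objects under `X`. -/
abbrev uArr (f : Arrow (Under X)) : Arrow C := Arrow.mk f.hom.right

/-- The underlying square of a square of objects under `X`. -/
abbrev uSq {f g : Arrow (Under X)} (sq : f ⟶ g) : uArr f ⟶ uArr g :=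
  Arrow.homMk' sq.left.right sq.right.right (congrArg CommaMorphism.right sq.w)

variable (A : AWFS C) (X)

/-- The lift of an algebraic weak factorization system along the forgetful functor from objects
under `X`: the middle object `E f` is based by the composite of the base point of `dom f` with
the left factor. -/
def under : AWFS (Under X) where
  E :=
    { obj := fun f => Under.mk (f.left.hom ≫ A.l (uArr f))
      map := fun {f g} sq => Under.homMk (A.E.map (uSq sq)) (by
        have h : f.left.hom ≫ sq.left.right = g.left.hom := Under.w sq.left
        have h' : A.l (uArr f) ≫ A.E.map (uSq sq) = sq.left.right ≫ A.l (uArr g) := A.l_map (uSq sq)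
        calc (f.left.hom ≫ A.l (uArr f)) ≫ A.E.map (uSq sq)
            = f.left.hom ≫ sq.left.right ≫ A.l (uArr g) :=
              (Category.assoc _ _ _).trans (congrArg (fun z => f.left.hom ≫ z) h')
          _ = g.left.hom ≫ A.l (uArr g) :=
              (Category.assoc _ _ _).symm.trans (congrArg (fun z => z ≫ A.l (uArr g)) h))
      map_id := fun f => by
        ext
        exact A.E.map_id _
      map_comp := fun a b => by
        ext
        exact A.E.map_comp (uSq a) (uSq b) }
  l f := Under.homMk (A.l (uArr f)) rfl
  r f := Under.homMk (A.r (uArr f)) (by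
    have h : f.left.hom ≫ f.hom.right = f.right.hom := Under.w f.hom
    exact ((Category.assoc _ _ _).trans
      (congrArg (fun z => f.left.hom ≫ z) (A.fac (uArr f)))).trans h)
  l_map sq := by ext; exact A.l_map (uSq sq)
  map_r sq := by ext; exact A.map_r (uSq sq)
  fac f := by ext; exact A.fac (uArr f)
  δ f := Under.homMk (A.δ (uArr f)) (by
    have h := A.l_δ (uArr f)
    exact (Category.assoc _ _ _).trans (congrArg (f.left.hom ≫ ·) h))
  μ f := Under.homMk (A.μ (uArr f)) (by
    have h := A.left_unit (uArr f)
    exact (Category.assoc _ _ _).trans ((congrArg ((f.left.hom ≫ A.l (uArr f)) ≫ ·) h).trans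
      (Category.comp_id _)))
  map_δ sq := by ext; exact A.map_δ (uSq sq)
  map_μ sq := by ext; exact A.map_μ (uSq sq)
  l_δ f := by ext; exact A.l_δ (uArr f)
  left_counit f := by ext; exact A.left_counit (uArr f)
  right_counit f := by ext; exact A.right_counit (uArr f)
  coassoc f := by ext; exact A.coassoc (uArr f)
  μ_r f := by ext; exact A.μ_r (uArr f)
  left_unit f := by ext; exact A.left_unit (uArr f)
  right_unit f := by ext; exact A.right_unit (uArr f)
  assoc f := by ext; exact A.assoc (uArr f)
  distrib f := by ext; exact A.distrib (uArr f)

/-- The lift of a morphism of algebraic weak factorization systems. -/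
def Hom.under {A B : AWFS C} (φ : Hom A B) : Hom (A.under X) (B.under X) where
  ξ f := Under.homMk (φ.ξ (uArr f)) (by
    have h := φ.l_ξ (uArr f)
    exact (Category.assoc _ _ _).trans (congrArg (f.left.hom ≫ ·) h))
  map_ξ sq := by ext; exact φ.map_ξ (uSq sq)
  l_ξ f := by ext; exact φ.l_ξ (uArr f)
  ξ_r f := by ext; exact φ.ξ_r (uArr f)
  ξ_δ f := by ext; exact φ.ξ_δ (uArr f)
  μ_ξ f := by ext; exact φ.μ_ξ (uArr f)

lemma under_leftClass : (A.under X).leftClass = A.leftClass.inverseImage (Under.forget X) := by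
  ext Y Z f
  rw [leftClass_iff, MorphismProperty.inverseImage_iff, leftClass_iff]
  constructor
  · rintro ⟨s, h, h'⟩
    exact ⟨s.right, congrArg CommaMorphism.right h, congrArg CommaMorphism.right h'⟩
  · rintro ⟨s, h, h'⟩
    refine ⟨Under.homMk s ?_, ?_, ?_⟩
    · have e := Under.w f
      have e' : Z.hom = Y.hom ≫ f.right := e.symm
      change Z.hom ≫ s = Y.hom ≫ A.l (Arrow.mk f.right)
      exact (congrArg (fun z => z ≫ s) e').trans
        ((Category.assoc _ _ _).trans (congrArg (fun z => Y.hom ≫ z) h))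
    · ext; exact h
    · ext; exact h'

lemma under_rightClass : (A.under X).rightClass = A.rightClass.inverseImage (Under.forget X) := by
  ext Y Z f
  rw [rightClass_iff, MorphismProperty.inverseImage_iff, rightClass_iff]
  constructor
  · rintro ⟨s, h, h'⟩
    exact ⟨s.right, congrArg CommaMorphism.right h, congrArg CommaMorphism.right h'⟩
  · rintro ⟨s, h, h'⟩
    refine ⟨Under.homMk s ?_, ?_, ?_⟩
    · change (Y.hom ≫ A.l (Arrow.mk f.right)) ≫ s = Y.hom
      refine (Category.assoc _ _ _).trans ?_
      exact (congrArg (Y.hom ≫ ·) h').trans (Category.comp_id _)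
    · ext; exact h
    · ext; exact h'

end Under

end AWFS

/-! ### Two-variable adjunctions -/

section TwoVar

open AWFS

variable {K : Type u₁} {M : Type u₂} {N : Type u₃}
  [Category.{v₁} K] [Category.{v₂} M] [Category.{v₃} N]

/-- A two-variable adjunction whose left adjoint is the bifunctor `F`. -/
structure TwoVarAdj (F : K ⥤ M ⥤ N) where
  homL : Kᵒᵖ ⥤ N ⥤ M
  homR : Mᵒᵖ ⥤ N ⥤ K
  adjL : F ⊣₂ homL
  adjR : F.flip ⊣₂ homR

namespace TwoVarAdj

variable {F : K ⥤ M ⥤ N} (T : TwoVarAdj F) [HasPullbacks K] [HasPullbacks M] [HasPushouts N]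

/-- The transposition `(i ⊗̂ j ⟶ f) ≃ (j ⟶ hom̂_ℓ(i, f))` between pushout-product and pullback-hom. -/
noncomputable def hatEquivL (i : Arrow K) (j : Arrow M) (f : Arrow N) :
    ((F.leibnizPushout.obj i).obj j ⟶ f) ≃ (j ⟶ (T.homL.leibnizPullback.obj (op i)).obj f) :=
  T.adjL.arrowHomEquiv (Functor.PushoutObjObj.ofHasPushout F i.hom j.hom)
    (Functor.PullbackObjObj.ofHasPullback T.homL i.hom f.hom)

/-- The transposition `(i ⊗̂ j ⟶ f) ≃ (i ⟶ hom̂_r(j, f))` between pushout-product and pullback-hom. -/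
noncomputable def hatEquivR (i : Arrow K) (j : Arrow M) (f : Arrow N) :
    ((F.leibnizPushout.obj i).obj j ⟶ f) ≃ (i ⟶ (T.homR.leibnizPullback.obj (op j)).obj f) :=
  T.adjR.arrowHomEquiv (Functor.PushoutObjObj.ofHasPushout F i.hom j.hom).flip
    (Functor.PullbackObjObj.ofHasPullback T.homR j.hom f.hom)

end TwoVarAdj

/-- A natural transformation `λ : Q' - ⊗ Q - ⟶ E (- ⊗̂ -)`, for algebraic weak factorization systems
`A = (C', F')`, `B = (C, F)` and `D = (L, R)` whose functorial factorizations have middle functors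
`Q'`, `Q` and `E`. -/
structure TensorTrans (F : K ⥤ M ⥤ N) [HasPushouts N]
    (A : AWFS K) (B : AWFS M) (D : AWFS N) where
  lam : ∀ (i : Arrow K) (j : Arrow M),
    (F.obj (A.E.obj i)).obj (B.E.obj j) ⟶ D.E.obj ((F.leibnizPushout.obj i).obj j)
  naturality_left : ∀ {i i' : Arrow K} (a : i ⟶ i') (j : Arrow M),
    (F.map (A.E.map a)).app (B.E.obj j) ≫ lam i' j =
      lam i j ≫ D.E.map ((F.leibnizPushout.map a).app j)
  naturality_right : ∀ (i : Arrow K) {j j' : Arrow M} (b : j ⟶ j'),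
    (F.obj (A.E.obj i)).map (B.E.map b) ≫ lam i j' =
      lam i j ≫ D.E.map ((F.leibnizPushout.obj i).map b)

namespace TensorTrans

variable {F : K ⥤ M ⥤ N} [HasPullbacks K] [HasPullbacks M] [HasPushouts N]
  {A : AWFS K} {B : AWFS M} {D : AWFS N} (lam : TensorTrans F A B D) (T : TwoVarAdj F)

/-- The mate `ρ^ℓ : Q hom̂_ℓ(-, -) ⟶ hom_ℓ(Q' -, E -)` of `λ`, for the adjunctions
`i ⊗̂ - ⊣ hom̂_ℓ(i, -)` and `Q' i ⊗ - ⊣ hom_ℓ(Q' i, -)`. -/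
noncomputable def rhoL (i : Arrow K) (f : Arrow N) :
    B.E.obj ((T.homL.leibnizPullback.obj (op i)).obj f) ⟶
      (T.homL.obj (op (A.E.obj i))).obj (D.E.obj f) :=
  T.adjL.homEquiv (lam.lam i ((T.homL.leibnizPullback.obj (op i)).obj f) ≫
    D.E.map ((T.hatEquivL i _ f).symm (𝟙 _)))

/-- The mate `ρ^r : Q' hom̂_r(-, -) ⟶ hom_r(Q -, E -)` of `λ`, for the adjunctions
`- ⊗̂ j ⊣ hom̂_r(j, -)` and `- ⊗ Q j ⊣ hom_r(Q j, -)`. -/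
noncomputable def rhoR (j : Arrow M) (f : Arrow N) :
    A.E.obj ((T.homR.leibnizPullback.obj (op j)).obj f) ⟶
      (T.homR.obj (op (B.E.obj j))).obj (D.E.obj f) :=
  T.adjR.homEquiv (lam.lam ((T.homR.leibnizPullback.obj (op j)).obj f) j ≫
    D.E.map ((T.hatEquivR _ j f).symm (𝟙 _)))

end TensorTrans

/-- A two-variable adjunction of algebraic weak factorization systems `A × B ⟶ D`: lifts of the
pushout-product to coalgebras, and of the two pullback-homs to coalgebras in the contravariant and
algebras in the covariant variable, characterized by a natural transformation `λ` and its
parameterized mates `ρ^ℓ` and `ρ^r`.  That the lifts act on morphisms of (co)algebras is automatic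
by naturality, see `tensor_map_left`, `tensor_map_right` for the pushout-product. -/
structure TwoVarAWFS {F : K ⥤ M ⥤ N} (T : TwoVarAdj F)
    [HasPullbacks K] [HasPullbacks M] [HasPushouts N]
    (A : AWFS K) (B : AWFS M) (D : AWFS N) extends TensorTrans F A B D where
  /-- The lift of the pushout-product to coalgebras. -/
  tensorStr : ∀ (i : A.Coalg) (j : B.Coalg), D.CoalgStr ((F.leibnizPushout.obj i.A).obj j.A)
  tensorStr_s : ∀ (i : A.Coalg) (j : B.Coalg), (tensorStr i j).s =
    (F.map (Coalg.s i)).app j.A.right ≫ (F.obj (A.E.obj i.A)).map (Coalg.s j) ≫ lam i.A j.A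
  /-- The lift of the left pullback-hom. -/
  homLStr : ∀ (i : A.Coalg) (f : D.Alg), B.AlgStr ((T.homL.leibnizPullback.obj (op i.A)).obj f.A)
  homLStr_t : ∀ (i : A.Coalg) (f : D.Alg), (homLStr i f).t =
    toTensorTrans.rhoL T i.A f.A ≫ (T.homL.map (Coalg.s i).op).app (D.E.obj f.A) ≫
      (T.homL.obj (op i.A.right)).map (Alg.t f)
  /-- The lift of the right pullback-hom. -/
  homRStr : ∀ (j : B.Coalg) (f : D.Alg), A.AlgStr ((T.homR.leibnizPullback.obj (op j.A)).obj f.A)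
  homRStr_t : ∀ (j : B.Coalg) (f : D.Alg), (homRStr j f).t =
    toTensorTrans.rhoR T j.A f.A ≫ (T.homR.map (Coalg.s j).op).app (D.E.obj f.A) ≫
      (T.homR.obj (op j.A.right)).map (Alg.t f)

namespace TwoVarAWFS

variable {F : K ⥤ M ⥤ N} {T : TwoVarAdj F} [HasPullbacks K] [HasPullbacks M] [HasPushouts N]
  {A : AWFS K} {B : AWFS M} {D : AWFS N} (P : TwoVarAWFS T A B D)

/-- The lifted pushout-product sends coalgebra morphisms in the first variable to coalgebra
morphisms. -/
lemma tensor_map_left {i i' : A.Coalg} (a : i ⟶ i') (j : B.Coalg) :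
    (P.tensorStr i j).s ≫ D.E.map ((F.leibnizPushout.map a.f).app j.A) =
      ((F.leibnizPushout.map a.f).app j.A).right ≫ (P.tensorStr i' j).s := by
  have h : Coalg.s i ≫ A.E.map a.f = a.f.right ≫ Coalg.s i' := congrArg CommaMorphism.right a.h
  have e : (F.map (Coalg.s i)).app j.A.right ≫ (F.obj (A.E.obj i.A)).map (Coalg.s j) ≫
      P.lam i.A j.A ≫ D.E.map ((F.leibnizPushout.map a.f).app j.A) =
    (F.map a.f.right).app j.A.right ≫ (F.map (Coalg.s i')).app j.A.right ≫
      (F.obj (A.E.obj i'.A)).map (Coalg.s j) ≫ P.lam i'.A j.A := by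
    rw [← P.naturality_left, (F.map (A.E.map a.f)).naturality_assoc, ← NatTrans.comp_app_assoc,
      ← NatTrans.comp_app_assoc, ← F.map_comp, ← F.map_comp, h]
  rw [P.tensorStr_s, P.tensorStr_s]
  refine Eq.trans ?_ e
  exact (Category.assoc _ _ _).trans (congrArg _ (Category.assoc _ _ _))

/-- The lifted pushout-product sends coalgebra morphisms in the second variable to coalgebra
morphisms. -/
lemma tensor_map_right (i : A.Coalg) {j j' : B.Coalg} (b : j ⟶ j') :
    (P.tensorStr i j).s ≫ D.E.map ((F.leibnizPushout.obj i.A).map b.f) =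
      ((F.leibnizPushout.obj i.A).map b.f).right ≫ (P.tensorStr i j').s := by
  have h : Coalg.s j ≫ B.E.map b.f = b.f.right ≫ Coalg.s j' := congrArg CommaMorphism.right b.h
  have e : (F.map (Coalg.s i)).app j.A.right ≫ (F.obj (A.E.obj i.A)).map (Coalg.s j) ≫
      P.lam i.A j.A ≫ D.E.map ((F.leibnizPushout.obj i.A).map b.f) =
    (F.obj i.A.right).map b.f.right ≫ (F.map (Coalg.s i)).app j'.A.right ≫
      (F.obj (A.E.obj i.A)).map (Coalg.s j') ≫ P.lam i.A j'.A := by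
    rw [← P.naturality_right, ← Functor.map_comp_assoc, h, Functor.map_comp_assoc,
      NatTrans.naturality_assoc]
  rw [P.tensorStr_s, P.tensorStr_s]
  refine Eq.trans ?_ e
  exact (Category.assoc _ _ _).trans (congrArg _ (Category.assoc _ _ _))

end TwoVarAWFS

end TwoVar

/-! ### Algebraic model structures -/

/-- An algebraic model structure on a complete and cocomplete category: a class of weak
equivalences with the two-out-of-three property and a morphism `ξ : (C_t, F) ⟶ (C, F_t)` of
algebraic weak factorization systems whose underlying weak factorization systems are
`(C ∩ W, F)` and `(C, F ∩ W)`. -/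
structure AlgModelStr (M : Type u) [Category.{v} M] [HasLimits M] [HasColimits M] where
  W : MorphismProperty M
  two_of_three : W.HasTwoOutOfThreeProperty
  /-- The system (trivial cofibrations, fibrations). -/
  tc : AWFS M
  /-- The system (cofibrations, trivial fibrations). -/
  cof : AWFS M
  ξ : AWFS.Hom tc cof
  left_eq : tc.leftClass = cof.leftClass ⊓ W
  right_eq : cof.rightClass = tc.rightClass ⊓ W

namespace AlgModelStr

variable {M : Type u} [Category.{v} M] [HasLimits M] [HasColimits M] (S : AlgModelStr M)

/-- Cofibrant objects. -/
def IsCofibrant (X : M) : Prop := S.cof.leftClass (initial.to X)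

/-- The cofibrant replacement of an object. -/
noncomputable def cofRepl (X : M) : M := S.cof.E.obj (Arrow.mk (initial.to X))

/-- The counit of the cofibrant replacement comonad. -/
noncomputable def cofReplCounit (X : M) : S.cofRepl X ⟶ X := S.cof.r (Arrow.mk (initial.to X))

open AWFS in
/-- The algebraic model structure on the category of objects under `X` which is lifted along the
forgetful functor: both algebraic weak factorization systems and their comparison are lifted, and
the weak equivalences are created by the forgetful functor. -/
def under (X : M) : AlgModelStr (Under X) where
  W := S.W.inverseImage (Under.forget X)
  two_of_three := by
    have := S.two_of_three
    infer_instance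
  tc := S.tc.under X
  cof := S.cof.under X
  ξ := Hom.under X S.ξ
  left_eq := by
    rw [under_leftClass, under_leftClass, S.left_eq]
    rfl
  right_eq := by
    rw [under_rightClass, under_rightClass, S.right_eq]
    rfl

end AlgModelStr

/-- An algebraic Quillen two-variable adjunction. -/
structure AlgQuillenTwoVar {K : Type u₁} {M : Type u₂} {N : Type u₃}
    [Category.{v₁} K] [Category.{v₂} M] [Category.{v₃} N]
    [HasLimits K] [HasColimits K] [HasLimits M] [HasColimits M] [HasLimits N] [HasColimits N]
    {F : K ⥤ M ⥤ N} (T : TwoVarAdj F)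
    (SK : AlgModelStr K) (SM : AlgModelStr M) (SN : AlgModelStr N) where
  cc : TwoVarAWFS T SK.cof SM.cof SN.cof
  tcc : TwoVarAWFS T SK.tc SM.cof SN.tc
  ctc : TwoVarAWFS T SK.cof SM.tc SN.tc

/-- Maximal coherence: the three squares of lifted functors on coalgebras commute. -/
structure AlgQuillenTwoVar.IsMaximallyCoherent {K : Type u₁} {M : Type u₂} {N : Type u₃}
    [Category.{v₁} K] [Category.{v₂} M] [Category.{v₃} N]
    [HasLimits K] [HasColimits K] [HasLimits M] [HasColimits M] [HasLimits N] [HasColimits N]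
    {F : K ⥤ M ⥤ N} {T : TwoVarAdj F}
    {SK : AlgModelStr K} {SM : AlgModelStr M} {SN : AlgModelStr N}
    (Q : AlgQuillenTwoVar T SK SM SN) : Prop where
  left : ∀ (i : SK.tc.Coalg) (j : SM.cof.Coalg),
    SN.ξ.mapStr (Q.tcc.tensorStr i j) = Q.cc.tensorStr (SK.ξ.mapCoalg i) j
  right : ∀ (i : SK.cof.Coalg) (j : SM.tc.Coalg),
    SN.ξ.mapStr (Q.ctc.tensorStr i j) = Q.cc.tensorStr i (SM.ξ.mapCoalg j)
  top : ∀ (i : SK.tc.Coalg) (j : SM.tc.Coalg),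
    Q.tcc.tensorStr i (SM.ξ.mapCoalg j) = Q.ctc.tensorStr (SK.ξ.mapCoalg i) j

/-! ### Monoidal algebraic model structures -/

section Monoidal

variable {M : Type u} [Category.{v} M] [HasLimits M] [HasColimits M] [MonoidalCategory M]

/-- The structure of a monoidal algebraic model category on a monoidal category with an algebraic
model structure: it is (bi)closed, the closed structure is an algebraic Quillen two-variable
adjunction, and tensoring a cofibrant object on either side with the cofibrant replacement
`Q * ⟶ *` of the unit gives a weak equivalence. -/
structure MonoidalAlgModel (S : AlgModelStr M) where
  closed : TwoVarAdj (curriedTensor M)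
  quillen : AlgQuillenTwoVar closed S S S
  unit_right : ∀ X : M, S.IsCofibrant X → S.W (X ◁ S.cofReplCounit (𝟙_ M))
  unit_left : ∀ X : M, S.IsCofibrant X → S.W (S.cofReplCounit (𝟙_ M) ▷ X)

/-- The monoidal algebraic model structure is symmetric: the lifted functors on algebraic (trivial)
cofibrations commute, up to isomorphism of coalgebras, with the symmetry `i ⊗̂ j ≅ j ⊗̂ i`. -/
structure MonoidalAlgModel.IsSymmetric [SymmetricCategory M] {S : AlgModelStr M}
    (P : MonoidalAlgModel S) : Prop where
  cc : ∀ i j : S.cof.Coalg,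
    (P.quillen.cc.tensorStr i j).s ≫
        S.cof.E.map (MonoidalCategory.Arrow.PushoutProduct.braiding i.A j.A).hom =
      (β_ i.A.right j.A.right).hom ≫ (P.quillen.cc.tensorStr j i).s
  tc : ∀ (i : S.tc.Coalg) (j : S.cof.Coalg),
    (P.quillen.tcc.tensorStr i j).s ≫
        S.tc.E.map (MonoidalCategory.Arrow.PushoutProduct.braiding i.A j.A).hom =
      (β_ i.A.right j.A.right).hom ≫ (P.quillen.ctc.tensorStr j i).s

/-- The monoidal algebraic model structure is maximally coherent. -/
def MonoidalAlgModel.IsMaximallyCoherent {S : AlgModelStr M} (P : MonoidalAlgModel S) : Prop :=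
  P.quillen.IsMaximallyCoherent

/-- The map `X ∨ Y ⟶ X × Y`, with components `1 × y` and `x × 1`, from the coproduct of two objects
under the monoidal unit `*` (the pushout over `*` of the underlying objects), where `×` denotes the
monoidal product and `x`, `y` are the base points. -/
noncomputable def wedgeToTensor (X Y : Under (𝟙_ M)) :
    pushout X.hom Y.hom ⟶ X.right ⊗ Y.right :=
  pushout.desc ((ρ_ X.right).inv ≫ X.right ◁ Y.hom) ((λ_ Y.right).inv ≫ X.hom ▷ Y.right) (by
    rw [rightUnitor_inv_naturality_assoc, leftUnitor_inv_naturality_assoc, whisker_exchange,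
      unitors_inv_equal])

/-- A monoidal structure on the category of pointed objects (objects under the terminal monoidal
unit `*`) is the smash product, with quotient maps `X × Y ⟶ X ∧ Y` given by the structure maps `μ`
of a lax monoidal structure on the forgetful functor: `X ∧ Y` is the pushout of
`X ∨ Y ⟶ X × Y` along `X ∨ Y ⟶ *`, based by the other leg, and the unit is
`S⁰ = * ⊔ *`, based at the first summand. Compatibility of `μ` with the unitors and associators
determines the latter. -/
structure IsSmash (ht : IsTerminal (𝟙_ M)) [MonoidalCategory (Under (𝟙_ M))]
    [(Under.forget (𝟙_ M)).LaxMonoidal] : Prop where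
  isPushout : ∀ X Y : Under (𝟙_ M),
    IsPushout (wedgeToTensor X Y) (ht.from (pushout X.hom Y.hom))
      (Functor.LaxMonoidal.μ (Under.forget (𝟙_ M)) X Y) (X ⊗ Y).hom
  unit : Nonempty (IsColimit (BinaryCofan.mk (𝟙_ (Under (𝟙_ M))).hom
    (Functor.LaxMonoidal.ε (Under.forget (𝟙_ M)))))

end Monoidal

end AlgModel

/-!
The quotient map `q : X ⊗ Y ⟶ X ∧ Y` is universal among the maps to pointed objects which are
constant on `* ⊗ Y` and on `X ⊗ *`. The structure `SmashData` records exactly this, for any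
bifunctor in place of the monoidal product; it is symmetric in the two variables, so that the
internal hom for one variable is obtained from the other by flipping. Such a smash product
is closed: pointed maps from `B` to `X` form the equalizer, inside the internal hom, of restriction
to the base point and the constant map (`SmashData.twoVarAdj`).

*Monoidal structure.* The maps `q` are epimorphisms, and so are `q ▷ Z` and `Z ◁ q`, since
tensoring is a left adjoint. A map out of `(X ∧ Y) ⊗ Z` can therefore be defined on `(X ⊗ Y) ⊗ Z`,
by descending its transpose (`SmashData.descMap`), and all coherence laws reduce to those of `M`
after precomposition with quotient maps. In the same way a map out of `S⁰ ∧ X` is determined by its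
restriction to the summand of `S⁰` which is not the base point.

*Algebraic weak factorization systems.* The quotient maps induce a square from the pushout-product
of `U i` and `U j` to `U` of the pushout-product of `i` and `j` for the smash product. Its
components are epimorphisms (`SmashData.comparison`), so a coalgebra structure descends along it as
soon as its structure map does (`AWFS.CoalgStr.ofEpi`). Dually, the transposed squares between
pullback-homs have monic components (`SmashData.homComparison`), and algebra structures restrict
along them (`AWFS.AlgStr.ofMono`). The map `λ` for the smash product is induced on the quotient by
`λ` for the monoidal product; this needs `λ` to be constant on base points, which holds because the
restriction of `λ` along the left factors is forced: applying the coalgebra axioms to free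
coalgebras expresses it through the left factor of the pushout-product (`map_l_app_lam`,
`obj_map_l_lam`). Hence every two-variable adjunction of algebraic weak factorization systems lifts
(`SmashData.twoVarAWFS`).

*Unit axiom.* As `*` is cofibrant, so is `S⁰` as a pointed object. Tensoring with a cofibrant object
preserves trivial cofibrations, being a pushout-product with `∅ ⟶ X`, and hence preserves weak
equivalences between cofibrant objects by Ken Brown's lemma (`AlgModelStr.W_map_of_isCofibrant`);
the counit of the cofibrant replacement of `S⁰` is one of these.

*Symmetry and coherence.* Both are equations between maps out of a smash product, and follow from
the corresponding equations in `M` after precomposition with `q`.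
-/

namespace AlgModel

/-! ### Zero maps into pointed objects -/

section Pointed

variable {M : Type u} [Category.{v} M] {pt : M}

/-- The base point of an object under `pt`. -/
def base (X : Under pt) : pt ⟶ X.right := X.hom

@[simp]
lemma base_right {X Y : Under pt} (f : X ⟶ Y) : base X ≫ f.right = base Y := Under.w f

lemma base_right_assoc {X Y : Under pt} (f : X ⟶ Y) {Z : M} (h : Y.right ⟶ Z) :
    base X ≫ f.right ≫ h = base Y ≫ h := by
  rw [← Category.assoc, base_right]

/-- The map from an arbitrary object to a pointed object which is constant at the base point. -/
def zeroMap (ht : IsTerminal pt) (T : M) (Z : Under pt) : T ⟶ Z.right := ht.from T ≫ base Z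

variable {ht : IsTerminal pt}

@[simp]
lemma comp_zeroMap {T T' : M} (f : T ⟶ T') (Z : Under pt) :
    f ≫ zeroMap ht T' Z = zeroMap ht T Z := by
  rw [zeroMap, zeroMap, ← Category.assoc, ht.hom_ext (f ≫ ht.from T') (ht.from T)]

@[simp]
lemma zeroMap_right (T : M) {Z Z' : Under pt} (g : Z ⟶ Z') :
    zeroMap ht T Z ≫ g.right = zeroMap ht T Z' := by
  rw [zeroMap, zeroMap, Category.assoc, base_right]

lemma zeroMap_right_right (T : M) {Z Z' Z'' : Under pt} (f : Z ⟶ Z') (g : Z' ⟶ Z'') :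
    zeroMap ht T Z ≫ f.right ≫ g.right = zeroMap ht T Z'' := by
  rw [← Under.comp_right, zeroMap_right]

lemma base_eq_zeroMap (Z : Under pt) : base Z = zeroMap ht pt Z := by
  rw [zeroMap, ht.hom_ext (ht.from pt) (𝟙 pt), Category.id_comp]

lemma zeroMap_pt (Z : Under pt) : zeroMap ht pt Z = base Z := (base_eq_zeroMap Z).symm

/-- Two maps out of a pointed object which agree on underlying maps agree. -/
lemma under_ext {X Y : Under pt} {f g : X ⟶ Y} (h : f.right = g.right) : f = g :=
  Under.UnderMorphism.ext h

/-- Two maps into a pullback of pointed objects which agree after both projections are equal, even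
when they do not preserve base points: they extend to pointed maps from the free pointed object
on their source. -/
lemma under_isPullback_hom_ext [HasBinaryCoproducts M] {P X Y Z : Under pt} {f : P ⟶ X} {g : P ⟶ Y}
    {h : X ⟶ Z} {k : Y ⟶ Z} (sq : IsPullback f g h k) {T : M} {a b : T ⟶ P.right}
    (h₁ : a ≫ f.right = b ≫ f.right) (h₂ : a ≫ g.right = b ≫ g.right) : a = b := by
  have key : ∀ {W : Under pt} (k : P ⟶ W), a ≫ k.right = b ≫ k.right →
      coprod.desc (base P) a ≫ k.right = coprod.desc (base P) b ≫ k.right := fun k hk => by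
    rw [coprod.desc_comp, coprod.desc_comp, hk]
  have e := sq.hom_ext
    (k := (Under.homMk (coprod.desc (base P) a) (coprod.inl_desc _ _) :
      Under.mk (coprod.inl : pt ⟶ pt ⨿ T) ⟶ P))
    (l := Under.homMk (coprod.desc (base P) b) (coprod.inl_desc _ _))
    (by exact under_ext (key f h₁)) (by exact under_ext (key g h₂))
  have e' : coprod.desc (base P) a = coprod.desc (base P) b := congrArg CommaMorphism.right e
  rw [← coprod.inr_desc (base P) a, e', coprod.inr_desc]

end Pointed

/-! ### Bifunctors from parametrized families of adjunctions -/

section ParamAdj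

variable {K : Type u₁} {M : Type u₂} {N : Type u₃}
  [Category.{v₁} K] [Category.{v₂} M] [Category.{v₃} N]

/-- A family of right adjoints of the functors `F.obj k` assembles to a bifunctor, which acts on
the first variable by conjugation. -/
@[simps]
def conjugateBifunctor (F : K ⥤ M ⥤ N) (G : K → N ⥤ M) (adj : ∀ k, F.obj k ⊣ G k) :
    Kᵒᵖ ⥤ N ⥤ M where
  obj k := G k.unop
  map f := conjugateEquiv (adj _) (adj _) (F.map f.unop)
  map_id k := by
    rw [unop_id, F.map_id]
    exact conjugateEquiv_id (adj k.unop)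
  map_comp f g := by
    rw [unop_comp, F.map_comp, conjugateEquiv_comp]

/-- The parametrized adjunction given by a family of adjunctions. -/
def paramAdjOfAdj (F : K ⥤ M ⥤ N) (G : K → N ⥤ M) (adj : ∀ k, F.obj k ⊣ G k) :
    F ⊣₂ conjugateBifunctor F G adj :=
  ParametrizedAdjunction.mk' adj fun {X Y} f {A B} g => by
    have h : (F.obj X).map ((conjugateEquiv (adj Y) (adj X) (F.map f)).app B) ≫
        (adj X).counit.app B = (F.map f).app _ ≫ (adj Y).counit.app B :=
      conjugateEquiv_counit (adj Y) (adj X) (F.map f) B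
    change (adj X).homEquiv A B ((F.map f).app A ≫ g) =
      (adj Y).homEquiv A B g ≫ (conjugateEquiv (adj Y) (adj X) (F.map f)).app B
    rw [← Equiv.eq_symm_apply, Adjunction.homEquiv_naturality_left_symm,
      (adj X).homEquiv_counit, h, NatTrans.naturality_assoc, ← (adj Y).homEquiv_counit,
      Equiv.symm_apply_apply]

lemma adjunctionOfEquivRight_homEquiv {F : M ⥤ N} {G_obj : N → M}
    (e : ∀ X Y, (F.obj X ⟶ Y) ≃ (X ⟶ G_obj Y))
    (he : ∀ X' X Y f g, e X' Y (F.map f ≫ g) = f ≫ e X Y g) (X : M) (Y : N) (g : F.obj X ⟶ Y) :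
    (Adjunction.adjunctionOfEquivRight e he).homEquiv X Y g = e X Y g := by
  rw [Adjunction.adjunctionOfEquivRight, Adjunction.mkOfHomEquiv_homEquiv]

end ParamAdj

/-! ### Smash products relative to a bifunctor -/

section Smash

variable {M : Type u} [Category.{v} M] {pt : M}

/-- A smash product for a bifunctor `F` on `M`, on the category of objects under a terminal object:
a bifunctor `S` with quotient maps `q : F(X, Y) ⟶ S(X, Y)`, universal among the maps from
`F(X, Y)` to pointed objects which are constant at the base point on `F(*, Y)` and on `F(X, *)`.
This notion is symmetric in the two variables. -/
structure SmashData (ht : IsTerminal pt) (F : M ⥤ M ⥤ M) where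
  S : Under pt ⥤ Under pt ⥤ Under pt
  q : ∀ X Y : Under pt, (F.obj X.right).obj Y.right ⟶ ((S.obj X).obj Y).right
  nat_left : ∀ {X X' : Under pt} (f : X ⟶ X') (Y : Under pt),
    (F.map f.right).app Y.right ≫ q X' Y = q X Y ≫ ((S.map f).app Y).right
  nat_right : ∀ (X : Under pt) {Y Y' : Under pt} (g : Y ⟶ Y'),
    (F.obj X.right).map g.right ≫ q X Y' = q X Y ≫ ((S.obj X).map g).right
  epi_q : ∀ X Y, Epi (q X Y)
  zero_left : ∀ X Y, (F.map (base X)).app Y.right ≫ q X Y = zeroMap ht _ _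
  zero_right : ∀ X Y, (F.obj X.right).map (base Y) ≫ q X Y = zeroMap ht _ _
  desc : ∀ {X Y Z : Under pt} (g : (F.obj X.right).obj Y.right ⟶ Z.right)
    (_ : (F.map (base X)).app Y.right ≫ g = zeroMap ht _ _)
    (_ : (F.obj X.right).map (base Y) ≫ g = zeroMap ht _ _), (S.obj X).obj Y ⟶ Z
  q_desc : ∀ {X Y Z : Under pt} (g : (F.obj X.right).obj Y.right ⟶ Z.right)
    (h₁ : (F.map (base X)).app Y.right ≫ g = zeroMap ht _ _)
    (h₂ : (F.obj X.right).map (base Y) ≫ g = zeroMap ht _ _), q X Y ≫ (desc g h₁ h₂).right = g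

namespace SmashData

attribute [instance] epi_q
attribute [simp] zero_left zero_right q_desc

variable {ht : IsTerminal pt} {F : M ⥤ M ⥤ M} (Sm : SmashData ht F)

/-- The smash product with the two variables interchanged. -/
@[simps]
def flip : SmashData ht F.flip where
  S := Sm.S.flip
  q X Y := Sm.q Y X
  nat_left f Y := Sm.nat_right Y f
  nat_right X _ _ g := Sm.nat_left g X
  epi_q X Y := Sm.epi_q Y X
  zero_left X Y := Sm.zero_right Y X
  zero_right X Y := Sm.zero_left Y X
  desc g h₁ h₂ := Sm.desc g h₂ h₁
  q_desc g h₁ h₂ := Sm.q_desc g h₂ h₁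

lemma nat_left_assoc {X X' : Under pt} (f : X ⟶ X') (Y : Under pt) {Z : M}
    (h : ((Sm.S.obj X').obj Y).right ⟶ Z) :
    (F.map f.right).app Y.right ≫ Sm.q X' Y ≫ h = Sm.q X Y ≫ ((Sm.S.map f).app Y).right ≫ h := by
  rw [← Category.assoc, Sm.nat_left, Category.assoc]

lemma nat_right_assoc (X : Under pt) {Y Y' : Under pt} (g : Y ⟶ Y') {Z : M}
    (h : ((Sm.S.obj X).obj Y').right ⟶ Z) :
    (F.obj X.right).map g.right ≫ Sm.q X Y' ≫ h = Sm.q X Y ≫ ((Sm.S.obj X).map g).right ≫ h := by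
  rw [← Category.assoc, Sm.nat_right, Category.assoc]

lemma zero_left_assoc (X Y : Under pt) {Z : M} (h : ((Sm.S.obj X).obj Y).right ⟶ Z) :
    (F.map (base X)).app Y.right ≫ Sm.q X Y ≫ h = zeroMap ht _ _ ≫ h := by
  rw [← Category.assoc, Sm.zero_left]

lemma zero_right_assoc (X Y : Under pt) {Z : M} (h : ((Sm.S.obj X).obj Y).right ⟶ Z) :
    (F.obj X.right).map (base Y) ≫ Sm.q X Y ≫ h = zeroMap ht _ _ ≫ h := by
  rw [← Category.assoc, Sm.zero_right]

lemma hom_ext {X Y Z : Under pt} {f g : (Sm.S.obj X).obj Y ⟶ Z}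
    (h : Sm.q X Y ≫ f.right = Sm.q X Y ≫ g.right) : f = g :=
  under_ext ((cancel_epi (Sm.q X Y)).1 h)

section Hom

variable {G : Mᵒᵖ ⥤ M ⥤ M} (adj : F ⊣₂ G) [HasEqualizers M]

/-- The object of pointed maps from `B` to `X`: the equalizer of restriction to the base point and
the constant map. -/
noncomputable def homObj (_ : SmashData ht F) (B X : Under pt) : Under pt :=
  Under.mk (Y := equalizer ((G.map (base B).op).app X.right) (adj.homEquiv (zeroMap ht _ X)))
    (equalizer.lift (adj.homEquiv (zeroMap ht _ X)) (by
      rw [← adj.homEquiv_naturality_one, ← adj.homEquiv_naturality_two, comp_zeroMap,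
        comp_zeroMap]))

/-- The inclusion of the object of pointed maps. -/
noncomputable def homι (B X : Under pt) :
    (Sm.homObj adj B X).right ⟶ (G.obj (op B.right)).obj X.right :=
  equalizer.ι _ _

instance mono_homι (B X : Under pt) : Mono (Sm.homι adj B X) :=
  inferInstanceAs (Mono (equalizer.ι _ _))

lemma base_homι (B X : Under pt) :
    base (Sm.homObj adj B X) ≫ Sm.homι adj B X = adj.homEquiv (zeroMap ht _ X) :=
  equalizer.lift_ι _ _

lemma homι_condition (B X : Under pt) :
    Sm.homι adj B X ≫ (G.map (base B).op).app X.right = adj.homEquiv (zeroMap ht _ X) := by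
  refine (equalizer.condition _ _).trans ?_
  rw [← adj.homEquiv_naturality_two, comp_zeroMap]
  rfl

/-- Pointed maps `S(B, Y) ⟶ X` correspond to pointed maps from `Y` to the object of pointed maps
from `B` to `X`: both are maps `F(B, Y) ⟶ X` which are constant on `F(*, Y)` and `F(B, *)`. -/
noncomputable def homEquiv (B Y X : Under pt) :
    ((Sm.S.obj B).obj Y ⟶ X) ≃ (Y ⟶ Sm.homObj adj B X) where
  toFun g := Under.homMk (equalizer.lift (adj.homEquiv (Sm.q B Y ≫ g.right)) (by
      rw [← adj.homEquiv_naturality_one, ← adj.homEquiv_naturality_two, comp_zeroMap,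
        Sm.zero_left_assoc, zeroMap_right])) (by
      refine (cancel_mono (Sm.homι adj B X)).1 ?_
      refine ((Category.assoc _ _ _).trans
        (congrArg (base Y ≫ ·) (equalizer.lift_ι _ _))).trans ?_
      refine Eq.trans ?_ (Sm.base_homι adj B X).symm
      rw [← adj.homEquiv_naturality_two, Sm.zero_right_assoc, zeroMap_right])
  invFun f := Sm.desc (adj.homEquiv.symm (f.right ≫ Sm.homι adj B X))
    (by
      rw [← adj.homEquiv_symm_naturality_one, Category.assoc, homι_condition,
        ← adj.homEquiv_naturality_two, comp_zeroMap, Equiv.symm_apply_apply])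
    (by
      rw [← adj.homEquiv_symm_naturality_two, base_right_assoc, base_homι,
        Equiv.symm_apply_apply])
  left_inv g := by
    refine Sm.hom_ext ?_
    rw [q_desc]
    refine (adj.homEquiv.symm_apply_eq).2 ?_
    exact equalizer.lift_ι _ _
  right_inv f := by
    refine under_ext ((cancel_mono (Sm.homι adj B X)).1 ?_)
    refine (equalizer.lift_ι _ _).trans ?_
    rw [q_desc, Equiv.apply_symm_apply]

lemma homEquiv_right_homι {B Y X : Under pt} (g : (Sm.S.obj B).obj Y ⟶ X) :
    (Sm.homEquiv adj B Y X g).right ≫ Sm.homι adj B X = adj.homEquiv (Sm.q B Y ≫ g.right) :=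
  equalizer.lift_ι _ _

lemma homEquiv_naturality (B : Under pt) (Y' Y X : Under pt) (f : Y' ⟶ Y)
    (g : (Sm.S.obj B).obj Y ⟶ X) :
    Sm.homEquiv adj B Y' X ((Sm.S.obj B).map f ≫ g) = f ≫ Sm.homEquiv adj B Y X g := by
  refine under_ext ((cancel_mono (Sm.homι adj B X)).1 ?_)
  rw [homEquiv_right_homι, Under.comp_right, Under.comp_right, Category.assoc, homEquiv_right_homι,
    ← adj.homEquiv_naturality_two, ← Sm.nat_right_assoc]

/-- The bifunctor of objects of pointed maps. -/
noncomputable def homFunctor : (Under pt)ᵒᵖ ⥤ Under pt ⥤ Under pt :=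
  conjugateBifunctor Sm.S
    (fun B => Adjunction.rightAdjointOfEquiv (Sm.homEquiv adj B) (Sm.homEquiv_naturality adj B))
    (fun B => Adjunction.adjunctionOfEquivRight (Sm.homEquiv adj B) (Sm.homEquiv_naturality adj B))

/-- The smash product is left adjoint to the bifunctor of objects of pointed maps. -/
noncomputable def smashAdj : Sm.S ⊣₂ Sm.homFunctor adj := paramAdjOfAdj _ _ _

/-- The inclusion of the object of pointed maps, as the value of the bifunctor. -/
noncomputable def ι (B X : Under pt) :
    (((Sm.homFunctor adj).obj (op B)).obj X).right ⟶ (G.obj (op B.right)).obj X.right :=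
  Sm.homι adj B X

instance (B X : Under pt) : Mono (Sm.ι adj B X) := Sm.mono_homι adj B X

lemma smashAdj_homEquiv_ι {B Y X : Under pt} (g : (Sm.S.obj B).obj Y ⟶ X) :
    ((Sm.smashAdj adj).homEquiv g).right ≫ Sm.ι adj B X =
      adj.homEquiv (Sm.q B Y ≫ g.right) := by
  refine Eq.trans ?_ (Sm.homEquiv_right_homι adj g)
  have h : (Sm.smashAdj adj).homEquiv g = Sm.homEquiv adj B Y X g :=
    adjunctionOfEquivRight_homEquiv (Sm.homEquiv adj B) (Sm.homEquiv_naturality adj B) Y X g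
  rw [h]
  rfl

end Hom

/-- The two-variable adjunction of the smash product. -/
noncomputable def twoVarAdj [HasEqualizers M] (T : TwoVarAdj F) : TwoVarAdj Sm.S where
  homL := Sm.homFunctor T.adjL
  homR := Sm.flip.homFunctor T.adjR
  adjL := Sm.smashAdj T.adjL
  adjR := Sm.flip.smashAdj T.adjR

end SmashData

end Smash

end AlgModel

namespace AlgModel

open AWFS

/-! ### Transport of coalgebra and algebra structures -/

section Transport

variable {C : Type u} [Category.{v} C] {A : AWFS C}

/-- A coalgebra structure descends along a square whose components are epimorphisms as soon as
its structure map does. -/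
def AWFS.CoalgStr.ofEpi {f g : Arrow C} (k : f ⟶ g) [Epi k.left] [Epi k.right]
    (S : A.CoalgStr f) (s : g.right ⟶ A.E.obj g) (h : k.right ≫ s = S.s ≫ A.E.map k) :
    A.CoalgStr g where
  s := s
  hom_s := by
    rw [← cancel_epi k.left, ← A.l_map, ← S.hom_s, Category.assoc, ← h, ← Category.assoc,
      ← Category.assoc, Arrow.w]
  counit := by
    rw [← cancel_epi k.right, reassoc_of% h, A.map_r, ← Category.assoc, S.counit, Category.id_comp,
      Category.comp_id]
  coassoc := by
    rw [← cancel_epi k.right, reassoc_of% h, reassoc_of% h, A.map_δ]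
    refine ((Category.assoc _ _ _).symm.trans (congrArg (· ≫ A.E.map (A.lFun.map k))
      S.coassoc)).trans ((Category.assoc _ _ _).trans ?_)
    refine congrArg (S.s ≫ ·) ((A.E.map_comp _ _).symm.trans (Eq.trans ?_ (A.E.map_comp _ _)))
    refine congrArg (A.E.map ·) (Arrow.hom_ext _ _ ?_ h.symm)
    exact (Category.id_comp _).trans (Category.comp_id _).symm

/-- An algebra structure restricts along a square whose components are monomorphisms as soon as
its structure map does. -/
def AWFS.AlgStr.ofMono {f g : Arrow C} (k : g ⟶ f) [Mono k.left] [Mono k.right]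
    (S : A.AlgStr f) (t : A.E.obj g ⟶ g.left) (h : t ≫ k.left = A.E.map k ≫ S.t) :
    A.AlgStr g where
  t := t
  t_hom := by
    rw [← cancel_mono k.right, ← A.map_r, ← S.t_hom, ← Category.assoc, ← h, Category.assoc,
      Category.assoc, Arrow.w]
  unit := by
    rw [← cancel_mono k.left, Category.assoc, h, ← Category.assoc, A.l_map, Category.assoc, S.unit,
      Category.id_comp, Category.comp_id]
  assoc := by
    rw [← cancel_mono k.left, Category.assoc, Category.assoc]
    refine (congrArg (A.μ g ≫ ·) h).trans (Eq.trans ?_ (congrArg (A.E.map _ ≫ ·) h.symm))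
    refine (Category.assoc _ _ _).symm.trans ((congrArg (· ≫ S.t) (A.map_μ k).symm).trans ?_)
    refine (Category.assoc _ _ _).trans ?_
    refine (congrArg (A.E.map (A.rFun.map k) ≫ ·) S.assoc).trans ?_
    refine (Category.assoc _ _ _).symm.trans (Eq.trans ?_ (Category.assoc _ _ _))
    refine congrArg (· ≫ S.t) ((A.E.map_comp _ _).symm.trans (Eq.trans ?_ (A.E.map_comp _ _)))
    refine congrArg (A.E.map ·) (Arrow.hom_ext _ _ h.symm ?_)
    exact (Category.comp_id _).trans (Category.id_comp _).symm

/-- The free coalgebra on an arrow. -/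
def AWFS.free (A : AWFS C) (f : Arrow C) : A.Coalg :=
  CoalgStr.toCoalg (f := Arrow.mk (A.l f)) ⟨A.δ f, A.l_δ f, A.left_counit f, A.coassoc f⟩

variable {X : C}

/-- A coalgebra structure on the underlying arrow whose structure map is pointed. -/
@[simps]
def AWFS.CoalgStr.toUnder {f : Arrow (Under X)} (s : f.right ⟶ (A.under X).E.obj f)
    (S : A.CoalgStr (uArr f)) (h : s.right = S.s) : (A.under X).CoalgStr f where
  s := s
  hom_s := under_ext ((congrArg (f.hom.right ≫ ·) h).trans S.hom_s)
  counit := under_ext ((congrArg (· ≫ A.r (uArr f)) h).trans S.counit)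
  coassoc := under_ext (by
    obtain ⟨S, h₁, h₂, h₃⟩ := S
    cases h
    exact h₃)

/-- An algebra structure on the underlying arrow whose structure map is pointed. -/
@[simps]
def AWFS.AlgStr.toUnder {f : Arrow (Under X)} (t : (A.under X).E.obj f ⟶ f.left)
    (S : A.AlgStr (uArr f)) (h : t.right = S.t) : (A.under X).AlgStr f where
  t := t
  t_hom := under_ext ((congrArg (· ≫ f.hom.right) h).trans S.t_hom)
  unit := under_ext ((congrArg (A.l (uArr f) ≫ ·) h).trans S.unit)
  assoc := under_ext (by
    obtain ⟨S, h₁, h₂, h₃⟩ := S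
    cases h
    exact h₃)

/-- The underlying coalgebra of a coalgebra for the lifted system. -/
def AWFS.Coalg.ofUnder (i : (A.under X).Coalg) : A.Coalg :=
  CoalgStr.toCoalg (f := uArr i.A)
    { s := (Coalg.s i).right
      hom_s := congrArg CommaMorphism.right (Coalg.str i).hom_s
      counit := congrArg CommaMorphism.right (Coalg.str i).counit
      coassoc := congrArg CommaMorphism.right (Coalg.str i).coassoc }

/-- The underlying algebra of an algebra for the lifted system. -/
def AWFS.Alg.ofUnder (f : (A.under X).Alg) : A.Alg :=
  AlgStr.toAlg (f := uArr f.A)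
    { t := (Alg.t f).right
      t_hom := congrArg CommaMorphism.right (Alg.str f).t_hom
      unit := congrArg CommaMorphism.right (Alg.str f).unit
      assoc := congrArg CommaMorphism.right (Alg.str f).assoc }

end Transport

/-! ### Naturality of pushout-products and their transposition -/

section Leibniz

variable {K : Type u₁} {M : Type u₂} {N : Type u₃}
  [Category.{v₁} K] [Category.{v₂} M] [Category.{v₃} N]

open Functor

/-- The transposition between pushout-products and pullback-homs is natural in the variable which is
not a parameter.  The map `m` between pushout-products is specified by its components. -/
lemma arrowHomEquiv_naturality {F : K ⥤ M ⥤ N} {G : Kᵒᵖ ⥤ N ⥤ M} (adj : F ⊣₂ G)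
    {X₁ Y₁ : K} {i : X₁ ⟶ Y₁} {j j' : Arrow M} {X₃ Y₃ : N} {f : X₃ ⟶ Y₃}
    (sq : F.PushoutObjObj i j.hom) (sq' : F.PushoutObjObj i j'.hom) (sqp : G.PullbackObjObj i f)
    (b : j ⟶ j') (m : Arrow.mk sq.ι ⟶ Arrow.mk sq'.ι)
    (hl : sq.inl ≫ m.left = (F.obj Y₁).map b.left ≫ sq'.inl)
    (hr : sq.inr ≫ m.left = (F.obj X₁).map b.right ≫ sq'.inr)
    (h : m.right = (F.obj Y₁).map b.right) (a : Arrow.mk sq'.ι ⟶ Arrow.mk f) :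
    adj.arrowHomEquiv sq sqp (m ≫ a) = b ≫ adj.arrowHomEquiv sq' sqp a := by
  refine Arrow.hom_ext _ _ ?_ (sqp.isPullback.hom_ext ?_ ?_)
  · change adj.homEquiv (sq.inl ≫ m.left ≫ a.left) = b.left ≫ adj.homEquiv (sq'.inl ≫ a.left)
    rw [← adj.homEquiv_naturality_two, reassoc_of% hl]
  · refine (adj.arrowHomEquiv_apply_right_fst sq sqp (m ≫ a)).trans ?_
    refine Eq.trans ?_ ((congrArg (b.right ≫ ·)
      (adj.arrowHomEquiv_apply_right_fst sq' sqp a).symm).trans (Category.assoc _ _ _).symm)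
    rw [← adj.homEquiv_naturality_two, Arrow.comp_left, reassoc_of% hr]
  · refine (adj.arrowHomEquiv_apply_right_snd sq sqp (m ≫ a)).trans ?_
    refine Eq.trans ?_ ((congrArg (b.right ≫ ·)
      (adj.arrowHomEquiv_apply_right_snd sq' sqp a).symm).trans (Category.assoc _ _ _).symm)
    rw [← adj.homEquiv_naturality_two, Arrow.comp_right, h]

variable (F : K ⥤ M ⥤ N) [HasPushouts N]

/-- The first inclusion into the domain of a pushout-product. -/
noncomputable def leibInl (i : Arrow K) (j : Arrow M) :
    (F.obj i.right).obj j.left ⟶ ((F.leibnizPushout.obj i).obj j).left :=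
  (PushoutObjObj.ofHasPushout F i.hom j.hom).inl

/-- The second inclusion into the domain of a pushout-product. -/
noncomputable def leibInr (i : Arrow K) (j : Arrow M) :
    (F.obj i.left).obj j.right ⟶ ((F.leibnizPushout.obj i).obj j).left :=
  (PushoutObjObj.ofHasPushout F i.hom j.hom).inr

variable {F}

lemma leib_isPushout (i : Arrow K) (j : Arrow M) :
    IsPushout ((F.map i.hom).app j.left) ((F.obj i.left).map j.hom) (leibInl F i j)
      (leibInr F i j) :=
  (PushoutObjObj.ofHasPushout F i.hom j.hom).isPushout

lemma leib_hom_ext {i : Arrow K} {j : Arrow M} {Z : N}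
    {a b : ((F.leibnizPushout.obj i).obj j).left ⟶ Z}
    (hl : leibInl F i j ≫ a = leibInl F i j ≫ b)
    (hr : leibInr F i j ≫ a = leibInr F i j ≫ b) : a = b :=
  (leib_isPushout i j).hom_ext hl hr

lemma leibInl_map_left {i i' : Arrow K} (a : i ⟶ i') (j : Arrow M) :
    leibInl F i j ≫ ((F.leibnizPushout.map a).app j).left =
      (F.map a.right).app j.left ≫ leibInl F i' j := IsPushout.inl_desc ..

lemma leibInr_map_left {i i' : Arrow K} (a : i ⟶ i') (j : Arrow M) :
    leibInr F i j ≫ ((F.leibnizPushout.map a).app j).left =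
      (F.map a.left).app j.right ≫ leibInr F i' j := IsPushout.inr_desc ..

lemma leibInl_obj_map_left (i : Arrow K) {j j' : Arrow M} (b : j ⟶ j') :
    leibInl F i j ≫ ((F.leibnizPushout.obj i).map b).left =
      (F.obj i.right).map b.left ≫ leibInl F i j' := IsPushout.inl_desc ..

lemma leibInr_obj_map_left (i : Arrow K) {j j' : Arrow M} (b : j ⟶ j') :
    leibInr F i j ≫ ((F.leibnizPushout.obj i).map b).left =
      (F.obj i.left).map b.right ≫ leibInr F i j' := IsPushout.inr_desc ..

/-- The pushout-product of two arrows, as a map to the value of the bifunctor. -/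
noncomputable def leibHom (F : K ⥤ M ⥤ N) (i : Arrow K) (j : Arrow M) :
    ((F.leibnizPushout.obj i).obj j).left ⟶ (F.obj i.right).obj j.right :=
  ((F.leibnizPushout.obj i).obj j).hom

lemma leibInl_hom (i : Arrow K) (j : Arrow M) :
    leibInl F i j ≫ leibHom F i j = (F.obj i.right).map j.hom :=
  (PushoutObjObj.ofHasPushout F i.hom j.hom).inl_ι

lemma leibInr_hom (i : Arrow K) (j : Arrow M) :
    leibInr F i j ≫ leibHom F i j = (F.map i.hom).app j.right :=
  (PushoutObjObj.ofHasPushout F i.hom j.hom).inr_ι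

lemma hatEquivL_symm_naturality [HasPullbacks M] (T : TwoVarAdj F)
    (i : Arrow K) {j j' : Arrow M} (f : Arrow N) (b : j ⟶ j')
    (c : j' ⟶ (T.homL.leibnizPullback.obj (op i)).obj f) :
    (F.leibnizPushout.obj i).map b ≫ (T.hatEquivL i j' f).symm c =
      (T.hatEquivL i j f).symm (b ≫ c) := by
  rw [Equiv.eq_symm_apply]
  refine (arrowHomEquiv_naturality T.adjL (.ofHasPushout F i.hom j.hom)
    (.ofHasPushout F i.hom j'.hom) _ b _ (leibInl_obj_map_left i b)
    (leibInr_obj_map_left i b) rfl _).trans ?_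
  exact congrArg (b ≫ ·) ((T.hatEquivL i j' f).apply_symm_apply c)

lemma hatEquivR_symm_naturality [HasPullbacks K] (T : TwoVarAdj F)
    {i i' : Arrow K} (j : Arrow M) (f : Arrow N) (a : i ⟶ i')
    (c : i' ⟶ (T.homR.leibnizPullback.obj (op j)).obj f) :
    (F.leibnizPushout.map a).app j ≫ (T.hatEquivR i' j f).symm c =
      (T.hatEquivR i j f).symm (a ≫ c) := by
  rw [Equiv.eq_symm_apply]
  refine (arrowHomEquiv_naturality T.adjR (Functor.PushoutObjObj.ofHasPushout F i.hom j.hom).flip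
    (Functor.PushoutObjObj.ofHasPushout F i'.hom j.hom).flip _ a _
    (leibInr_map_left a j) (leibInl_map_left a j) rfl _).trans ?_
  exact congrArg (a ≫ ·) ((T.hatEquivR i' j f).apply_symm_apply c)

end Leibniz

/-! ### The mates of a natural transformation `λ` -/

section Mates

variable {K : Type u₁} {M : Type u₂} {N : Type u₃}
  [Category.{v₁} K] [Category.{v₂} M] [Category.{v₃} N]
  {F : K ⥤ M ⥤ N} [HasPushouts N] {A : AWFS K} {B : AWFS M} {D : AWFS N}

lemma rhoL_comp [HasPullbacks M] (lam : TensorTrans F A B D) (T : TwoVarAdj F) {i : Arrow K}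
    {f : Arrow N} {Y : K} (s : Y ⟶ A.E.obj i) {Z : N} (t : D.E.obj f ⟶ Z) :
    lam.rhoL T i f ≫ (T.homL.map s.op).app (D.E.obj f) ≫ (T.homL.obj (op Y)).map t =
      T.adjL.homEquiv ((F.map s).app _ ≫ lam.lam i _ ≫
        D.E.map ((T.hatEquivL i _ f).symm (𝟙 _)) ≫ t) := by
  rw [ParametrizedAdjunction.homEquiv_naturality_one, ← Category.assoc (lam.lam i _),
    ParametrizedAdjunction.homEquiv_naturality_three, Category.assoc, NatTrans.naturality]
  rfl

lemma rhoR_comp [HasPullbacks K] (lam : TensorTrans F A B D) (T : TwoVarAdj F) {j : Arrow M}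
    {f : Arrow N} {Y : M} (s : Y ⟶ B.E.obj j) {Z : N} (t : D.E.obj f ⟶ Z) :
    lam.rhoR T j f ≫ (T.homR.map s.op).app (D.E.obj f) ≫ (T.homR.obj (op Y)).map t =
      T.adjR.homEquiv ((F.obj _).map s ≫ lam.lam _ j ≫
        D.E.map ((T.hatEquivR _ j f).symm (𝟙 _)) ≫ t) := by
  have h₁ := T.adjR.homEquiv_naturality_one s (lam.lam _ j ≫
    D.E.map ((T.hatEquivR _ j f).symm (𝟙 _)) ≫ t)
  have h₂ := T.adjR.homEquiv_naturality_three t (lam.lam _ j ≫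
    D.E.map ((T.hatEquivR _ j f).symm (𝟙 _)))
  refine Eq.trans ?_ h₁.symm
  rw [← NatTrans.naturality]
  refine (Category.assoc _ _ _).symm.trans (congrArg (· ≫ (T.homR.map s.op).app Z) ?_)
  exact h₂.symm.trans (congrArg (fun z => T.adjR.homEquiv z) (Category.assoc _ _ _))

end Mates

/-! ### The natural transformation `λ` and the two factors -/

section Lam

variable {K : Type u₁} {M : Type u₂} {N : Type u₃}
  [Category.{v₁} K] [Category.{v₂} M] [Category.{v₃} N]
  {F : K ⥤ M ⥤ N} {T : TwoVarAdj F} [HasPullbacks K] [HasPullbacks M] [HasPushouts N]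
  {A : AWFS K} {B : AWFS M} {D : AWFS N} (P : TwoVarAWFS T A B D)

/-- The transformation `λ` is determined by the coalgebra structures on pushout-products of free
coalgebras. -/
lemma lam_eq_free (i : Arrow K) (j : Arrow M) :
    P.lam i j = ((F.map (A.δ i)).app (B.E.obj j) ≫
      (F.obj (A.E.obj (Arrow.mk (A.l i)))).map (B.δ j) ≫
        P.lam (Arrow.mk (A.l i)) (Arrow.mk (B.l j))) ≫
      D.E.map ((F.leibnizPushout.map (A.eps i)).app (Arrow.mk (B.l j)) ≫
        (F.leibnizPushout.obj i).map (B.eps j)) := by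
  rw [D.E.map_comp, Category.assoc, Category.assoc, ← reassoc_of% P.naturality_left,
    ← P.naturality_right, NatTrans.naturality_assoc, ← NatTrans.comp_app_assoc,
    ← F.map_comp, A.right_counit, ← Functor.map_comp_assoc, B.right_counit]
  simp

/-- The first axiom for the coalgebra structure on the pushout-product of two free coalgebras. -/
lemma hom_free_lam (i : Arrow K) (j : Arrow M) :
    leibHom F (Arrow.mk (A.l i)) (Arrow.mk (B.l j)) ≫
      ((F.map (A.δ i)).app (B.E.obj j) ≫ (F.obj (A.E.obj (Arrow.mk (A.l i)))).map (B.δ j) ≫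
        P.lam (Arrow.mk (A.l i)) (Arrow.mk (B.l j))) = D.l _ :=
  (congrArg (leibHom F (Arrow.mk (A.l i)) (Arrow.mk (B.l j)) ≫ ·)
    (P.tensorStr_s (A.free i) (B.free j)).symm).trans (P.tensorStr (A.free i) (B.free j)).hom_s

/-- The restriction of `λ` to the domain of the pushout-product of the left factors. -/
lemma hom_lam (i : Arrow K) (j : Arrow M) :
    leibHom F (Arrow.mk (A.l i)) (Arrow.mk (B.l j)) ≫ P.lam i j =
      ((F.leibnizPushout.map (A.eps i)).app (Arrow.mk (B.l j)) ≫
        (F.leibnizPushout.obj i).map (B.eps j)).left ≫ D.l _ := by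
  rw [lam_eq_free]
  refine (Category.assoc _ _ _).symm.trans ((congrArg (· ≫ _) (hom_free_lam P i j)).trans ?_)
  exact D.l_map _

/-- The restriction of `λ` along the left factor in the first variable is forced. -/
lemma map_l_app_lam (i : Arrow K) (j : Arrow M) :
    (F.map (A.l i)).app (B.E.obj j) ≫ P.lam i j =
      (F.obj i.left).map (B.r j) ≫ leibInr F i j ≫ D.l _ := by
  have h := leibInr F (Arrow.mk (A.l i)) (Arrow.mk (B.l j)) ≫= hom_lam P i j
  rw [reassoc_of% leibInr_hom, Arrow.comp_left, Category.assoc, reassoc_of% leibInr_map_left,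
    reassoc_of% leibInr_obj_map_left] at h
  refine h.trans ?_
  simp

/-- The restriction of `λ` along the left factor in the second variable is forced. -/
lemma obj_map_l_lam (i : Arrow K) (j : Arrow M) :
    (F.obj (A.E.obj i)).map (B.l j) ≫ P.lam i j =
      (F.map (A.r i)).app j.left ≫ leibInl F i j ≫ D.l _ := by
  have h := leibInl F (Arrow.mk (A.l i)) (Arrow.mk (B.l j)) ≫= hom_lam P i j
  rw [reassoc_of% leibInl_hom, Arrow.comp_left, Category.assoc, reassoc_of% leibInl_map_left,
    reassoc_of% leibInl_obj_map_left] at h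
  refine h.trans ?_
  simp

end Lam

end AlgModel

namespace AlgModel

open AWFS Functor

namespace SmashData

variable {M : Type u} [Category.{v} M] {pt : M} {ht : IsTerminal pt} {F : M ⥤ M ⥤ M}
  (Sm : SmashData ht F)

/-! ### The comparison square between pushout-products -/

section Comparison

variable {i j : Arrow (Under pt)} (sq : F.PushoutObjObj (uArr i).hom (uArr j).hom)
  (sq' : Sm.S.PushoutObjObj i.hom j.hom)

/-- The comparison from the pushout-product of the underlying arrows to the underlying arrow of the
pushout-product for the smash product, for arbitrary choices of the pushouts. Its components are
induced by the quotient maps. -/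
noncomputable def comparison : Arrow.mk sq.ι ⟶ uArr (Arrow.mk sq'.ι) :=
  Arrow.homMk' (sq.isPushout.desc (Sm.q i.right j.left ≫ sq'.inl.right)
      (Sm.q i.left j.right ≫ sq'.inr.right) (by
        have h := congrArg CommaMorphism.right sq'.isPushout.w
        refine (Sm.nat_left_assoc i.hom j.left _).trans ?_
        refine Eq.trans ?_ (Sm.nat_right_assoc i.left j.hom _).symm
        exact congrArg (Sm.q i.left j.left ≫ ·) h))
    (Sm.q i.right j.right) (by
      refine sq.isPushout.hom_ext ?_ ?_
      · have h : sq'.inl.right ≫ sq'.ι.right = ((Sm.S.obj i.right).map j.hom).right :=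
          congrArg CommaMorphism.right sq'.inl_ι
        rw [sq.isPushout.inl_desc_assoc, sq.inl_ι_assoc, Category.assoc]
        refine (congrArg (Sm.q i.right j.left ≫ ·) h).trans ?_
        exact (Sm.nat_right i.right j.hom).symm
      · have h : sq'.inr.right ≫ sq'.ι.right = ((Sm.S.map i.hom).app j.right).right :=
          congrArg CommaMorphism.right sq'.inr_ι
        rw [sq.isPushout.inr_desc_assoc, sq.inr_ι_assoc, Category.assoc]
        refine (congrArg (Sm.q i.left j.right ≫ ·) h).trans ?_
        exact (Sm.nat_left i.hom j.right).symm)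

lemma inl_comparison_left :
    sq.inl ≫ (Sm.comparison sq sq').left = Sm.q i.right j.left ≫ sq'.inl.right :=
  sq.isPushout.inl_desc _ _ _

lemma inr_comparison_left :
    sq.inr ≫ (Sm.comparison sq sq').left = Sm.q i.left j.right ≫ sq'.inr.right :=
  sq.isPushout.inr_desc _ _ _

lemma comparison_flip :
    Sm.flip.comparison sq.flip sq'.flip = Sm.comparison sq sq' :=
  Arrow.hom_ext _ _ (sq.isPushout.hom_ext
    ((Sm.flip.inr_comparison_left sq.flip sq'.flip).trans (Sm.inl_comparison_left sq sq').symm)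
    ((Sm.flip.inl_comparison_left sq.flip sq'.flip).trans (Sm.inr_comparison_left sq sq').symm))
    rfl

instance epi_comparison_right : Epi (Sm.comparison sq sq').right := Sm.epi_q _ _

/-- The pushout in the codomain is one of pointed objects, and the maps to be compared are
arbitrary; they become pointed once their target is pointed by the common image of the base
point. -/
instance epi_comparison_left : Epi (Sm.comparison sq sq').left where
  left_cancellation {Z} a b h := by
    have hl : sq'.inl.right ≫ a = sq'.inl.right ≫ b := by
      rw [← cancel_epi (Sm.q i.right j.left), ← reassoc_of% Sm.inl_comparison_left sq sq', h,
        reassoc_of% Sm.inl_comparison_left sq sq']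
    have hr : sq'.inr.right ≫ a = sq'.inr.right ≫ b := by
      rw [← cancel_epi (Sm.q i.left j.right), ← reassoc_of% Sm.inr_comparison_left sq sq', h,
        reassoc_of% Sm.inr_comparison_left sq sq']
    have hb : base sq'.pt ≫ a = base sq'.pt ≫ b := by
      rw [← base_right sq'.inl, Category.assoc, Category.assoc, hl]
    have e : (Under.homMk a rfl : sq'.pt ⟶ Under.mk (base sq'.pt ≫ a)) =
        Under.homMk b hb.symm :=
      sq'.isPushout.hom_ext (under_ext hl) (under_ext hr)
    exact congrArg CommaMorphism.right e

/-! ### The comparison between pullback-homs -/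

variable {G : Mᵒᵖ ⥤ M ⥤ M} (adj : F ⊣₂ G) [HasEqualizers M]

/-- The transpose of the comparison between pushout-products, as a comparison from the underlying
arrow of the pullback-hom for the smash product to the pullback-hom of the underlying arrows. -/
noncomputable def homComparison {i f : Arrow (Under pt)}
    (sqp : G.PullbackObjObj (uArr i).hom (uArr f).hom)
    (sqp' : (Sm.homFunctor adj).PullbackObjObj i.hom f.hom)
    (sq : F.PushoutObjObj (uArr i).hom (uArr (Arrow.mk sqp'.π)).hom)
    (sq' : Sm.S.PushoutObjObj i.hom (Arrow.mk sqp'.π).hom) :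
    uArr (Arrow.mk sqp'.π) ⟶ Arrow.mk sqp.π :=
  adj.arrowHomEquiv sq sqp (Sm.comparison sq sq' ≫
    uSq (((Sm.smashAdj adj).arrowHomEquiv sq' sqp').symm (𝟙 _)))

variable {i f : Arrow (Under pt)}
    (sqp : G.PullbackObjObj (uArr i).hom (uArr f).hom)
    (sqp' : (Sm.homFunctor adj).PullbackObjObj i.hom f.hom)
    (sq : F.PushoutObjObj (uArr i).hom (uArr (Arrow.mk sqp'.π)).hom)
    (sq' : Sm.S.PushoutObjObj i.hom (Arrow.mk sqp'.π).hom)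

lemma homComparison_left :
    (Sm.homComparison adj sqp sqp' sq sq').left = Sm.ι adj i.right f.left := by
  have h := congrArg CommaMorphism.left
    (((Sm.smashAdj adj).arrowHomEquiv sq' sqp').apply_symm_apply (𝟙 _))
  have h' := Sm.smashAdj_homEquiv_ι adj
    (sq'.inl ≫ (((Sm.smashAdj adj).arrowHomEquiv sq' sqp').symm (𝟙 _)).left)
  refine (congrArg (fun z => adj.homEquiv z)
    ((reassoc_of% Sm.inl_comparison_left sq sq') _)).trans (h'.symm.trans ?_)
  exact (congrArg (fun z => z.right ≫ Sm.ι adj i.right f.left) h).trans (Category.id_comp _)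

lemma homComparison_right_fst :
    (Sm.homComparison adj sqp sqp' sq sq').right ≫ sqp.fst =
      sqp'.fst.right ≫ Sm.ι adj i.left f.left := by
  have h := (Sm.smashAdj adj).arrowHomEquiv_apply_right_fst sq' sqp'
    (((Sm.smashAdj adj).arrowHomEquiv sq' sqp').symm (𝟙 _))
  rw [Equiv.apply_symm_apply] at h
  have h' := Sm.smashAdj_homEquiv_ι adj
    (sq'.inr ≫ (((Sm.smashAdj adj).arrowHomEquiv sq' sqp').symm (𝟙 _)).left)
  refine (adj.arrowHomEquiv_apply_right_fst sq sqp _).trans ?_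
  refine (congrArg (fun z => adj.homEquiv z)
    ((reassoc_of% Sm.inr_comparison_left sq sq') _)).trans (h'.symm.trans ?_)
  exact (congrArg (fun z => z.right ≫ Sm.ι adj i.left f.left)
    (h.symm.trans (Category.id_comp sqp'.fst)))

lemma homComparison_right_snd :
    (Sm.homComparison adj sqp sqp' sq sq').right ≫ sqp.snd =
      sqp'.snd.right ≫ Sm.ι adj i.right f.right := by
  have h := (Sm.smashAdj adj).arrowHomEquiv_apply_right_snd sq' sqp'
    (((Sm.smashAdj adj).arrowHomEquiv sq' sqp').symm (𝟙 _))
  rw [Equiv.apply_symm_apply] at h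
  have h' := Sm.smashAdj_homEquiv_ι adj
    (((Sm.smashAdj adj).arrowHomEquiv sq' sqp').symm (𝟙 _)).right
  refine (adj.arrowHomEquiv_apply_right_snd sq sqp _).trans (h'.symm.trans ?_)
  exact (congrArg (fun z => z.right ≫ Sm.ι adj i.right f.right)
    (h.symm.trans (Category.id_comp sqp'.snd)))

instance mono_homComparison_left : Mono (Sm.homComparison adj sqp sqp' sq sq').left := by
  rw [homComparison_left]
  infer_instance

/-- The maps to be compared need not preserve base points, so the universal property of the pullback
of pointed objects is used in the form of `under_isPullback_hom_ext`. -/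
instance mono_homComparison_right [HasBinaryCoproducts M] :
    Mono (Sm.homComparison adj sqp sqp' sq sq').right where
  right_cancellation {Z} a b h := by
    refine under_isPullback_hom_ext sqp'.isPullback ?_ ?_
    · refine (cancel_mono (Sm.ι adj i.left f.left)).1 ?_
      rw [Category.assoc, Category.assoc, ← Sm.homComparison_right_fst adj sqp sqp' sq sq',
        reassoc_of% h]
    · refine (cancel_mono (Sm.ι adj i.right f.right)).1 ?_
      rw [Category.assoc, Category.assoc, ← Sm.homComparison_right_snd adj sqp sqp' sq sq',
        reassoc_of% h]

end Comparison

/-! ### Lifting two-variable adjunctions of algebraic weak factorization systems -/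

section Lift

variable [HasPushouts M] [HasPushouts (Under pt)]

/-- The comparison between pushout-products, for the chosen pushouts. -/
noncomputable def leibComparison (i j : Arrow (Under pt)) :
    (F.leibnizPushout.obj (uArr i)).obj (uArr j) ⟶ uArr ((Sm.S.leibnizPushout.obj i).obj j) :=
  Sm.comparison (.ofHasPushout F (uArr i).hom (uArr j).hom) (.ofHasPushout Sm.S i.hom j.hom)

lemma leibInl_leibComparison (i j : Arrow (Under pt)) :
    leibInl F (uArr i) (uArr j) ≫ (Sm.leibComparison i j).left =
      Sm.q i.right j.left ≫ (leibInl Sm.S i j).right :=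
  Sm.inl_comparison_left _ _

lemma leibInr_leibComparison (i j : Arrow (Under pt)) :
    leibInr F (uArr i) (uArr j) ≫ (Sm.leibComparison i j).left =
      Sm.q i.left j.right ≫ (leibInr Sm.S i j).right :=
  Sm.inr_comparison_left _ _

instance (i j : Arrow (Under pt)) : Epi (Sm.leibComparison i j).right :=
  Sm.epi_comparison_right _ _

instance (i j : Arrow (Under pt)) : Epi (Sm.leibComparison i j).left :=
  Sm.epi_comparison_left _ _

lemma leibComparison_map_left {i i' : Arrow (Under pt)} (a : i ⟶ i') (j : Arrow (Under pt)) :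
    Sm.leibComparison i j ≫ uSq ((Sm.S.leibnizPushout.map a).app j) =
      (F.leibnizPushout.map (uSq a)).app (uArr j) ≫ Sm.leibComparison i' j := by
  refine Arrow.hom_ext _ _ (leib_hom_ext ?_ ?_) (Sm.nat_left a.right j.right).symm
  · have h := congrArg CommaMorphism.right (leibInl_map_left (F := Sm.S) a j)
    rw [Arrow.comp_left, Arrow.comp_left, reassoc_of% Sm.leibInl_leibComparison,
      reassoc_of% leibInl_map_left, leibInl_leibComparison]
    exact (congrArg (Sm.q i.right j.left ≫ ·) h).trans
      (Sm.nat_left_assoc a.right j.left _).symm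
  · have h := congrArg CommaMorphism.right (leibInr_map_left (F := Sm.S) a j)
    rw [Arrow.comp_left, Arrow.comp_left, reassoc_of% Sm.leibInr_leibComparison,
      reassoc_of% leibInr_map_left, leibInr_leibComparison]
    exact (congrArg (Sm.q i.left j.right ≫ ·) h).trans
      (Sm.nat_left_assoc a.left j.right _).symm

lemma leibComparison_map_right (i : Arrow (Under pt)) {j j' : Arrow (Under pt)} (b : j ⟶ j') :
    Sm.leibComparison i j ≫ uSq ((Sm.S.leibnizPushout.obj i).map b) =
      (F.leibnizPushout.obj (uArr i)).map (uSq b) ≫ Sm.leibComparison i j' := by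
  refine Arrow.hom_ext _ _ (leib_hom_ext ?_ ?_) (Sm.nat_right i.right b.right).symm
  · have h := congrArg CommaMorphism.right (leibInl_obj_map_left (F := Sm.S) i b)
    rw [Arrow.comp_left, Arrow.comp_left, reassoc_of% Sm.leibInl_leibComparison,
      reassoc_of% leibInl_obj_map_left, leibInl_leibComparison]
    exact (congrArg (Sm.q i.right j.left ≫ ·) h).trans
      (Sm.nat_right_assoc i.right b.left _).symm
  · have h := congrArg CommaMorphism.right (leibInr_obj_map_left (F := Sm.S) i b)
    rw [Arrow.comp_left, Arrow.comp_left, reassoc_of% Sm.leibInr_leibComparison,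
      reassoc_of% leibInr_obj_map_left, leibInr_leibComparison]
    exact (congrArg (Sm.q i.left j.right ≫ ·) h).trans
      (Sm.nat_right_assoc i.left b.right _).symm

variable [HasPullbacks M] {T : TwoVarAdj F} {A B D : AWFS M} (P : TwoVarAWFS T A B D)

/-- The map `λ` is constant on the base point in the first variable, because the base point of `E i`
factors through the left factor of `i`, along which `λ` is forced. -/
lemma zero_left_lam (i j : Arrow (Under pt)) :
    (F.map (base ((A.under pt).E.obj i))).app ((B.under pt).E.obj j).right ≫
      P.lam (uArr i) (uArr j) ≫ D.E.map (Sm.leibComparison i j) =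
        zeroMap ht _ ((D.under pt).E.obj ((Sm.S.leibnizPushout.obj i).obj j)) := by
  refine Eq.trans (b := (F.map (base i.left)).app (B.E.obj (uArr j)) ≫
    (F.map (A.l (uArr i))).app (B.E.obj (uArr j)) ≫
      P.lam (uArr i) (uArr j) ≫ D.E.map (Sm.leibComparison i j)) ?_ ?_
  · rw [← NatTrans.comp_app_assoc, ← F.map_comp]
    rfl
  rw [reassoc_of% map_l_app_lam P, D.l_map,
    reassoc_of% Sm.leibInr_leibComparison]
  refine ((F.map (base i.left)).naturality_assoc (B.r (uArr j)) _).symm.trans ?_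
  refine (congrArg ((F.obj pt).map (B.r (uArr j)) ≫ ·)
    ((Sm.zero_left_assoc i.left j.right _).trans ?_)).trans (comp_zeroMap (ht := ht)
      ((F.obj pt).map (B.r (uArr j))) ((D.under pt).E.obj ((Sm.S.leibnizPushout.obj i).obj j)))
  exact zeroMap_right_right _ (leibInr Sm.S i j)
    ((D.under pt).l ((Sm.S.leibnizPushout.obj i).obj j))

/-- The map `λ` is constant on the base point in the second variable. -/
lemma zero_right_lam (i j : Arrow (Under pt)) :
    (F.obj ((A.under pt).E.obj i).right).map (base ((B.under pt).E.obj j)) ≫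
      P.lam (uArr i) (uArr j) ≫ D.E.map (Sm.leibComparison i j) =
        zeroMap ht _ ((D.under pt).E.obj ((Sm.S.leibnizPushout.obj i).obj j)) := by
  refine Eq.trans (b := (F.obj (A.E.obj (uArr i))).map (base j.left) ≫
    (F.obj (A.E.obj (uArr i))).map (B.l (uArr j)) ≫
      P.lam (uArr i) (uArr j) ≫ D.E.map (Sm.leibComparison i j)) ?_ ?_
  · rw [← Functor.map_comp_assoc]
    rfl
  rw [reassoc_of% obj_map_l_lam P, D.l_map,
    reassoc_of% Sm.leibInl_leibComparison]
  refine ((F.map (A.r (uArr i))).naturality_assoc (base j.left) _).trans ?_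
  refine (congrArg ((F.map (A.r (uArr i))).app pt ≫ ·)
    ((Sm.zero_right_assoc i.right j.left _).trans ?_)).trans (comp_zeroMap (ht := ht)
      ((F.map (A.r (uArr i))).app pt) ((D.under pt).E.obj ((Sm.S.leibnizPushout.obj i).obj j)))
  exact zeroMap_right_right _ (leibInl Sm.S i j)
    ((D.under pt).l ((Sm.S.leibnizPushout.obj i).obj j))

/-- The map `λ` for the smash product, induced by that for `F` on the quotient. -/
noncomputable def lam (i j : Arrow (Under pt)) :
    (Sm.S.obj ((A.under pt).E.obj i)).obj ((B.under pt).E.obj j) ⟶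
      (D.under pt).E.obj ((Sm.S.leibnizPushout.obj i).obj j) :=
  Sm.desc (Z := (D.under pt).E.obj ((Sm.S.leibnizPushout.obj i).obj j))
    (P.lam (uArr i) (uArr j) ≫ D.E.map (Sm.leibComparison i j))
    (Sm.zero_left_lam P i j) (Sm.zero_right_lam P i j)

lemma q_lam (i j : Arrow (Under pt)) :
    Sm.q ((A.under pt).E.obj i) ((B.under pt).E.obj j) ≫ (Sm.lam P i j).right =
      P.lam (uArr i) (uArr j) ≫ D.E.map (Sm.leibComparison i j) :=
  Sm.q_desc _ _ _

/-- The natural transformation `λ` for the smash product. -/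
noncomputable def tensorTrans : TensorTrans Sm.S (A.under pt) (B.under pt) (D.under pt) where
  lam := Sm.lam P
  naturality_left {i i'} a j := by
    refine Sm.hom_ext ?_
    refine (Sm.nat_left_assoc ((A.under pt).E.map a) ((B.under pt).E.obj j) _).symm.trans ?_
    refine (congrArg (_ ≫ ·) (Sm.q_lam P i' j)).trans ?_
    refine Eq.trans ?_ ((congrArg (· ≫ D.E.map (uSq ((Sm.S.leibnizPushout.map a).app j)))
      (Sm.q_lam P i j).symm).trans (Category.assoc _ _ _))
    rw [Category.assoc, ← D.E.map_comp, leibComparison_map_left, D.E.map_comp,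
      ← reassoc_of% P.naturality_left]
    rfl
  naturality_right i {j j'} b := by
    refine Sm.hom_ext ?_
    refine (Sm.nat_right_assoc ((A.under pt).E.obj i) ((B.under pt).E.map b) _).symm.trans ?_
    refine (congrArg (_ ≫ ·) (Sm.q_lam P i j')).trans ?_
    refine Eq.trans ?_ ((congrArg (· ≫ D.E.map (uSq ((Sm.S.leibnizPushout.obj i).map b)))
      (Sm.q_lam P i j).symm).trans (Category.assoc _ _ _))
    rw [Category.assoc, ← D.E.map_comp, leibComparison_map_right, D.E.map_comp,
      ← reassoc_of% P.naturality_right]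
    rfl

/-- The structure map of the pushout-product of two coalgebras. -/
noncomputable def tensorS (i : (A.under pt).Coalg) (j : (B.under pt).Coalg) :
    (Sm.S.obj i.A.right).obj j.A.right ⟶
      (D.under pt).E.obj ((Sm.S.leibnizPushout.obj i.A).obj j.A) :=
  (Sm.S.map (Coalg.s i)).app j.A.right ≫
    (Sm.S.obj ((A.under pt).E.obj i.A)).map (Coalg.s j) ≫ Sm.lam P i.A j.A

/-- The structure map for the smash product is induced on the quotient by the one for `F`. This is
the condition for the coalgebra structure to descend along the comparison. -/
lemma q_tensorS (i : (A.under pt).Coalg) (j : (B.under pt).Coalg) :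
    Sm.q i.A.right j.A.right ≫ (Sm.tensorS P i j).right =
      (P.tensorStr (Coalg.ofUnder i) (Coalg.ofUnder j)).s ≫
        D.E.map (Sm.leibComparison i.A j.A) := by
  refine (Sm.nat_left_assoc (Coalg.s i) j.A.right _).symm.trans ?_
  refine (congrArg (_ ≫ ·)
    (Sm.nat_right_assoc ((A.under pt).E.obj i.A) (Coalg.s j) _).symm).trans ?_
  refine (congrArg (_ ≫ _ ≫ ·) (Sm.q_lam P i.A j.A)).trans ?_
  refine Eq.trans ?_ (congrArg (· ≫ D.E.map (Sm.leibComparison i.A j.A))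
    (P.tensorStr_s (Coalg.ofUnder i) (Coalg.ofUnder j)).symm)
  exact ((Category.assoc _ _ _).trans (congrArg (_ ≫ ·) (Category.assoc _ _ _))).symm

/-- The coalgebra structure on the pushout-product, for the smash product, of two coalgebras. -/
noncomputable def tensorStr (i : (A.under pt).Coalg) (j : (B.under pt).Coalg) :
    (D.under pt).CoalgStr ((Sm.S.leibnizPushout.obj i.A).obj j.A) :=
  CoalgStr.toUnder (Sm.tensorS P i j)
    (CoalgStr.ofEpi (Sm.leibComparison i.A j.A)
      (P.tensorStr (Coalg.ofUnder i) (Coalg.ofUnder j)) (Sm.tensorS P i j).right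
      (Sm.q_tensorS P i j)) rfl

variable [HasPullbacks (Under pt)] [HasEqualizers M]

/-- The comparison between left pullback-homs. -/
noncomputable def homLComparison (T : TwoVarAdj F) (i f : Arrow (Under pt)) :
    uArr (((Sm.twoVarAdj T).homL.leibnizPullback.obj (op i)).obj f) ⟶
      (T.homL.leibnizPullback.obj (op (uArr i))).obj (uArr f) :=
  Sm.homComparison T.adjL (.ofHasPullback T.homL (uArr i).hom (uArr f).hom)
    (.ofHasPullback (Sm.homFunctor T.adjL) i.hom f.hom)
    (.ofHasPushout F (uArr i).hom _) (.ofHasPushout Sm.S i.hom _)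

/-- The comparison between right pullback-homs. -/
noncomputable def homRComparison (T : TwoVarAdj F) (j f : Arrow (Under pt)) :
    uArr (((Sm.twoVarAdj T).homR.leibnizPullback.obj (op j)).obj f) ⟶
      (T.homR.leibnizPullback.obj (op (uArr j))).obj (uArr f) :=
  Sm.flip.homComparison T.adjR (.ofHasPullback T.homR (uArr j).hom (uArr f).hom)
    (.ofHasPullback (Sm.flip.homFunctor T.adjR) j.hom f.hom)
    (Functor.PushoutObjObj.ofHasPushout F _ (uArr j).hom).flip
    (Functor.PushoutObjObj.ofHasPushout Sm.S _ j.hom).flip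

lemma homLComparison_left (i f : Arrow (Under pt)) :
    (Sm.homLComparison T i f).left = Sm.ι T.adjL i.right f.left :=
  Sm.homComparison_left _ _ _ _ _

lemma homRComparison_left (j f : Arrow (Under pt)) :
    (Sm.homRComparison T j f).left = Sm.flip.ι T.adjR j.right f.left :=
  Sm.flip.homComparison_left _ _ _ _ _

instance (i f : Arrow (Under pt)) : Mono (Sm.homLComparison T i f).left :=
  Sm.mono_homComparison_left ..

instance [HasBinaryCoproducts M] (i f : Arrow (Under pt)) :
    Mono (Sm.homLComparison T i f).right :=
  Sm.mono_homComparison_right ..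

instance (i f : Arrow (Under pt)) : Mono (Sm.homRComparison T i f).left :=
  Sm.flip.mono_homComparison_left ..

instance [HasBinaryCoproducts M] (i f : Arrow (Under pt)) :
    Mono (Sm.homRComparison T i f).right :=
  Sm.flip.mono_homComparison_right ..

/-- The counits of the transpositions are compatible with the comparisons. -/
lemma map_homLComparison (i f : Arrow (Under pt)) :
    (F.leibnizPushout.obj (uArr i)).map (Sm.homLComparison T i f) ≫
        (T.hatEquivL (uArr i) _ (uArr f)).symm (𝟙 _) =
      Sm.leibComparison i _ ≫ uSq (((Sm.twoVarAdj T).hatEquivL i _ f).symm (𝟙 _)) := by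
  rw [hatEquivL_symm_naturality, Category.comp_id, Equiv.symm_apply_eq]
  rfl

lemma map_homRComparison (j f : Arrow (Under pt)) :
    (F.leibnizPushout.map (Sm.homRComparison T j f)).app (uArr j) ≫
        (T.hatEquivR _ (uArr j) (uArr f)).symm (𝟙 _) =
      Sm.leibComparison _ j ≫ uSq (((Sm.twoVarAdj T).hatEquivR _ j f).symm (𝟙 _)) := by
  rw [hatEquivR_symm_naturality, Category.comp_id, Equiv.symm_apply_eq]
  refine congrArg (fun z => T.hatEquivR _ (uArr j) (uArr f)
    (z ≫ uSq (((Sm.twoVarAdj T).hatEquivR _ j f).symm (𝟙 _)))) ?_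
  exact Sm.comparison_flip _ _

/-- Transposing along the smash product is compatible with transposing along `F`. -/
lemma q_lam_counitL {i f : Arrow (Under pt)} {Y Z : Under pt} (s : Y ⟶ (A.under pt).E.obj i)
    (t : (D.under pt).E.obj f ⟶ Z) :
    Sm.q Y ((B.under pt).E.obj (((Sm.twoVarAdj T).homL.leibnizPullback.obj (op i)).obj f)) ≫
      ((Sm.S.map s).app _ ≫ Sm.lam P i _ ≫
        (D.under pt).E.map (((Sm.twoVarAdj T).hatEquivL i _ f).symm (𝟙 _)) ≫ t).right =
    (F.obj Y.right).map (B.E.map (Sm.homLComparison T i f)) ≫ (F.map s.right).app _ ≫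
      P.lam (uArr i) _ ≫ D.E.map ((T.hatEquivL (uArr i) _ (uArr f)).symm (𝟙 _)) ≫ t.right := by
  refine (Sm.nat_left_assoc s _ _).symm.trans ?_
  rw [NatTrans.naturality_assoc]
  refine congrArg ((F.map s.right).app _ ≫ ·) ?_
  refine Eq.trans ?_ (((congrArg (· ≫ D.E.map ((T.hatEquivL (uArr i) _ (uArr f)).symm (𝟙 _)) ≫
    t.right) (P.naturality_right (uArr i) (Sm.homLComparison T i f)).symm).trans
      (Category.assoc _ _ _)))
  refine Eq.trans (b := P.lam (uArr i) _ ≫ D.E.map (Sm.leibComparison i _ ≫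
    uSq (((Sm.twoVarAdj T).hatEquivL i _ f).symm (𝟙 _))) ≫ t.right) ?_ ?_
  · rw [D.E.map_comp]
    refine Eq.trans ?_ (congrArg (P.lam _ _ ≫ ·) (Category.assoc _ _ _).symm)
    exact ((Category.assoc _ _ _).symm.trans (congrArg (· ≫ _) (Sm.q_lam P i _))).trans
      (Category.assoc _ _ _)
  · rw [← map_homLComparison, D.E.map_comp, Category.assoc]
    exact congrArg (P.lam _ _ ≫ ·) (Category.assoc _ _ _)

lemma q_lam_counitR {j f : Arrow (Under pt)} {Y Z : Under pt} (s : Y ⟶ (B.under pt).E.obj j)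
    (t : (D.under pt).E.obj f ⟶ Z) :
    Sm.q ((A.under pt).E.obj (((Sm.twoVarAdj T).homR.leibnizPullback.obj (op j)).obj f)) Y ≫
      ((Sm.S.obj _).map s ≫ Sm.lam P _ j ≫
        (D.under pt).E.map (((Sm.twoVarAdj T).hatEquivR _ j f).symm (𝟙 _)) ≫ t).right =
    (F.map (A.E.map (Sm.homRComparison T j f))).app Y.right ≫ (F.obj _).map s.right ≫
      P.lam _ (uArr j) ≫ D.E.map ((T.hatEquivR _ (uArr j) (uArr f)).symm (𝟙 _)) ≫ t.right := by
  refine (Sm.nat_right_assoc _ s _).symm.trans ?_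
  rw [← NatTrans.naturality_assoc]
  refine congrArg ((F.obj _).map s.right ≫ ·) ?_
  refine Eq.trans ?_ (((congrArg (· ≫ D.E.map ((T.hatEquivR _ (uArr j) (uArr f)).symm (𝟙 _)) ≫
    t.right) (P.naturality_left (Sm.homRComparison T j f) (uArr j)).symm).trans
      (Category.assoc _ _ _)))
  refine Eq.trans (b := P.lam _ (uArr j) ≫ D.E.map (Sm.leibComparison _ j ≫
    uSq (((Sm.twoVarAdj T).hatEquivR _ j f).symm (𝟙 _))) ≫ t.right) ?_ ?_
  · rw [D.E.map_comp]
    refine Eq.trans ?_ (congrArg (P.lam _ _ ≫ ·) (Category.assoc _ _ _).symm)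
    exact ((Category.assoc _ _ _).symm.trans (congrArg (· ≫ _) (Sm.q_lam P _ j))).trans
      (Category.assoc _ _ _)
  · rw [← map_homRComparison, D.E.map_comp, Category.assoc]
    exact congrArg (P.lam _ _ ≫ ·) (Category.assoc _ _ _)

/-- The structure map of the left pullback-hom of a coalgebra and an algebra. -/
noncomputable def homLT (i : (A.under pt).Coalg) (f : (D.under pt).Alg) :
    (B.under pt).E.obj (((Sm.twoVarAdj T).homL.leibnizPullback.obj (op i.A)).obj f.A) ⟶
      ((Sm.twoVarAdj T).homL.obj (op i.A.right)).obj f.A.left :=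
  (Sm.tensorTrans P).rhoL (Sm.twoVarAdj T) i.A f.A ≫
    ((Sm.twoVarAdj T).homL.map (Coalg.s i).op).app ((D.under pt).E.obj f.A) ≫
      ((Sm.twoVarAdj T).homL.obj (op i.A.right)).map (Alg.t f)

/-- The structure map for the smash product is the restriction of the one for `F`. This is the
condition for the algebra structure to restrict along the comparison. -/
lemma homLT_ι (i : (A.under pt).Coalg) (f : (D.under pt).Alg) :
    (Sm.homLT P i f).right ≫ Sm.ι T.adjL i.A.right f.A.left =
      B.E.map (Sm.homLComparison T i.A f.A) ≫
        (P.homLStr (Coalg.ofUnder i) (Alg.ofUnder f)).t := by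
  have h := rhoL_comp (Sm.tensorTrans P) (Sm.twoVarAdj T) (Coalg.s i) (Alg.t f)
  have h' := (P.homLStr_t (Coalg.ofUnder i) (Alg.ofUnder f)).trans
    (rhoL_comp P.toTensorTrans T (Coalg.s (Coalg.ofUnder i)) (Alg.t (Alg.ofUnder f)))
  refine (congrArg (fun z => z.right ≫ Sm.ι T.adjL i.A.right f.A.left) h).trans ?_
  refine (Sm.smashAdj_homEquiv_ι T.adjL _).trans ?_
  refine Eq.trans ?_ ((congrArg (B.E.map (Sm.homLComparison T i.A f.A) ≫ ·) h').symm)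
  refine Eq.trans ?_ (T.adjL.homEquiv_naturality_two _ _)
  exact congrArg (fun z => T.adjL.homEquiv z) (Sm.q_lam_counitL P (Coalg.s i) (Alg.t f))

/-- The structure map of the right pullback-hom of a coalgebra and an algebra. -/
noncomputable def homRT (j : (B.under pt).Coalg) (f : (D.under pt).Alg) :
    (A.under pt).E.obj (((Sm.twoVarAdj T).homR.leibnizPullback.obj (op j.A)).obj f.A) ⟶
      ((Sm.twoVarAdj T).homR.obj (op j.A.right)).obj f.A.left :=
  (Sm.tensorTrans P).rhoR (Sm.twoVarAdj T) j.A f.A ≫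
    ((Sm.twoVarAdj T).homR.map (Coalg.s j).op).app ((D.under pt).E.obj f.A) ≫
      ((Sm.twoVarAdj T).homR.obj (op j.A.right)).map (Alg.t f)

lemma homRT_ι (j : (B.under pt).Coalg) (f : (D.under pt).Alg) :
    (Sm.homRT P j f).right ≫ Sm.flip.ι T.adjR j.A.right f.A.left =
      A.E.map (Sm.homRComparison T j.A f.A) ≫
        (P.homRStr (Coalg.ofUnder j) (Alg.ofUnder f)).t := by
  have h := rhoR_comp (Sm.tensorTrans P) (Sm.twoVarAdj T) (Coalg.s j) (Alg.t f)
  have h' := (P.homRStr_t (Coalg.ofUnder j) (Alg.ofUnder f)).trans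
    (rhoR_comp P.toTensorTrans T (Coalg.s (Coalg.ofUnder j)) (Alg.t (Alg.ofUnder f)))
  refine (congrArg (fun z => z.right ≫ Sm.flip.ι T.adjR j.A.right f.A.left) h).trans ?_
  refine (Sm.flip.smashAdj_homEquiv_ι T.adjR _).trans ?_
  refine Eq.trans ?_ ((congrArg (A.E.map (Sm.homRComparison T j.A f.A) ≫ ·) h').symm)
  refine Eq.trans ?_ (T.adjR.homEquiv_naturality_two _ _)
  exact congrArg (fun z => T.adjR.homEquiv z) (Sm.q_lam_counitR P (Coalg.s j) (Alg.t f))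

/-- A two-variable adjunction of algebraic weak factorization systems lifts to the smash product. -/
noncomputable def twoVarAWFS [HasBinaryCoproducts M] :
    TwoVarAWFS (Sm.twoVarAdj T) (A.under pt) (B.under pt) (D.under pt) where
  toTensorTrans := Sm.tensorTrans P
  tensorStr := Sm.tensorStr P
  tensorStr_s _ _ := rfl
  homLStr i f := AlgStr.toUnder (Sm.homLT P i f)
    (AlgStr.ofMono (Sm.homLComparison T i.A f.A) (P.homLStr (Coalg.ofUnder i) (Alg.ofUnder f))
      (Sm.homLT P i f).right
      ((congrArg ((Sm.homLT P i f).right ≫ ·) (Sm.homLComparison_left _ _)).trans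
        (Sm.homLT_ι P i f))) rfl
  homLStr_t _ _ := rfl
  homRStr j f := AlgStr.toUnder (Sm.homRT P j f)
    (AlgStr.ofMono (Sm.homRComparison T j.A f.A) (P.homRStr (Coalg.ofUnder j) (Alg.ofUnder f))
      (Sm.homRT P j f).right
      ((congrArg ((Sm.homRT P j f).right ≫ ·) (Sm.homRComparison_left _ _)).trans
        (Sm.homRT_ι P j f))) rfl
  homRStr_t _ _ := rfl

end Lift

end SmashData

end AlgModel

namespace AlgModel

namespace SmashData

/-! ### Maps out of iterated smash products -/

section Transpose

variable {M : Type u} [Category.{v} M] {pt : M} {ht : IsTerminal pt} {F : M ⥤ M ⥤ M}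
  (Sm : SmashData ht F) {L R : M ⥤ M} (adj : L ⊣ R)

/-- The transpose of a constant map is constant, when the value of the right adjoint is pointed by
the transpose of a constant map. -/
lemma homEquiv_zeroMap (adj : L ⊣ R) (T : M) (W : Under pt) :
    adj.homEquiv T W.right (zeroMap ht _ W) =
      zeroMap ht T (Under.mk (adj.homEquiv pt W.right (zeroMap ht _ W))) := by
  rw [← comp_zeroMap (ht := ht) (L.map (ht.from T)) W, adj.homEquiv_naturality_left]
  rfl

/-- For a left adjoint `L`, a map `L (F(X, Y)) ⟶ W` which is constant on `L (F(*, Y))` and on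
`L (F(X, *))` descends to `L` of the smash product: its transpose is a map into `R W`, which is
pointed by the transpose of the constant map. -/
noncomputable def descMap {X Y W : Under pt} (g : L.obj ((F.obj X.right).obj Y.right) ⟶ W.right)
    (h₁ : L.map ((F.map (base X)).app Y.right) ≫ g = zeroMap ht _ W)
    (h₂ : L.map ((F.obj X.right).map (base Y)) ≫ g = zeroMap ht _ W) :
    L.obj ((Sm.S.obj X).obj Y).right ⟶ W.right :=
  (adj.homEquiv _ _).symm (Sm.desc
    (Z := Under.mk (adj.homEquiv pt W.right (zeroMap ht _ W))) (adj.homEquiv _ _ g)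
    (by
      rw [← adj.homEquiv_naturality_left, h₁]
      exact homEquiv_zeroMap adj _ W)
    (by
      rw [← adj.homEquiv_naturality_left, h₂]
      exact homEquiv_zeroMap adj _ W)).right

lemma map_q_descMap {X Y W : Under pt} (g : L.obj ((F.obj X.right).obj Y.right) ⟶ W.right)
    (h₁ : L.map ((F.map (base X)).app Y.right) ≫ g = zeroMap ht _ W)
    (h₂ : L.map ((F.obj X.right).map (base Y)) ≫ g = zeroMap ht _ W) :
    L.map (Sm.q X Y) ≫ Sm.descMap adj g h₁ h₂ = g := by
  rw [descMap, ← adj.homEquiv_naturality_left_symm, q_desc, Equiv.symm_apply_apply]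

lemma map_base_descMap {X Y W : Under pt} (g : L.obj ((F.obj X.right).obj Y.right) ⟶ W.right)
    (h₁ : L.map ((F.map (base X)).app Y.right) ≫ g = zeroMap ht _ W)
    (h₂ : L.map ((F.obj X.right).map (base Y)) ≫ g = zeroMap ht _ W) :
    L.map (base ((Sm.S.obj X).obj Y)) ≫ Sm.descMap adj g h₁ h₂ = zeroMap ht _ W := by
  rw [descMap, ← adj.homEquiv_naturality_left_symm, base_right]
  exact (adj.homEquiv _ _).symm_apply_apply _

lemma epi_map_q (adj : L ⊣ R) (X Y : Under pt) : Epi (L.map (Sm.q X Y)) := by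
  have := adj.leftAdjoint_preservesColimits
  infer_instance

end Transpose

section Monoidal

variable {M : Type u} [Category.{v} M] [MonoidalCategory M]

lemma inl_wedgeToTensor [HasColimits M] (X Y : Under (𝟙_ M)) :
    pushout.inl X.hom Y.hom ≫ wedgeToTensor X Y = (ρ_ X.right).inv ≫ X.right ◁ base Y :=
  pushout.inl_desc _ _ _

lemma inr_wedgeToTensor [HasColimits M] (X Y : Under (𝟙_ M)) :
    pushout.inr X.hom Y.hom ≫ wedgeToTensor X Y = (λ_ Y.right).inv ≫ base X ▷ Y.right :=
  pushout.inr_desc _ _ _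

variable {ht : IsTerminal (𝟙_ M)}
  (Sm : SmashData ht (curriedTensor M))

/-- The smash product of two pointed objects. -/
abbrev smash (X Y : Under (𝟙_ M)) : Under (𝟙_ M) := (Sm.S.obj X).obj Y

/-- The action of the smash product on a map in the second variable. -/
abbrev smashL (X : Under (𝟙_ M)) {Y Y' : Under (𝟙_ M)} (g : Y ⟶ Y') :
    Sm.smash X Y ⟶ Sm.smash X Y' := (Sm.S.obj X).map g

/-- The action of the smash product on a map in the first variable. -/
abbrev smashR {X X' : Under (𝟙_ M)} (f : X ⟶ X') (Y : Under (𝟙_ M)) :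
    Sm.smash X Y ⟶ Sm.smash X' Y := (Sm.S.map f).app Y

/-- The quotient map from the monoidal product to the smash product. -/
def quo (X Y : Under (𝟙_ M)) : X.right ⊗ Y.right ⟶ (Sm.smash X Y).right := Sm.q X Y

instance (X Y : Under (𝟙_ M)) : Epi (Sm.quo X Y) := Sm.epi_q X Y

lemma whiskerRight_quo {X X' : Under (𝟙_ M)} (f : X ⟶ X') (Y : Under (𝟙_ M)) :
    f.right ▷ Y.right ≫ Sm.quo X' Y = Sm.quo X Y ≫ (Sm.smashR f Y).right := Sm.nat_left f Y

lemma whiskerLeft_quo (X : Under (𝟙_ M)) {Y Y' : Under (𝟙_ M)} (g : Y ⟶ Y') :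
    X.right ◁ g.right ≫ Sm.quo X Y' = Sm.quo X Y ≫ (Sm.smashL X g).right := Sm.nat_right X g

lemma whiskerRight_quo_assoc {X X' : Under (𝟙_ M)} (f : X ⟶ X') (Y : Under (𝟙_ M)) {Z : M}
    (h : (Sm.smash X' Y).right ⟶ Z) :
    f.right ▷ Y.right ≫ Sm.quo X' Y ≫ h = Sm.quo X Y ≫ (Sm.smashR f Y).right ≫ h :=
  Sm.nat_left_assoc f Y h

lemma whiskerLeft_quo_assoc (X : Under (𝟙_ M)) {Y Y' : Under (𝟙_ M)} (g : Y ⟶ Y') {Z : M}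
    (h : (Sm.smash X Y').right ⟶ Z) :
    X.right ◁ g.right ≫ Sm.quo X Y' ≫ h = Sm.quo X Y ≫ (Sm.smashL X g).right ≫ h :=
  Sm.nat_right_assoc X g h

@[simp]
lemma zeroMap_whiskerRight_quo (T : M) (X Y : Under (𝟙_ M)) :
    zeroMap ht T X ▷ Y.right ≫ Sm.quo X Y = zeroMap ht _ _ := by
  have h : base X ▷ Y.right ≫ Sm.quo X Y = zeroMap ht _ _ := Sm.zero_left X Y
  rw [zeroMap, comp_whiskerRight, Category.assoc, h, comp_zeroMap]

@[simp]
lemma whiskerLeft_zeroMap_quo (T : M) (X Y : Under (𝟙_ M)) :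
    X.right ◁ zeroMap ht T Y ≫ Sm.quo X Y = zeroMap ht _ _ := by
  have h : X.right ◁ base Y ≫ Sm.quo X Y = zeroMap ht _ _ := Sm.zero_right X Y
  rw [zeroMap, MonoidalCategory.whiskerLeft_comp, Category.assoc, h, comp_zeroMap]

@[simp]
lemma base_whiskerRight_quo (X Y : Under (𝟙_ M)) :
    base X ▷ Y.right ≫ Sm.quo X Y = zeroMap ht _ _ := Sm.zero_left X Y

@[simp]
lemma whiskerLeft_base_quo (X Y : Under (𝟙_ M)) :
    X.right ◁ base Y ≫ Sm.quo X Y = zeroMap ht _ _ := Sm.zero_right X Y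

lemma quo_ext {X Y Z : Under (𝟙_ M)} {f g : Sm.smash X Y ⟶ Z}
    (h : Sm.quo X Y ≫ f.right = Sm.quo X Y ≫ g.right) : f = g := Sm.hom_ext h

/-- The pointed map out of a smash product induced by a map out of the monoidal product. -/
def quoDesc {X Y Z : Under (𝟙_ M)} (g : X.right ⊗ Y.right ⟶ Z.right)
    (h₁ : base X ▷ Y.right ≫ g = zeroMap ht _ Z) (h₂ : X.right ◁ base Y ≫ g = zeroMap ht _ Z) :
    Sm.smash X Y ⟶ Z := Sm.desc g h₁ h₂

@[simp]
lemma quo_quoDesc {X Y Z : Under (𝟙_ M)} (g : X.right ⊗ Y.right ⟶ Z.right)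
    (h₁ : base X ▷ Y.right ≫ g = zeroMap ht _ Z) (h₂ : X.right ◁ base Y ≫ g = zeroMap ht _ Z) :
    Sm.quo X Y ≫ (Sm.quoDesc g h₁ h₂).right = g := Sm.q_desc g h₁ h₂

/-- The smash product is the pushout collapsing the wedge of the two factors. -/
lemma isPushout_quo [HasColimits M] (X Y : Under (𝟙_ M)) :
    IsPushout (wedgeToTensor X Y) (ht.from (pushout X.hom Y.hom)) (Sm.quo X Y)
      (Sm.smash X Y).hom := by
  have w : wedgeToTensor X Y ≫ Sm.quo X Y =
      ht.from (pushout X.hom Y.hom) ≫ (Sm.smash X Y).hom := by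
    change _ = zeroMap ht _ (Sm.smash X Y)
    refine pushout.hom_ext ?_ ?_
    · rw [reassoc_of% inl_wedgeToTensor X Y, whiskerLeft_base_quo, comp_zeroMap, comp_zeroMap]
    · rw [reassoc_of% inr_wedgeToTensor X Y, base_whiskerRight_quo, comp_zeroMap, comp_zeroMap]
  refine IsPushout.of_isColimit' ⟨w⟩ (PushoutCocone.IsColimit.mk _
    (fun s => (Sm.quoDesc (Z := Under.mk s.inr) s.inl ?_ ?_).right) (fun s => ?_) (fun s => ?_)
    (fun s m h _ => ?_))
  · have h := congrArg (fun z => (λ_ _).hom ≫ pushout.inr X.hom Y.hom ≫ z) s.condition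
    rw [reassoc_of% inr_wedgeToTensor X Y, Iso.hom_inv_id_assoc] at h
    refine h.trans ?_
    change _ ≫ _ ≫ zeroMap ht _ (Under.mk s.inr) = _
    rw [comp_zeroMap, comp_zeroMap]
  · have h := congrArg (fun z => (ρ_ _).hom ≫ pushout.inl X.hom Y.hom ≫ z) s.condition
    rw [reassoc_of% inl_wedgeToTensor X Y, Iso.hom_inv_id_assoc] at h
    refine h.trans ?_
    change _ ≫ _ ≫ zeroMap ht _ (Under.mk s.inr) = _
    rw [comp_zeroMap, comp_zeroMap]
  · exact Sm.quo_quoDesc _ _ _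
  · exact base_right (Sm.quoDesc (Z := Under.mk s.inr) s.inl _ _)
  · rw [← cancel_epi (Sm.quo X Y), h]
    exact (Sm.quo_quoDesc (Z := Under.mk s.inr) _ _ _).symm

lemma epi_quo_whiskerRight (T : TwoVarAdj (curriedTensor M)) (X Y : Under (𝟙_ M)) (Z : M) :
    Epi (Sm.quo X Y ▷ Z) :=
  Sm.epi_map_q (T.adjR.adj Z) X Y

lemma epi_whiskerLeft_quo (T : TwoVarAdj (curriedTensor M)) (X Y : Under (𝟙_ M)) (Z : M) :
    Epi (Z ◁ Sm.quo X Y) :=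
  Sm.epi_map_q (T.adjL.adj Z) X Y

/-! ### The associator -/

section Associator

variable (T : TwoVarAdj (curriedTensor M))

/-- The associator of the monoidal product, with values in the iterated smash product and descended
to the first of the two quotients. -/
noncomputable def assocHomAux (X Y Z : Under (𝟙_ M)) :
    (Sm.smash X Y).right ⊗ Z.right ⟶ (Sm.smash X (Sm.smash Y Z)).right :=
  Sm.descMap (T.adjR.adj Z.right) (X := X) (Y := Y) (W := Sm.smash X (Sm.smash Y Z))
    ((α_ X.right Y.right Z.right).hom ≫ X.right ◁ Sm.quo Y Z ≫ Sm.quo X (Sm.smash Y Z))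
    (by
      change (base X ▷ Y.right) ▷ Z.right ≫ _ = _
      rw [associator_naturality_left_assoc, ← whisker_exchange_assoc, base_whiskerRight_quo,
        comp_zeroMap, comp_zeroMap]
      rfl)
    (by
      change (X.right ◁ base Y) ▷ Z.right ≫ _ = _
      rw [associator_naturality_middle_assoc, ← MonoidalCategory.whiskerLeft_comp_assoc,
        base_whiskerRight_quo, whiskerLeft_zeroMap_quo, comp_zeroMap]
      rfl)

lemma whiskerRight_quo_assocHomAux (X Y Z : Under (𝟙_ M)) :
    Sm.quo X Y ▷ Z.right ≫ Sm.assocHomAux T X Y Z =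
      (α_ X.right Y.right Z.right).hom ≫ X.right ◁ Sm.quo Y Z ≫ Sm.quo X (Sm.smash Y Z) :=
  Sm.map_q_descMap (T.adjR.adj Z.right) _ _ _

/-- The associator for the smash product. -/
noncomputable def assocHom (X Y Z : Under (𝟙_ M)) :
    Sm.smash (Sm.smash X Y) Z ⟶ Sm.smash X (Sm.smash Y Z) :=
  Sm.quoDesc (Sm.assocHomAux T X Y Z) (Sm.map_base_descMap (T.adjR.adj Z.right) _ _ _) (by
    have := Sm.epi_quo_whiskerRight T X Y (𝟙_ M)
    rw [← cancel_epi (Sm.quo X Y ▷ 𝟙_ M), ← whisker_exchange_assoc, whiskerRight_quo_assocHomAux,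
      associator_naturality_right_assoc, ← MonoidalCategory.whiskerLeft_comp_assoc,
      whiskerLeft_base_quo, whiskerLeft_zeroMap_quo, comp_zeroMap, comp_zeroMap])

@[simp]
lemma quo_quo_assocHom (X Y Z : Under (𝟙_ M)) :
    Sm.quo X Y ▷ Z.right ≫ Sm.quo (Sm.smash X Y) Z ≫ (Sm.assocHom T X Y Z).right =
      (α_ X.right Y.right Z.right).hom ≫ X.right ◁ Sm.quo Y Z ≫ Sm.quo X (Sm.smash Y Z) := by
  exact (congrArg (Sm.quo X Y ▷ Z.right ≫ ·) (Sm.quo_quoDesc _ _ _)).trans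
    (Sm.whiskerRight_quo_assocHomAux T X Y Z)

/-- The inverse of the associator of the monoidal product, with values in the iterated smash product
and descended to the first of the two quotients. -/
noncomputable def assocInvAux (X Y Z : Under (𝟙_ M)) :
    X.right ⊗ (Sm.smash Y Z).right ⟶ (Sm.smash (Sm.smash X Y) Z).right :=
  Sm.descMap (T.adjL.adj X.right) (X := Y) (Y := Z) (W := Sm.smash (Sm.smash X Y) Z)
    ((α_ X.right Y.right Z.right).inv ≫ Sm.quo X Y ▷ Z.right ≫ Sm.quo (Sm.smash X Y) Z)
    (by
      change X.right ◁ (base Y ▷ Z.right) ≫ _ = _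
      rw [associator_inv_naturality_middle_assoc, ← comp_whiskerRight_assoc,
        whiskerLeft_base_quo, zeroMap_whiskerRight_quo, comp_zeroMap]
      rfl)
    (by
      change X.right ◁ (Y.right ◁ base Z) ≫ _ = _
      rw [associator_inv_naturality_right_assoc, whisker_exchange_assoc, whiskerLeft_base_quo,
        comp_zeroMap, comp_zeroMap]
      rfl)

lemma whiskerLeft_quo_assocInvAux (X Y Z : Under (𝟙_ M)) :
    X.right ◁ Sm.quo Y Z ≫ Sm.assocInvAux T X Y Z =
      (α_ X.right Y.right Z.right).inv ≫ Sm.quo X Y ▷ Z.right ≫ Sm.quo (Sm.smash X Y) Z :=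
  Sm.map_q_descMap (T.adjL.adj X.right) _ _ _

/-- The inverse of the associator for the smash product. -/
noncomputable def assocInv (X Y Z : Under (𝟙_ M)) :
    Sm.smash X (Sm.smash Y Z) ⟶ Sm.smash (Sm.smash X Y) Z :=
  Sm.quoDesc (Sm.assocInvAux T X Y Z) (by
    have := Sm.epi_whiskerLeft_quo T Y Z (𝟙_ M)
    rw [← cancel_epi (𝟙_ M ◁ Sm.quo Y Z), whisker_exchange_assoc, whiskerLeft_quo_assocInvAux,
      associator_inv_naturality_left_assoc, ← comp_whiskerRight_assoc,
      base_whiskerRight_quo, zeroMap_whiskerRight_quo, comp_zeroMap, comp_zeroMap])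
    (Sm.map_base_descMap (T.adjL.adj X.right) _ _ _)

@[simp]
lemma quo_quo_assocInv (X Y Z : Under (𝟙_ M)) :
    X.right ◁ Sm.quo Y Z ≫ Sm.quo X (Sm.smash Y Z) ≫ (Sm.assocInv T X Y Z).right =
      (α_ X.right Y.right Z.right).inv ≫ Sm.quo X Y ▷ Z.right ≫ Sm.quo (Sm.smash X Y) Z := by
  exact (congrArg (X.right ◁ Sm.quo Y Z ≫ ·) (Sm.quo_quoDesc _ _ _)).trans
    (Sm.whiskerLeft_quo_assocInvAux T X Y Z)

variable {Sm} in
/-- A pointed map out of an iterated smash product is determined by its restriction to the iterated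
monoidal product. -/
lemma quo_quo_ext (T : TwoVarAdj (curriedTensor M)) {X Y Z W : Under (𝟙_ M)}
    {f g : Sm.smash (Sm.smash X Y) Z ⟶ W}
    (h : Sm.quo X Y ▷ Z.right ≫ Sm.quo (Sm.smash X Y) Z ≫ f.right =
      Sm.quo X Y ▷ Z.right ≫ Sm.quo (Sm.smash X Y) Z ≫ g.right) : f = g := by
  have := Sm.epi_quo_whiskerRight T X Y Z.right
  exact Sm.quo_ext ((cancel_epi (Sm.quo X Y ▷ Z.right)).1 h)

variable {Sm} in
/-- A pointed map out of an iterated smash product is determined by its restriction to the iterated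
monoidal product. -/
lemma quo_quo_ext' (T : TwoVarAdj (curriedTensor M)) {X Y Z W : Under (𝟙_ M)}
    {f g : Sm.smash X (Sm.smash Y Z) ⟶ W}
    (h : X.right ◁ Sm.quo Y Z ≫ Sm.quo X (Sm.smash Y Z) ≫ f.right =
      X.right ◁ Sm.quo Y Z ≫ Sm.quo X (Sm.smash Y Z) ≫ g.right) : f = g := by
  have := Sm.epi_whiskerLeft_quo T Y Z X.right
  exact Sm.quo_ext ((cancel_epi (X.right ◁ Sm.quo Y Z)).1 h)

/-- The associator isomorphism for the smash product. -/
@[simps]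
noncomputable def assocIso (X Y Z : Under (𝟙_ M)) :
    Sm.smash (Sm.smash X Y) Z ≅ Sm.smash X (Sm.smash Y Z) where
  hom := Sm.assocHom T X Y Z
  inv := Sm.assocInv T X Y Z
  hom_inv_id := quo_quo_ext T (by
    rw [Under.comp_right, reassoc_of% Sm.quo_quo_assocHom T X Y Z, quo_quo_assocInv,
      Iso.hom_inv_id_assoc, Under.id_right, Category.comp_id])
  inv_hom_id := quo_quo_ext' T (by
    rw [Under.comp_right, reassoc_of% Sm.quo_quo_assocInv T X Y Z, quo_quo_assocHom,
      Iso.inv_hom_id_assoc, Under.id_right, Category.comp_id])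

lemma assocHom_naturality_left {X X' : Under (𝟙_ M)} (f : X ⟶ X') (Y Z : Under (𝟙_ M)) :
    Sm.smashR (Sm.smashR f Y) Z ≫ Sm.assocHom T X' Y Z =
      Sm.assocHom T X Y Z ≫ Sm.smashR f (Sm.smash Y Z) := by
  refine quo_quo_ext T ?_
  rw [Under.comp_right, Under.comp_right, ← whiskerRight_quo_assoc, ← comp_whiskerRight_assoc,
    ← whiskerRight_quo, comp_whiskerRight_assoc, quo_quo_assocHom,
    reassoc_of% Sm.quo_quo_assocHom T X Y Z, ← whiskerRight_quo,
    whisker_exchange_assoc, associator_naturality_left_assoc]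

lemma assocHom_naturality_middle (X : Under (𝟙_ M)) {Y Y' : Under (𝟙_ M)} (f : Y ⟶ Y')
    (Z : Under (𝟙_ M)) :
    Sm.smashR (Sm.smashL X f) Z ≫ Sm.assocHom T X Y' Z =
      Sm.assocHom T X Y Z ≫ Sm.smashL X (Sm.smashR f Z) := by
  refine quo_quo_ext T ?_
  rw [Under.comp_right, Under.comp_right, ← whiskerRight_quo_assoc, ← comp_whiskerRight_assoc,
    ← whiskerLeft_quo, comp_whiskerRight_assoc, quo_quo_assocHom,
    reassoc_of% Sm.quo_quo_assocHom T X Y Z, ← whiskerLeft_quo,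
    ← MonoidalCategory.whiskerLeft_comp_assoc, ← whiskerRight_quo,
    MonoidalCategory.whiskerLeft_comp_assoc, associator_naturality_middle_assoc]

lemma assocHom_naturality_right (X Y : Under (𝟙_ M)) {Z Z' : Under (𝟙_ M)} (f : Z ⟶ Z') :
    Sm.smashL (Sm.smash X Y) f ≫ Sm.assocHom T X Y Z' =
      Sm.assocHom T X Y Z ≫ Sm.smashL X (Sm.smashL Y f) := by
  refine quo_quo_ext T ?_
  rw [Under.comp_right, Under.comp_right, ← whiskerLeft_quo_assoc, ← whisker_exchange_assoc,
    quo_quo_assocHom,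
    reassoc_of% Sm.quo_quo_assocHom T X Y Z, ← whiskerLeft_quo,
    ← MonoidalCategory.whiskerLeft_comp_assoc, ← whiskerLeft_quo,
    MonoidalCategory.whiskerLeft_comp_assoc, associator_naturality_right_assoc]

lemma assocHom_pentagon (W X Y Z : Under (𝟙_ M)) :
    Sm.smashR (Sm.assocHom T W X Y) Z ≫ Sm.assocHom T W (Sm.smash X Y) Z ≫
        Sm.smashL W (Sm.assocHom T X Y Z) =
      Sm.assocHom T (Sm.smash W X) Y Z ≫ Sm.assocHom T W X (Sm.smash Y Z) := by
  -- The source is a quotient of the fourfold monoidal product by three successive epimorphisms.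
  have : Epi ((Sm.quo W X ▷ Y.right) ▷ Z.right) := by
    have := (T.adjR.adj Z.right).leftAdjoint_preservesColimits
    have := Sm.epi_quo_whiskerRight T W X Y.right
    exact inferInstanceAs (Epi (((curriedTensor M).flip.obj Z.right).map _))
  refine quo_quo_ext T ((cancel_epi ((Sm.quo W X ▷ Y.right) ▷ Z.right)).1 ?_)
  simp only [Under.comp_right]
  rw [← whiskerRight_quo_assoc, ← comp_whiskerRight_assoc, ← comp_whiskerRight_assoc,
    Category.assoc, quo_quo_assocHom, comp_whiskerRight_assoc, comp_whiskerRight_assoc,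
    reassoc_of% Sm.quo_quo_assocHom T W (Sm.smash X Y) Z, ← whiskerLeft_quo,
    associator_naturality_middle_assoc, ← MonoidalCategory.whiskerLeft_comp_assoc,
    ← MonoidalCategory.whiskerLeft_comp_assoc, Category.assoc, quo_quo_assocHom,
    reassoc_of% Sm.quo_quo_assocHom T (Sm.smash W X) Y Z, associator_naturality_left_assoc,
    ← whisker_exchange_assoc, quo_quo_assocHom]
  simp

end Associator

/-! ### The unit -/

section Unit

variable [HasBinaryCoproducts M]

/-- The zero-sphere `* ⊔ *`, based at the first summand. -/
noncomputable def sphere (M : Type u) [Category.{v} M] [MonoidalCategory M]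
    [HasBinaryCoproducts M] : Under (𝟙_ M) :=
  Under.mk (coprod.inl : 𝟙_ M ⟶ 𝟙_ M ⨿ 𝟙_ M)

/-- The inclusion of the summand of the zero-sphere which is not the base point. -/
noncomputable def sphereIncl (M : Type u) [Category.{v} M] [MonoidalCategory M]
    [HasBinaryCoproducts M] : 𝟙_ M ⟶ (sphere M).right :=
  coprod.inr

section

variable {L R : M ⥤ M} (adj : L ⊣ R)

/-- A left adjoint preserves the coproduct defining the zero-sphere. -/
noncomputable def sphereDesc (adj : L ⊣ R) {W : M} (a b : L.obj (𝟙_ M) ⟶ W) :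
    L.obj (sphere M).right ⟶ W :=
  (adj.homEquiv _ _).symm (coprod.desc (adj.homEquiv _ _ a) (adj.homEquiv _ _ b))

lemma map_base_sphereDesc {W : M} (a b : L.obj (𝟙_ M) ⟶ W) :
    L.map (base (sphere M)) ≫ sphereDesc adj a b = a := by
  exact (adj.homEquiv_naturality_left_symm (base (sphere M)) _).symm.trans
    ((Equiv.symm_apply_eq _).2 (coprod.inl_desc _ _))

lemma map_sphereIncl_sphereDesc {W : M} (a b : L.obj (𝟙_ M) ⟶ W) :
    L.map (sphereIncl M) ≫ sphereDesc adj a b = b := by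
  exact (adj.homEquiv_naturality_left_symm (sphereIncl M) _).symm.trans
    ((Equiv.symm_apply_eq _).2 (coprod.inr_desc _ _))

lemma map_sphere_hom_ext (adj : L ⊣ R) {W : M} {f g : L.obj (sphere M).right ⟶ W}
    (h₁ : L.map (base (sphere M)) ≫ f = L.map (base (sphere M)) ≫ g)
    (h₂ : L.map (sphereIncl M) ≫ f = L.map (sphereIncl M) ≫ g) : f = g := by
  refine (adj.homEquiv _ _).injective (coprod.hom_ext ?_ ?_)
  · refine (adj.homEquiv_naturality_left (base (sphere M)) f).symm.trans ?_
    rw [h₁]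
    exact adj.homEquiv_naturality_left (base (sphere M)) g
  · refine (adj.homEquiv_naturality_left (sphereIncl M) f).symm.trans ?_
    rw [h₂]
    exact adj.homEquiv_naturality_left (sphereIncl M) g

end

variable (T : TwoVarAdj (curriedTensor M))

/-- A pointed map out of `S⁰ ∧ X` is determined by its restriction to the summand of `S⁰` which is
not the base point. -/
lemma leftUnit_ext (T : TwoVarAdj (curriedTensor M)) {X Y : Under (𝟙_ M)}
    {f g : Sm.smash (sphere M) X ⟶ Y}
    (h : sphereIncl M ▷ X.right ≫ Sm.quo (sphere M) X ≫ f.right =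
      sphereIncl M ▷ X.right ≫ Sm.quo (sphere M) X ≫ g.right) : f = g := by
  refine Sm.quo_ext (map_sphere_hom_ext (T.adjR.adj X.right) ?_ h)
  change base (sphere M) ▷ X.right ≫ _ = base (sphere M) ▷ X.right ≫ _
  rw [← Category.assoc, ← Category.assoc, base_whiskerRight_quo, zeroMap_right, zeroMap_right]

lemma rightUnit_ext (T : TwoVarAdj (curriedTensor M)) {X Y : Under (𝟙_ M)}
    {f g : Sm.smash X (sphere M) ⟶ Y}
    (h : X.right ◁ sphereIncl M ≫ Sm.quo X (sphere M) ≫ f.right =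
      X.right ◁ sphereIncl M ≫ Sm.quo X (sphere M) ≫ g.right) : f = g := by
  refine Sm.quo_ext (map_sphere_hom_ext (T.adjL.adj X.right) ?_ h)
  change X.right ◁ base (sphere M) ≫ _ = X.right ◁ base (sphere M) ≫ _
  rw [← Category.assoc, ← Category.assoc, whiskerLeft_base_quo, zeroMap_right, zeroMap_right]

/-- The left unitor for the smash product. -/
noncomputable def leftUnitHom (X : Under (𝟙_ M)) : Sm.smash (sphere M) X ⟶ X :=
  Sm.quoDesc (sphereDesc (T.adjR.adj X.right) (zeroMap ht _ X) (λ_ X.right).hom)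
    (map_base_sphereDesc (T.adjR.adj X.right) _ _)
    (by
      refine map_sphere_hom_ext (T.adjR.adj (𝟙_ M)) ?_ ?_
      · change base (sphere M) ▷ 𝟙_ M ≫ _ = base (sphere M) ▷ 𝟙_ M ≫ _
        rw [← whisker_exchange_assoc]
        refine (congrArg (𝟙_ M ◁ base X ≫ ·)
          (map_base_sphereDesc (T.adjR.adj X.right) _ _)).trans ?_
        exact (comp_zeroMap (T' := 𝟙_ M ⊗ X.right) _ X).trans (comp_zeroMap _ X).symm
      · change sphereIncl M ▷ 𝟙_ M ≫ _ = sphereIncl M ▷ 𝟙_ M ≫ _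
        rw [← whisker_exchange_assoc]
        refine (congrArg (𝟙_ M ◁ base X ≫ ·)
          (map_sphereIncl_sphereDesc (T.adjR.adj X.right) _ _)).trans ?_
        rw [comp_zeroMap, leftUnitor_naturality, base_eq_zeroMap (ht := ht), comp_zeroMap])

@[simp]
lemma quo_leftUnitHom (X : Under (𝟙_ M)) :
    sphereIncl M ▷ X.right ≫ Sm.quo (sphere M) X ≫ (Sm.leftUnitHom T X).right =
      (λ_ X.right).hom := by
  rw [leftUnitHom, quo_quoDesc]
  exact map_sphereIncl_sphereDesc (T.adjR.adj X.right) _ _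

/-- The left unitor isomorphism for the smash product. -/
noncomputable def leftUnitIso (X : Under (𝟙_ M)) : Sm.smash (sphere M) X ≅ X where
  hom := Sm.leftUnitHom T X
  inv := Under.homMk ((λ_ X.right).inv ≫ sphereIncl M ▷ X.right ≫ Sm.quo (sphere M) X) (by
    change base X ≫ _ = base _
    rw [leftUnitor_inv_naturality_assoc, whisker_exchange_assoc, whiskerLeft_base_quo,
      comp_zeroMap, comp_zeroMap, zeroMap_pt])
  hom_inv_id := Sm.leftUnit_ext T (by
    rw [Under.comp_right, reassoc_of% Sm.quo_leftUnitHom T X]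
    exact ((λ_ X.right).hom_inv_id_assoc _).trans
      (congrArg (_ ≫ ·) (Category.comp_id (Sm.quo _ _)).symm))
  inv_hom_id := under_ext (((Category.assoc _ _ _).trans (congrArg (_ ≫ ·)
    ((Category.assoc _ _ _).trans (Sm.quo_leftUnitHom T X)))).trans (λ_ X.right).inv_hom_id)

/-- The right unitor for the smash product. -/
noncomputable def rightUnitHom (X : Under (𝟙_ M)) : Sm.smash X (sphere M) ⟶ X :=
  Sm.quoDesc (sphereDesc (T.adjL.adj X.right) (zeroMap ht _ X) (ρ_ X.right).hom)
    (by
      refine map_sphere_hom_ext (T.adjL.adj (𝟙_ M)) ?_ ?_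
      · change 𝟙_ M ◁ base (sphere M) ≫ _ = 𝟙_ M ◁ base (sphere M) ≫ _
        rw [whisker_exchange_assoc]
        refine (congrArg (base X ▷ 𝟙_ M ≫ ·)
          (map_base_sphereDesc (T.adjL.adj X.right) _ _)).trans ?_
        exact (comp_zeroMap (T' := X.right ⊗ 𝟙_ M) _ X).trans (comp_zeroMap _ X).symm
      · change 𝟙_ M ◁ sphereIncl M ≫ _ = 𝟙_ M ◁ sphereIncl M ≫ _
        rw [whisker_exchange_assoc]
        refine (congrArg (base X ▷ 𝟙_ M ≫ ·)
          (map_sphereIncl_sphereDesc (T.adjL.adj X.right) _ _)).trans ?_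
        rw [comp_zeroMap, rightUnitor_naturality, base_eq_zeroMap (ht := ht), comp_zeroMap])
    (map_base_sphereDesc (T.adjL.adj X.right) _ _)

@[simp]
lemma quo_rightUnitHom (X : Under (𝟙_ M)) :
    X.right ◁ sphereIncl M ≫ Sm.quo X (sphere M) ≫ (Sm.rightUnitHom T X).right =
      (ρ_ X.right).hom := by
  rw [rightUnitHom, quo_quoDesc]
  exact map_sphereIncl_sphereDesc (T.adjL.adj X.right) _ _

/-- The right unitor isomorphism for the smash product. -/
noncomputable def rightUnitIso (X : Under (𝟙_ M)) : Sm.smash X (sphere M) ≅ X where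
  hom := Sm.rightUnitHom T X
  inv := Under.homMk ((ρ_ X.right).inv ≫ X.right ◁ sphereIncl M ≫ Sm.quo X (sphere M)) (by
    change base X ≫ _ = base _
    rw [rightUnitor_inv_naturality_assoc, ← whisker_exchange_assoc, base_whiskerRight_quo,
      comp_zeroMap, comp_zeroMap, zeroMap_pt])
  hom_inv_id := Sm.rightUnit_ext T (by
    rw [Under.comp_right, reassoc_of% Sm.quo_rightUnitHom T X]
    exact ((ρ_ X.right).hom_inv_id_assoc _).trans
      (congrArg (_ ≫ ·) (Category.comp_id (Sm.quo _ _)).symm))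
  inv_hom_id := under_ext (((Category.assoc _ _ _).trans (congrArg (_ ≫ ·)
    ((Category.assoc _ _ _).trans (Sm.quo_rightUnitHom T X)))).trans (ρ_ X.right).inv_hom_id)

lemma leftUnitHom_naturality {X Y : Under (𝟙_ M)} (f : X ⟶ Y) :
    Sm.smashL (sphere M) f ≫ Sm.leftUnitHom T Y = Sm.leftUnitHom T X ≫ f := by
  refine Sm.leftUnit_ext T ?_
  rw [Under.comp_right, Under.comp_right, ← whiskerLeft_quo_assoc, ← whisker_exchange_assoc,
    quo_leftUnitHom, reassoc_of% Sm.quo_leftUnitHom T X, leftUnitor_naturality]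

lemma rightUnitHom_naturality {X Y : Under (𝟙_ M)} (f : X ⟶ Y) :
    Sm.smashR f (sphere M) ≫ Sm.rightUnitHom T Y = Sm.rightUnitHom T X ≫ f := by
  refine Sm.rightUnit_ext T ?_
  rw [Under.comp_right, Under.comp_right, ← whiskerRight_quo_assoc, whisker_exchange_assoc,
    quo_rightUnitHom, reassoc_of% Sm.quo_rightUnitHom T X, rightUnitor_naturality]

lemma assocHom_triangle (X Y : Under (𝟙_ M)) :
    Sm.assocHom T X (sphere M) Y ≫ Sm.smashL X (Sm.leftUnitHom T Y) =
      Sm.smashR (Sm.rightUnitHom T X) Y := by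
  -- The inverse of the right unitor restricts the middle factor to the summand of `S⁰` on which
  -- both unitors are known.
  rw [← cancel_epi (Sm.smashR (Sm.rightUnitIso T X).inv Y)]
  refine Sm.quo_ext ?_
  simp only [Under.comp_right]
  rw [← whiskerRight_quo_assoc, ← whiskerRight_quo_assoc, ← whiskerRight_quo]
  change ((ρ_ X.right).inv ≫ X.right ◁ sphereIncl M ≫ Sm.quo X (sphere M)) ▷ Y.right ≫ _ =
    ((ρ_ X.right).inv ≫ X.right ◁ sphereIncl M ≫ Sm.quo X (sphere M)) ▷ Y.right ≫ _
  rw [← comp_whiskerRight_assoc, Category.assoc, Category.assoc, quo_rightUnitHom,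
    Iso.inv_hom_id, id_whiskerRight, Category.id_comp, comp_whiskerRight, comp_whiskerRight,
    Category.assoc, Category.assoc, reassoc_of% Sm.quo_quo_assocHom T X (sphere M) Y,
    ← whiskerLeft_quo, associator_naturality_middle_assoc,
    ← MonoidalCategory.whiskerLeft_comp_assoc, ← MonoidalCategory.whiskerLeft_comp_assoc,
    Category.assoc, quo_leftUnitHom]
  simp

end Unit

end Monoidal

end SmashData

/-! ### Existence of smash products -/

section Existence

variable {M : Type u} [Category.{v} M] [HasColimits M] [MonoidalCategory M]

/-- The smash product of two pointed objects, as a pushout. -/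
noncomputable def smashObj (ht : IsTerminal (𝟙_ M)) (X Y : Under (𝟙_ M)) : Under (𝟙_ M) :=
  Under.mk (pushout.inr (wedgeToTensor X Y) (ht.from (pushout X.hom Y.hom)))

/-- The quotient map from the monoidal product to the smash product. -/
noncomputable def smashQuo (ht : IsTerminal (𝟙_ M)) (X Y : Under (𝟙_ M)) :
    X.right ⊗ Y.right ⟶ (smashObj ht X Y).right :=
  pushout.inl (wedgeToTensor X Y) (ht.from (pushout X.hom Y.hom))

variable {ht : IsTerminal (𝟙_ M)}

lemma wedgeToTensor_smashQuo (X Y : Under (𝟙_ M)) :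
    wedgeToTensor X Y ≫ smashQuo ht X Y = zeroMap ht _ (smashObj ht X Y) :=
  pushout.condition

lemma base_whiskerRight_smashQuo (X Y : Under (𝟙_ M)) :
    base X ▷ Y.right ≫ smashQuo ht X Y = zeroMap ht _ (smashObj ht X Y) := by
  rw [← cancel_epi (λ_ Y.right).inv, ← Category.assoc, ← SmashData.inr_wedgeToTensor,
    Category.assoc, wedgeToTensor_smashQuo, comp_zeroMap, comp_zeroMap]

lemma whiskerLeft_base_smashQuo (X Y : Under (𝟙_ M)) :
    X.right ◁ base Y ≫ smashQuo ht X Y = zeroMap ht _ (smashObj ht X Y) := by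
  rw [← cancel_epi (ρ_ X.right).inv, ← Category.assoc, ← SmashData.inl_wedgeToTensor,
    Category.assoc, wedgeToTensor_smashQuo, comp_zeroMap, comp_zeroMap]

/-- The quotient map is an epimorphism because the base point of the smash product factors
through it. -/
instance epi_smashQuo (X Y : Under (𝟙_ M)) : Epi (smashQuo ht X Y) where
  left_cancellation {Z} a b h := by
    refine pushout.hom_ext h ?_
    have e : (λ_ (𝟙_ M)).inv ≫ (base X ▷ 𝟙_ M ≫ X.right ◁ base Y) ≫ smashQuo ht X Y =
        base (smashObj ht X Y) := by
      rw [Category.assoc, whiskerLeft_base_smashQuo, comp_zeroMap, comp_zeroMap, zeroMap_pt]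
    change base (smashObj ht X Y) ≫ a = base (smashObj ht X Y) ≫ b
    rw [← e]
    simp only [Category.assoc, h]

/-- The universal property of the smash product. -/
noncomputable def smashDesc {X Y Z : Under (𝟙_ M)} (g : X.right ⊗ Y.right ⟶ Z.right)
    (h₁ : base X ▷ Y.right ≫ g = zeroMap ht _ Z) (h₂ : X.right ◁ base Y ≫ g = zeroMap ht _ Z) :
    smashObj ht X Y ⟶ Z :=
  Under.homMk (pushout.desc g (base Z) (by
    change _ = zeroMap ht _ Z
    refine pushout.hom_ext ?_ ?_
    · rw [reassoc_of% SmashData.inl_wedgeToTensor X Y, h₂, comp_zeroMap, comp_zeroMap]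
    · rw [reassoc_of% SmashData.inr_wedgeToTensor X Y, h₁, comp_zeroMap, comp_zeroMap]))
    (pushout.inr_desc _ _ _)

lemma smashQuo_smashDesc {X Y Z : Under (𝟙_ M)} (g : X.right ⊗ Y.right ⟶ Z.right)
    (h₁ : base X ▷ Y.right ≫ g = zeroMap ht _ Z) (h₂ : X.right ◁ base Y ≫ g = zeroMap ht _ Z) :
    smashQuo ht X Y ≫ (smashDesc g h₁ h₂).right = g :=
  pushout.inl_desc _ _ _

lemma smashObj_hom_ext {X Y Z : Under (𝟙_ M)} {f g : smashObj ht X Y ⟶ Z}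
    (h : smashQuo ht X Y ≫ f.right = smashQuo ht X Y ≫ g.right) : f = g :=
  under_ext ((cancel_epi (smashQuo ht X Y)).1 h)

/-- The action of the smash product on maps. -/
noncomputable def smashMap (ht : IsTerminal (𝟙_ M)) {X X' Y Y' : Under (𝟙_ M)} (f : X ⟶ X')
    (g : Y ⟶ Y') : smashObj ht X Y ⟶ smashObj ht X' Y' :=
  smashDesc ((f.right ⊗ₘ g.right) ≫ smashQuo ht X' Y')
    (by
      rw [MonoidalCategory.tensorHom_def, Category.assoc, ← comp_whiskerRight_assoc, base_right,
        ← whisker_exchange_assoc, base_whiskerRight_smashQuo, comp_zeroMap])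
    (by
      rw [MonoidalCategory.tensorHom_def', Category.assoc,
        ← MonoidalCategory.whiskerLeft_comp_assoc, base_right,
        whisker_exchange_assoc, whiskerLeft_base_smashQuo, comp_zeroMap])

lemma smashQuo_smashMap {X X' Y Y' : Under (𝟙_ M)} (f : X ⟶ X') (g : Y ⟶ Y') :
    smashQuo ht X Y ≫ (smashMap ht f g).right = (f.right ⊗ₘ g.right) ≫ smashQuo ht X' Y' :=
  smashQuo_smashDesc _ _ _

lemma smashMap_id (X Y : Under (𝟙_ M)) : smashMap ht (𝟙 X) (𝟙 Y) = 𝟙 _ := by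
  refine smashObj_hom_ext ?_
  rw [smashQuo_smashMap, Under.id_right, Under.id_right, id_tensorHom_id, Category.id_comp,
    Under.id_right, Category.comp_id]

lemma smashMap_comp {X X' X'' Y Y' Y'' : Under (𝟙_ M)} (f : X ⟶ X') (f' : X' ⟶ X'') (g : Y ⟶ Y')
    (g' : Y' ⟶ Y'') :
    smashMap ht (f ≫ f') (g ≫ g') = smashMap ht f g ≫ smashMap ht f' g' := by
  refine smashObj_hom_ext ?_
  rw [smashQuo_smashMap, Under.comp_right, Under.comp_right, Under.comp_right,
    reassoc_of% smashQuo_smashMap, smashQuo_smashMap, tensorHom_comp_tensorHom_assoc]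

/-- The smash product as a bifunctor. -/
@[simps]
noncomputable def smashFunctor (ht : IsTerminal (𝟙_ M)) :
    Under (𝟙_ M) ⥤ Under (𝟙_ M) ⥤ Under (𝟙_ M) where
  obj X :=
    { obj Y := smashObj ht X Y
      map g := smashMap ht (𝟙 X) g
      map_id Y := smashMap_id X Y
      map_comp g g' := by rw [← smashMap_comp, Category.comp_id] }
  map f :=
    { app Y := smashMap ht f (𝟙 Y)
      naturality Y Y' g := by
        rw [← smashMap_comp, ← smashMap_comp]
        exact congrArg₂ (fun a b => smashMap ht a b)
          ((Category.id_comp _).trans (Category.comp_id _).symm)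
          ((Category.comp_id _).trans (Category.id_comp _).symm) }
  map_id X := by
    ext Y : 2
    exact smashMap_id X Y
  map_comp f f' := by
    ext Y : 2
    exact (congrArg (smashMap ht (f ≫ f')) (Category.id_comp (𝟙 Y)).symm).trans
      (smashMap_comp f f' (𝟙 Y) (𝟙 Y))

/-- The smash product of pointed objects. -/
noncomputable def smashData (ht : IsTerminal (𝟙_ M)) : SmashData ht (curriedTensor M) where
  S := smashFunctor ht
  q X Y := smashQuo ht X Y
  nat_left f Y := by
    refine Eq.trans ?_ (smashQuo_smashMap f (𝟙 Y)).symm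
    rw [Under.id_right, tensorHom_id]
    rfl
  nat_right X _ _ g := by
    refine Eq.trans ?_ (smashQuo_smashMap (𝟙 X) g).symm
    rw [Under.id_right, id_tensorHom]
    rfl
  epi_q X Y := epi_smashQuo X Y
  zero_left X Y := base_whiskerRight_smashQuo X Y
  zero_right X Y := whiskerLeft_base_smashQuo X Y
  desc g h₁ h₂ := smashDesc g h₁ h₂
  q_desc g h₁ h₂ := smashQuo_smashDesc g h₁ h₂

end Existence

namespace SmashData

/-! ### The monoidal structure on pointed objects -/

section Monoidal

variable {M : Type u} [Category.{v} M] [MonoidalCategory M] [HasBinaryCoproducts M]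
  {ht : IsTerminal (𝟙_ M)} (Sm : SmashData ht (curriedTensor M))
  (T : TwoVarAdj (curriedTensor M))

/-- The monoidal structure on pointed objects given by the smash product. -/
@[reducible]
noncomputable def monoidalCategory : MonoidalCategory (Under (𝟙_ M)) where
  tensorObj X Y := Sm.smash X Y
  whiskerLeft X _ _ g := Sm.smashL X g
  whiskerRight f Y := Sm.smashR f Y
  tensorUnit := sphere M
  associator X Y Z := Sm.assocIso T X Y Z
  leftUnitor X := Sm.leftUnitIso T X
  rightUnitor X := Sm.rightUnitIso T X
  tensorHom_def _ _ := rfl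
  id_tensorHom_id X Y := by
    change (Sm.S.map (𝟙 X)).app Y ≫ (Sm.S.obj X).map (𝟙 Y) = _
    simp
  tensorHom_comp_tensorHom {X₁ Y₁ Z₁ X₂ Y₂ Z₂} f₁ f₂ g₁ g₂ := by
    change ((Sm.S.map f₁).app X₂ ≫ (Sm.S.obj Y₁).map f₂) ≫ (Sm.S.map g₁).app Y₂ ≫
      (Sm.S.obj Z₁).map g₂ = (Sm.S.map (f₁ ≫ g₁)).app X₂ ≫ (Sm.S.obj Z₁).map (f₂ ≫ g₂)
    simp
  whiskerLeft_id X Y := (Sm.S.obj X).map_id Y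
  id_whiskerRight X Y := by
    change (Sm.S.map (𝟙 X)).app Y = _
    simp
  associator_naturality {X₁ X₂ X₃ Y₁ Y₂ Y₃} f₁ f₂ f₃ := by
    change ((Sm.S.map (Sm.smashR f₁ X₂ ≫ Sm.smashL Y₁ f₂)).app X₃ ≫ Sm.smashL (Sm.smash Y₁ Y₂) f₃) ≫
      Sm.assocHom T Y₁ Y₂ Y₃ = Sm.assocHom T X₁ X₂ X₃ ≫ Sm.smashR f₁ (Sm.smash X₂ X₃) ≫
        Sm.smashL Y₁ (Sm.smashR f₂ X₃ ≫ Sm.smashL Y₂ f₃)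
    rw [Category.assoc, assocHom_naturality_right, Functor.map_comp, NatTrans.comp_app,
      Category.assoc, reassoc_of% Sm.assocHom_naturality_middle T Y₁ f₂ X₃,
      reassoc_of% Sm.assocHom_naturality_left T f₁ X₂ X₃, ← Functor.map_comp]
  leftUnitor_naturality f := Sm.leftUnitHom_naturality T f
  rightUnitor_naturality f := Sm.rightUnitHom_naturality T f
  pentagon W X Y Z := Sm.assocHom_pentagon T W X Y Z
  triangle X Y := Sm.assocHom_triangle T X Y

/-- The forgetful functor from pointed objects is lax monoidal, with structure maps the quotient
maps and the inclusion of the second summand of the zero-sphere. -/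
@[reducible]
noncomputable def laxMonoidal :
    letI := Sm.monoidalCategory T
    (Under.forget (𝟙_ M)).LaxMonoidal :=
  letI := Sm.monoidalCategory T
  { ε := sphereIncl M
    μ X Y := Sm.quo X Y
    μ_natural_left f Y := Sm.whiskerRight_quo f Y
    μ_natural_right X g := Sm.whiskerLeft_quo X g
    associativity X Y Z := Sm.quo_quo_assocHom T X Y Z
    left_unitality X := (Sm.quo_leftUnitHom T X).symm
    right_unitality X := (Sm.quo_rightUnitHom T X).symm }

end Monoidal

section

variable {M : Type u} [Category.{v} M] [MonoidalCategory M] [HasColimits M]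
  {ht : IsTerminal (𝟙_ M)} (Sm : SmashData ht (curriedTensor M))
  (T : TwoVarAdj (curriedTensor M))

lemma isSmash :
    letI := Sm.monoidalCategory T
    letI := Sm.laxMonoidal T
    IsSmash ht :=
  letI := Sm.monoidalCategory T
  letI := Sm.laxMonoidal T
  { isPushout X Y := Sm.isPushout_quo X Y
    unit := ⟨coprodIsCoprod (𝟙_ M) (𝟙_ M)⟩ }

end

/-! ### The symmetry -/

section Braiding

variable {M : Type u} [Category.{v} M] [MonoidalCategory M] {ht : IsTerminal (𝟙_ M)}
  (Sm : SmashData ht (curriedTensor M))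

/-- The symmetry of the smash product. -/
def braidHom [BraidedCategory M] (X Y : Under (𝟙_ M)) : Sm.smash X Y ⟶ Sm.smash Y X :=
  Sm.quoDesc ((β_ X.right Y.right).hom ≫ Sm.quo Y X)
    (by rw [BraidedCategory.braiding_naturality_left_assoc, whiskerLeft_base_quo, comp_zeroMap])
    (by rw [BraidedCategory.braiding_naturality_right_assoc, base_whiskerRight_quo, comp_zeroMap])

lemma quo_braidHom [BraidedCategory M] (X Y : Under (𝟙_ M)) :
    Sm.quo X Y ≫ (Sm.braidHom X Y).right = (β_ X.right Y.right).hom ≫ Sm.quo Y X :=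
  Sm.quo_quoDesc _ _ _

lemma braidHom_braidHom [SymmetricCategory M] (X Y : Under (𝟙_ M)) :
    Sm.braidHom X Y ≫ Sm.braidHom Y X = 𝟙 _ := by
  refine Sm.quo_ext ?_
  rw [Under.comp_right, reassoc_of% Sm.quo_braidHom X Y, quo_braidHom,
    SymmetricCategory.symmetry_assoc, Under.id_right, Category.comp_id]

/-- The symmetry of the smash product, as an isomorphism. -/
@[simps]
def braidIso [SymmetricCategory M] (X Y : Under (𝟙_ M)) : Sm.smash X Y ≅ Sm.smash Y X where
  hom := Sm.braidHom X Y
  inv := Sm.braidHom Y X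
  hom_inv_id := Sm.braidHom_braidHom X Y
  inv_hom_id := Sm.braidHom_braidHom Y X

lemma braidHom_naturality_left [BraidedCategory M] {X X' : Under (𝟙_ M)} (f : X ⟶ X')
    (Y : Under (𝟙_ M)) :
    Sm.smashR f Y ≫ Sm.braidHom X' Y = Sm.braidHom X Y ≫ Sm.smashL Y f := by
  refine Sm.quo_ext ?_
  rw [Under.comp_right, Under.comp_right, ← whiskerRight_quo_assoc, quo_braidHom,
    reassoc_of% Sm.quo_braidHom X Y, ← whiskerLeft_quo,
    BraidedCategory.braiding_naturality_left_assoc]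

lemma braidHom_naturality_right [BraidedCategory M] (X : Under (𝟙_ M)) {Y Y' : Under (𝟙_ M)}
    (g : Y ⟶ Y') : Sm.smashL X g ≫ Sm.braidHom X Y' = Sm.braidHom X Y ≫ Sm.smashR g X := by
  refine Sm.quo_ext ?_
  rw [Under.comp_right, Under.comp_right, ← whiskerLeft_quo_assoc, quo_braidHom,
    reassoc_of% Sm.quo_braidHom X Y, ← whiskerRight_quo,
    BraidedCategory.braiding_naturality_right_assoc]

variable (T : TwoVarAdj (curriedTensor M))

lemma braidHom_hexagon [BraidedCategory M] (X Y Z : Under (𝟙_ M)) :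
    Sm.assocHom T X Y Z ≫ Sm.braidHom X (Sm.smash Y Z) ≫ Sm.assocHom T Y Z X =
      Sm.smashR (Sm.braidHom X Y) Z ≫ Sm.assocHom T Y X Z ≫ Sm.smashL Y (Sm.braidHom X Z) := by
  refine quo_quo_ext T ?_
  simp only [Under.comp_right]
  rw [reassoc_of% Sm.quo_quo_assocHom T X Y Z, reassoc_of% Sm.quo_braidHom X (Sm.smash Y Z),
    BraidedCategory.braiding_naturality_right_assoc, quo_quo_assocHom,
    ← whiskerRight_quo_assoc, ← comp_whiskerRight_assoc, quo_braidHom, comp_whiskerRight_assoc,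
    reassoc_of% Sm.quo_quo_assocHom T Y X Z, ← whiskerLeft_quo,
    ← MonoidalCategory.whiskerLeft_comp_assoc, quo_braidHom,
    MonoidalCategory.whiskerLeft_comp_assoc, BraidedCategory.hexagon_forward_assoc]

lemma braidHom_hexagon_inv [BraidedCategory M] (X Y Z : Under (𝟙_ M)) :
    Sm.assocInv T X Y Z ≫ Sm.braidHom (Sm.smash X Y) Z ≫ Sm.assocInv T Z X Y =
      Sm.smashL X (Sm.braidHom Y Z) ≫ Sm.assocInv T X Z Y ≫ Sm.smashR (Sm.braidHom X Z) Y := by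
  refine quo_quo_ext' T ?_
  simp only [Under.comp_right]
  rw [reassoc_of% Sm.quo_quo_assocInv T X Y Z, reassoc_of% Sm.quo_braidHom (Sm.smash X Y) Z,
    BraidedCategory.braiding_naturality_left_assoc, quo_quo_assocInv,
    ← whiskerLeft_quo_assoc, ← MonoidalCategory.whiskerLeft_comp_assoc, quo_braidHom,
    MonoidalCategory.whiskerLeft_comp_assoc,
    reassoc_of% Sm.quo_quo_assocInv T X Z Y, ← whiskerRight_quo,
    ← comp_whiskerRight_assoc, quo_braidHom, comp_whiskerRight_assoc,
    BraidedCategory.hexagon_reverse_assoc]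

/-- The symmetric monoidal structure on pointed objects. -/
@[reducible]
noncomputable def symmetricCategory [HasBinaryCoproducts M] [SymmetricCategory M] :
    letI := Sm.monoidalCategory T
    SymmetricCategory (Under (𝟙_ M)) :=
  letI := Sm.monoidalCategory T
  { braiding X Y := Sm.braidIso X Y
    braiding_naturality_left f Y := Sm.braidHom_naturality_left f Y
    braiding_naturality_right X _ _ g := Sm.braidHom_naturality_right X g
    hexagon_forward X Y Z := Sm.braidHom_hexagon T X Y Z
    hexagon_reverse X Y Z := Sm.braidHom_hexagon_inv T X Y Z
    symmetry X Y := Sm.braidHom_braidHom X Y }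

end Braiding

end SmashData

open AWFS

/-! ### The underlying weak factorization system -/

namespace AWFS

variable {C : Type u} [Category.{v} C] (A : AWFS C)

lemma leftClass_l (f : Arrow C) : A.leftClass (A.l f) :=
  (A.leftClass_iff _).2 ⟨A.δ f, A.l_δ f, A.left_counit f⟩

lemma rightClass_r (f : Arrow C) : A.rightClass (A.r f) :=
  (A.rightClass_iff _).2 ⟨A.μ f, A.μ_r f, A.left_unit f⟩

lemma hasLiftingProperty {X Y Z W : C} {i : X ⟶ Y} {p : Z ⟶ W} (hi : A.leftClass i)
    (hp : A.rightClass p) : HasLiftingProperty i p where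
  sq_hasLift {f g} sq := by
    obtain ⟨s, hs, hs'⟩ := (A.leftClass_iff i).1 hi
    obtain ⟨t, ht, ht'⟩ := (A.rightClass_iff p).1 hp
    have h₁ := A.l_map (Arrow.homMk (f := Arrow.mk i) (g := Arrow.mk p) f g sq.w)
    have h₂ := A.map_r (Arrow.homMk (f := Arrow.mk i) (g := Arrow.mk p) f g sq.w)
    refine ⟨⟨s ≫ A.E.map (Arrow.homMk (f := Arrow.mk i) (g := Arrow.mk p) f g sq.w) ≫ t, ?_, ?_⟩⟩
    · rw [reassoc_of% hs, reassoc_of% h₁, ht']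
      exact Category.comp_id f
    · rw [Category.assoc, Category.assoc, ht, h₂, reassoc_of% hs']
      rfl

lemma leftClass_eq_llp : A.leftClass = A.rightClass.llp := by
  ext X Y i
  refine ⟨fun hi _ _ p hp => A.hasLiftingProperty hi hp, fun h => ?_⟩
  have := h _ (A.rightClass_r (Arrow.mk i))
  have sq : CommSq (A.l (Arrow.mk i)) i (A.r (Arrow.mk i)) (𝟙 Y) :=
    ⟨(A.fac (Arrow.mk i)).trans (Category.comp_id i).symm⟩
  exact (A.leftClass_iff i).2 ⟨sq.lift, sq.fac_left, sq.fac_right⟩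

instance : A.leftClass.IsMultiplicative := by
  rw [leftClass_eq_llp]
  infer_instance

instance : A.leftClass.IsStableUnderCobaseChange := by
  rw [leftClass_eq_llp]
  infer_instance

end AWFS

/-! ### Pushout-products of maps in the left classes -/

section PushoutProduct

variable {K : Type u₁} {M : Type u₂} {N : Type u₃}
  [Category.{v₁} K] [Category.{v₂} M] [Category.{v₃} N]
  {F : K ⥤ M ⥤ N} {T : TwoVarAdj F} [HasPullbacks K] [HasPullbacks M] [HasPushouts N]
  {A : AWFS K} {B : AWFS M} {D : AWFS N}

/-- Compatibility of `λ` with the right factors follows from the counit law for the coalgebra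
structure on the pushout-product of two free coalgebras. -/
lemma lam_r (P : TwoVarAWFS T A B D) (i : Arrow K) (j : Arrow M) :
    P.lam i j ≫ D.r _ = (F.map (A.r i)).app (B.E.obj j) ≫ (F.obj i.right).map (B.r j) := by
  have h := (P.tensorStr (A.free i) (B.free j)).counit
  have h' : ((F.map (A.δ i)).app (B.E.obj j) ≫
      (F.obj (A.E.obj (Arrow.mk (A.l i)))).map (B.δ j) ≫
        P.lam (Arrow.mk (A.l i)) (Arrow.mk (B.l j))) ≫ D.r _ = 𝟙 _ :=
    (congrArg (· ≫ D.r _) (P.tensorStr_s (A.free i) (B.free j))).symm.trans h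
  rw [lam_eq_free, Category.assoc, D.map_r]
  exact ((Category.assoc _ _ _).symm.trans (congrArg (· ≫ _) h')).trans (Category.id_comp _)

/-- The left classes are closed under the pushout-product. A map in the left class has the structure
map of a coalgebra, except for coassociativity, and `λ` combines two of these into a third. -/
lemma leftClass_leibHom (P : TwoVarAWFS T A B D) {i : Arrow K} {j : Arrow M}
    (hi : A.leftClass i.hom) (hj : B.leftClass j.hom) : D.leftClass (leibHom F i j) := by
  obtain ⟨s, hs, hs'⟩ : ∃ s : i.right ⟶ A.E.obj i, i.hom ≫ s = A.l i ∧ s ≫ A.r i = 𝟙 i.right :=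
    (A.leftClass_iff i.hom).1 hi
  obtain ⟨s', ht, ht'⟩ : ∃ s : j.right ⟶ B.E.obj j, j.hom ≫ s = B.l j ∧ s ≫ B.r j = 𝟙 j.right :=
    (B.leftClass_iff j.hom).1 hj
  have h₁ : leibInl F i j ≫ leibHom F i j ≫
      (F.map s).app j.right ≫ (F.obj (A.E.obj i)).map s' ≫ P.lam i j =
        leibInl F i j ≫ D.l ((F.leibnizPushout.obj i).obj j) := by
    rw [reassoc_of% leibInl_hom, NatTrans.naturality_assoc, ← Functor.map_comp_assoc, ht,
      obj_map_l_lam, ← NatTrans.comp_app_assoc, ← F.map_comp, hs', F.map_id, NatTrans.id_app,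
      Category.id_comp]
  have h₂ : leibInr F i j ≫ leibHom F i j ≫
      (F.map s).app j.right ≫ (F.obj (A.E.obj i)).map s' ≫ P.lam i j =
        leibInr F i j ≫ D.l ((F.leibnizPushout.obj i).obj j) := by
    rw [reassoc_of% leibInr_hom, ← NatTrans.comp_app_assoc, ← F.map_comp, hs,
      ← NatTrans.naturality_assoc, map_l_app_lam, ← Functor.map_comp_assoc, ht',
      CategoryTheory.Functor.map_id, Category.id_comp]
  have h₃ : (F.map s).app j.right ≫ (F.obj (A.E.obj i)).map s' ≫
      (F.map (A.r i)).app (B.E.obj j) ≫ (F.obj i.right).map (B.r j) =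
        𝟙 ((F.obj i.right).obj j.right) := by
    rw [NatTrans.naturality_assoc, ← NatTrans.comp_app_assoc, ← F.map_comp, hs',
      F.map_id, NatTrans.id_app, ← Functor.map_comp, ht']
    simp
  refine (D.leftClass_iff _).2
    ⟨(F.map s).app j.right ≫ (F.obj (A.E.obj i)).map s' ≫ P.lam i j, leib_hom_ext h₁ h₂, ?_⟩
  exact (Category.assoc _ _ _).trans ((congrArg (_ ≫ ·) ((Category.assoc _ _ _).trans
    (congrArg (_ ≫ ·) (lam_r P i j)))).trans h₃)

/-- A functor `F(X, -)` with `X` cofibrant preserves the left classes: the map `F(X, j)` is the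
pushout-product of `∅ ⟶ X` and `j`. -/
lemma leftClass_obj_map (P : TwoVarAWFS T A B D) [HasInitial K] {X : K}
    (hX : A.leftClass (initial.to X)) {Y Y' : M} {j : Y ⟶ Y'} (hj : B.leftClass j) :
    D.leftClass ((F.obj X).map j) := by
  have h := leftClass_leibHom P (i := Arrow.mk (initial.to X)) (j := Arrow.mk j) hX hj
  have hinit : ∀ Z : M, Nonempty (IsInitial ((F.obj (⊥_ K)).obj Z)) := fun Z => by
    have := (T.adjR.adj Z).leftAdjoint_preservesColimits
    exact ⟨initialIsInitial.isInitialObj (F.flip.obj Z)⟩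
  have : IsIso ((F.obj (⊥_ K)).map j) :=
    isIso_of_isInitial (hinit Y).some (hinit Y').some _
  have hp := leib_isPushout (F := F) (Arrow.mk (initial.to X)) (Arrow.mk j)
  have : IsIso (leibInl F (Arrow.mk (initial.to X)) (Arrow.mk j)) := hp.isIso_inl_of_isIso this
  have e := leibInl_hom (F := F) (Arrow.mk (initial.to X)) (Arrow.mk j)
  have := D.leftClass.comp_mem _ _ (D.leftClass.of_isIso (leibInl F _ _)) h
  rw [e] at this
  exact this

lemma leftClass_map_app (P : TwoVarAWFS T A B D) [HasInitial M] {Y : M}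
    (hY : B.leftClass (initial.to Y)) {X X' : K} {i : X ⟶ X'} (hi : A.leftClass i) :
    D.leftClass ((F.map i).app Y) := by
  have h := leftClass_leibHom P (i := Arrow.mk i) (j := Arrow.mk (initial.to Y)) hi hY
  have hinit : ∀ Z : K, Nonempty (IsInitial ((F.obj Z).obj (⊥_ M))) := fun Z => by
    have := (T.adjL.adj Z).leftAdjoint_preservesColimits
    exact ⟨initialIsInitial.isInitialObj (F.obj Z)⟩
  have : IsIso ((F.map i).app (⊥_ M)) :=
    isIso_of_isInitial (hinit X).some (hinit X').some _
  have hp := leib_isPushout (F := F) (Arrow.mk i) (Arrow.mk (initial.to Y))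
  have : IsIso (leibInr F (Arrow.mk i) (Arrow.mk (initial.to Y))) := hp.isIso_inr_of_isIso this
  have e := leibInr_hom (F := F) (Arrow.mk i) (Arrow.mk (initial.to Y))
  have := D.leftClass.comp_mem _ _ (D.leftClass.of_isIso (leibInr F _ _)) h
  rw [e] at this
  exact this

end PushoutProduct

/-! ### Weak equivalences between cofibrant objects and the unit axiom -/

namespace AlgModelStr

variable {M : Type u} [Category.{v} M] [HasLimits M] [HasColimits M] (S : AlgModelStr M)

lemma W_of_leftClass {X Y : M} {f : X ⟶ Y} (h : S.tc.leftClass f) : S.W f := by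
  rw [S.left_eq] at h
  exact h.2

lemma W_of_rightClass {X Y : M} {f : X ⟶ Y} (h : S.cof.rightClass f) : S.W f := by
  rw [S.right_eq] at h
  exact h.2

lemma cof_inl {X Y : M} (h : S.IsCofibrant Y) : S.cof.leftClass (coprod.inl : X ⟶ X ⨿ Y) :=
  MorphismProperty.of_isPushout
    (IsPushout.of_isColimit_binaryCofan_of_isInitial (coprodIsCoprod X Y) initialIsInitial).flip h

lemma cof_inr {X Y : M} (h : S.IsCofibrant X) : S.cof.leftClass (coprod.inr : Y ⟶ X ⨿ Y) :=
  MorphismProperty.of_isPushout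
    (IsPushout.of_isColimit_binaryCofan_of_isInitial (coprodIsCoprod X Y) initialIsInitial) h

/-- Ken Brown's lemma: a functor which sends trivial cofibrations to weak equivalences preserves the
weak equivalences between cofibrant objects. The cofibrations of a factorization of
`(f, 1) : X ⊔ Y ⟶ Y` restrict to trivial cofibrations on both summands. -/
theorem W_map_of_isCofibrant {N : Type u₁} [Category.{v₁} N] [HasLimits N] [HasColimits N]
    (S' : AlgModelStr N) (H : M ⥤ N)
    (hH : ∀ {X Y : M} (i : X ⟶ Y), S.tc.leftClass i → S'.W (H.map i)) {X Y : M} (f : X ⟶ Y)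
    (hX : S.IsCofibrant X) (hY : S.IsCofibrant Y) (hf : S.W f) : S'.W (H.map f) := by
  have := S.two_of_three
  have := S'.two_of_three
  let g := Arrow.mk (coprod.desc f (𝟙 Y))
  have hr : S.W (S.cof.r g) := S.W_of_rightClass (S.cof.rightClass_r g)
  have e₁ : (coprod.inl ≫ S.cof.l g) ≫ S.cof.r g = f := by
    rw [Category.assoc, S.cof.fac]
    exact coprod.inl_desc _ _
  have e₂ : (coprod.inr ≫ S.cof.l g) ≫ S.cof.r g = 𝟙 Y := by
    rw [Category.assoc, S.cof.fac]
    exact coprod.inr_desc _ _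
  have h1 : S.W (𝟙 Y) := S.W_of_leftClass (S.tc.leftClass.id_mem Y)
  have hl : S.tc.leftClass (coprod.inl ≫ S.cof.l g) := by
    rw [S.left_eq]
    exact ⟨S.cof.leftClass.comp_mem _ _ (S.cof_inl hY) (S.cof.leftClass_l g),
      S.W.of_postcomp _ _ hr (by rwa [e₁])⟩
  have hl' : S.tc.leftClass (coprod.inr ≫ S.cof.l g) := by
    rw [S.left_eq]
    exact ⟨S.cof.leftClass.comp_mem _ _ (S.cof_inr hX) (S.cof.leftClass_l g),
      S.W.of_postcomp _ _ hr (by rwa [e₂])⟩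
  have hHr : S'.W (H.map (S.cof.r g)) := by
    refine S'.W.of_precomp _ _ (hH _ hl') ?_
    rw [← H.map_comp, e₂]
    exact hH _ (S.tc.leftClass.id_mem Y)
  rw [← e₁, H.map_comp]
  exact S'.W.comp_mem _ _ (hH _ hl) hHr

lemma isCofibrant_cofRepl (X : M) : S.IsCofibrant (S.cofRepl X) := by
  have h := S.cof.leftClass_l (Arrow.mk (initial.to X))
  rwa [show S.cof.l (Arrow.mk (initial.to X)) = initial.to (S.cofRepl X) from
    initial.hom_ext _ _] at h

lemma W_cofReplCounit (X : M) : S.W (S.cofReplCounit X) :=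
  S.W_of_rightClass (S.cof.rightClass_r _)

/-- If the unit is cofibrant, then the unit axiom follows from the axioms on pushout-products. -/
lemma W_whiskerLeft_cofReplCounit [MonoidalCategory M] {T : TwoVarAdj (curriedTensor M)}
    (P : TwoVarAWFS T S.cof S.tc S.tc) {X I : M} (hI : S.IsCofibrant I) (hX : S.IsCofibrant X) :
    S.W (X ◁ S.cofReplCounit I) :=
  S.W_map_of_isCofibrant S ((curriedTensor M).obj X)
    (fun _ hi => S.W_of_leftClass (leftClass_obj_map P hX hi)) _ (S.isCofibrant_cofRepl I) hI
    (S.W_cofReplCounit I)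

lemma W_cofReplCounit_whiskerRight [MonoidalCategory M] {T : TwoVarAdj (curriedTensor M)}
    (P : TwoVarAWFS T S.tc S.cof S.tc) {X I : M} (hI : S.IsCofibrant I) (hX : S.IsCofibrant X) :
    S.W (S.cofReplCounit I ▷ X) :=
  S.W_map_of_isCofibrant S ((curriedTensor M).flip.obj X)
    (fun _ hi => S.W_of_leftClass (leftClass_map_app P hX hi)) _ (S.isCofibrant_cofRepl I) hI
    (S.W_cofReplCounit I)

/-- The zero-sphere is cofibrant, because `* ⟶ * ⊔ *` is a pushout of `∅ ⟶ *`. -/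
lemma isCofibrant_sphere [MonoidalCategory M] (hc : S.IsCofibrant (𝟙_ M)) :
    (S.under (𝟙_ M)).IsCofibrant (SmashData.sphere M) := by
  change (S.cof.under (𝟙_ M)).leftClass _
  rw [under_leftClass]
  change S.cof.leftClass (initial.to (SmashData.sphere M)).right
  let e : Under.mk (𝟙 (𝟙_ M)) ≅ ⊥_ (Under (𝟙_ M)) :=
    Under.mkIdInitial.uniqueUpToIso initialIsInitial
  have h : e.hom.right ≫ (initial.to (SmashData.sphere M)).right =
      (coprod.inl : 𝟙_ M ⟶ 𝟙_ M ⨿ 𝟙_ M) := by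
    have h₁ : (e.hom ≫ initial.to (SmashData.sphere M)).right =
      𝟙 _ ≫ (e.hom ≫ initial.to (SmashData.sphere M)).right := (Category.id_comp _).symm
    exact h₁.trans (Under.w (e.hom ≫ initial.to (SmashData.sphere M)))
  have h' : (initial.to (SmashData.sphere M)).right =
      e.inv.right ≫ (coprod.inl : 𝟙_ M ⟶ 𝟙_ M ⨿ 𝟙_ M) :=
    (congrArg CommaMorphism.right (e.inv_hom_id_assoc (initial.to (SmashData.sphere M)))).symm.trans
      (congrArg (e.inv.right ≫ ·) h)
  rw [h']
  have : IsIso e.inv.right := inferInstanceAs (IsIso ((Under.forget _).map e.inv))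
  exact S.cof.leftClass.comp_mem _ _ (S.cof.leftClass.of_isIso _) (S.cof_inl hc)

end AlgModelStr

/-! ### Compatibility with the symmetry -/

section Braiding

variable {M : Type u} [Category.{v} M] [HasPushouts M] [MonoidalCategory M] [BraidedCategory M]

lemma leibInl_braiding (i j : Arrow M) :
    leibInl (curriedTensor M) i j ≫ (Arrow.PushoutProduct.braiding i j).hom.left =
      (β_ i.right j.left).hom ≫ leibInr (curriedTensor M) j i := by
  refine (inl_comp_pushoutSymmetry_hom_assoc _ _ _).trans ?_
  exact HasColimit.isoOfNatIso_ι_hom _ _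

lemma leibInr_braiding (i j : Arrow M) :
    leibInr (curriedTensor M) i j ≫ (Arrow.PushoutProduct.braiding i j).hom.left =
      (β_ i.left j.right).hom ≫ leibInl (curriedTensor M) j i := by
  refine (inr_comp_pushoutSymmetry_hom_assoc _ _ _).trans ?_
  exact HasColimit.isoOfNatIso_ι_hom _ _

end Braiding

namespace SmashData

section

variable {M : Type u} [Category.{v} M] [HasColimits M] [MonoidalCategory M]
  {ht : IsTerminal (𝟙_ M)} (Sm : SmashData ht (curriedTensor M)) (T : TwoVarAdj (curriedTensor M))

/-- The smash product, as the tensor product of the monoidal structure it defines. -/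
@[reducible]
noncomputable def curried :
    letI := Sm.monoidalCategory T
    SmashData ht (curriedTensor M) :=
  letI := Sm.monoidalCategory T
  { Sm with S := curriedTensor (Under (𝟙_ M)) }

/-- The comparison between pushout-products is compatible with the symmetries. -/
lemma leibComparison_braiding [SymmetricCategory M] (i j : Arrow (Under (𝟙_ M))) :
    letI := Sm.monoidalCategory T
    letI := Sm.symmetricCategory T
    (Sm.curried T).leibComparison i j ≫ uSq (Arrow.PushoutProduct.braiding i j).hom =
      (Arrow.PushoutProduct.braiding (uArr i) (uArr j)).hom ≫
        (Sm.curried T).leibComparison j i := by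
  let := Sm.monoidalCategory T
  let := Sm.symmetricCategory T
  refine Arrow.hom_ext _ _ (leib_hom_ext ?_ ?_) (Sm.quo_braidHom i.right j.right)
  · have h := congrArg CommaMorphism.right (leibInl_braiding i j)
    rw [Arrow.comp_left, Arrow.comp_left, reassoc_of% (Sm.curried T).leibInl_leibComparison i j,
      reassoc_of% leibInl_braiding (uArr i) (uArr j), leibInr_leibComparison]
    refine (congrArg (Sm.quo i.right j.left ≫ ·) h).trans ?_
    have h' := Sm.quo_braidHom i.right j.left
    exact (Category.assoc _ _ _).symm.trans ((congrArg (· ≫ _) h').trans (Category.assoc _ _ _))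
  · have h := congrArg CommaMorphism.right (leibInr_braiding i j)
    rw [Arrow.comp_left, Arrow.comp_left, reassoc_of% (Sm.curried T).leibInr_leibComparison i j,
      reassoc_of% leibInr_braiding (uArr i) (uArr j), leibInl_leibComparison]
    refine (congrArg (Sm.quo i.left j.right ≫ ·) h).trans ?_
    have h' := Sm.quo_braidHom i.left j.right
    exact (Category.assoc _ _ _).symm.trans ((congrArg (· ≫ _) h').trans (Category.assoc _ _ _))

/-- If the lifted pushout-products commute with the symmetry of the monoidal product, then the
lifted pushout-products for the smash product commute with its symmetry. -/
lemma tensorS_braiding [HasPullbacks M] [SymmetricCategory M] {A B D : AWFS M}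
    (P : TwoVarAWFS T A B D) (P' : TwoVarAWFS T B A D)
    (i : (A.under (𝟙_ M)).Coalg) (j : (B.under (𝟙_ M)).Coalg)
    (h : (P.tensorStr (Coalg.ofUnder i) (Coalg.ofUnder j)).s ≫
        D.E.map (Arrow.PushoutProduct.braiding (uArr i.A) (uArr j.A)).hom =
      (β_ i.A.right.right j.A.right.right).hom ≫
        (P'.tensorStr (Coalg.ofUnder j) (Coalg.ofUnder i)).s) :
    letI := Sm.monoidalCategory T
    letI := Sm.symmetricCategory T
    (Sm.curried T).tensorS P i j ≫
        (D.under (𝟙_ M)).E.map (Arrow.PushoutProduct.braiding i.A j.A).hom =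
      (β_ i.A.right j.A.right).hom ≫ (Sm.curried T).tensorS P' j i := by
  let := Sm.monoidalCategory T
  let := Sm.symmetricCategory T
  refine (Sm.curried T).hom_ext ?_
  have h₁ := (Sm.curried T).q_tensorS P i j
  have h₂ := (Sm.curried T).q_tensorS P' j i
  have hκ : D.E.map ((Sm.curried T).leibComparison i.A j.A) ≫
      D.E.map (uSq (Arrow.PushoutProduct.braiding i.A j.A).hom) =
      D.E.map (Arrow.PushoutProduct.braiding (uArr i.A) (uArr j.A)).hom ≫
        D.E.map ((Sm.curried T).leibComparison j.A i.A) := by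
    rw [← D.E.map_comp, ← D.E.map_comp]
    exact congrArg (fun z => D.E.map z) (Sm.leibComparison_braiding T i.A j.A)
  have hβ := Sm.quo_braidHom i.A.right j.A.right
  refine (Category.assoc _ _ _).symm.trans ((congrArg (· ≫ _) h₁).trans ?_)
  refine (Category.assoc _ _ _).trans ((congrArg (_ ≫ ·) hκ).trans ?_)
  refine (Category.assoc _ _ _).symm.trans ((congrArg (· ≫ _) h).trans ?_)
  refine (Category.assoc _ _ _).trans ((congrArg (_ ≫ ·) h₂.symm).trans ?_)
  refine (Category.assoc _ _ _).symm.trans ((congrArg (· ≫ _) hβ.symm).trans ?_)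
  exact Category.assoc _ _ _

end

/-! ### Compatibility with morphisms of algebraic weak factorization systems -/

section Coherence

variable {M : Type u} [Category.{v} M] {pt : M} {ht : IsTerminal pt} {F : M ⥤ M ⥤ M}
  (Sm : SmashData ht F) [HasPushouts M] [HasPushouts (Under pt)] [HasPullbacks M]
  {T : TwoVarAdj F}

/-- Applying a morphism of systems to the coalgebra structure on a pushout-product commutes with
passing to the quotient. -/
lemma q_tensorS_ξ {A B D D' : AWFS M} (P : TwoVarAWFS T A B D) (φ : Hom D D')
    (i : (A.under pt).Coalg) (j : (B.under pt).Coalg) :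
    Sm.q i.A.right j.A.right ≫
        (Sm.tensorS P i j ≫ (Hom.under pt φ).ξ ((Sm.S.leibnizPushout.obj i.A).obj j.A)).right =
      (φ.mapStr (P.tensorStr (Coalg.ofUnder i) (Coalg.ofUnder j))).s ≫
        D'.E.map (Sm.leibComparison i.A j.A) := by
  refine (Category.assoc _ _ _).symm.trans ((congrArg (· ≫ _) (Sm.q_tensorS P i j)).trans ?_)
  refine (Category.assoc _ _ _).trans ((congrArg (_ ≫ ·) (φ.map_ξ _)).trans ?_)
  exact (Category.assoc _ _ _).symm

/-- Maximal coherence passes to the smash product, because it can be checked after precomposition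
with the quotient maps. -/
lemma mapStr_tensorStr_left {A A' B D D' : AWFS M} (P : TwoVarAWFS T A B D)
    (P' : TwoVarAWFS T A' B D') (φ : Hom D D') (ψ : Hom A A') (i : (A.under pt).Coalg)
    (j : (B.under pt).Coalg)
    (h : φ.mapStr (P.tensorStr (Coalg.ofUnder i) (Coalg.ofUnder j)) =
      P'.tensorStr (ψ.mapCoalg (Coalg.ofUnder i)) (Coalg.ofUnder j)) :
    (Hom.under pt φ).mapStr (Sm.tensorStr P i j) =
      Sm.tensorStr P' ((Hom.under pt ψ).mapCoalg i) j :=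
  CoalgStr.ext (Sm.hom_ext ((Sm.q_tensorS_ξ P φ i j).trans
    ((congrArg (fun z => CoalgStr.s z ≫ D'.E.map (Sm.leibComparison i.A j.A)) h).trans
      (Sm.q_tensorS P' ((Hom.under pt ψ).mapCoalg i) j).symm)))

lemma mapStr_tensorStr_right {A B B' D D' : AWFS M} (P : TwoVarAWFS T A B D)
    (P' : TwoVarAWFS T A B' D') (φ : Hom D D') (ψ : Hom B B') (i : (A.under pt).Coalg)
    (j : (B.under pt).Coalg)
    (h : φ.mapStr (P.tensorStr (Coalg.ofUnder i) (Coalg.ofUnder j)) =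
      P'.tensorStr (Coalg.ofUnder i) (ψ.mapCoalg (Coalg.ofUnder j))) :
    (Hom.under pt φ).mapStr (Sm.tensorStr P i j) =
      Sm.tensorStr P' i ((Hom.under pt ψ).mapCoalg j) :=
  CoalgStr.ext (Sm.hom_ext ((Sm.q_tensorS_ξ P φ i j).trans
    ((congrArg (fun z => CoalgStr.s z ≫ D'.E.map (Sm.leibComparison i.A j.A)) h).trans
      (Sm.q_tensorS P' i ((Hom.under pt ψ).mapCoalg j)).symm)))

lemma tensorStr_mapCoalg {A A' B B' D : AWFS M} (P : TwoVarAWFS T A B' D)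
    (P' : TwoVarAWFS T A' B D) (φ : Hom A A') (ψ : Hom B B') (i : (A.under pt).Coalg)
    (j : (B.under pt).Coalg)
    (h : P.tensorStr (Coalg.ofUnder i) (ψ.mapCoalg (Coalg.ofUnder j)) =
      P'.tensorStr (φ.mapCoalg (Coalg.ofUnder i)) (Coalg.ofUnder j)) :
    Sm.tensorStr P i ((Hom.under pt ψ).mapCoalg j) =
      Sm.tensorStr P' ((Hom.under pt φ).mapCoalg i) j :=
  CoalgStr.ext (Sm.hom_ext ((Sm.q_tensorS P i ((Hom.under pt ψ).mapCoalg j)).trans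
    ((congrArg (fun z => CoalgStr.s z ≫ D.E.map (Sm.leibComparison i.A j.A)) h).trans
      (Sm.q_tensorS P' ((Hom.under pt φ).mapCoalg i) j).symm)))

end Coherence

/-! ### The monoidal algebraic model structure on pointed objects -/

section

variable {M : Type u} [Category.{v} M] [HasLimits M] [HasColimits M] [MonoidalCategory M]
  {ht : IsTerminal (𝟙_ M)} (Sm : SmashData ht (curriedTensor M))

/-- The monoidal algebraic model structure on pointed objects. -/
@[reducible]
noncomputable def monoidalAlgModel {S : AlgModelStr M} (P : MonoidalAlgModel S)
    (hc : S.IsCofibrant (𝟙_ M)) :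
    letI := Sm.monoidalCategory P.closed
    MonoidalAlgModel (S.under (𝟙_ M)) :=
  letI := Sm.monoidalCategory P.closed
  { closed := (Sm.curried P.closed).twoVarAdj P.closed
    quillen :=
      { cc := (Sm.curried P.closed).twoVarAWFS P.quillen.cc
        tcc := (Sm.curried P.closed).twoVarAWFS P.quillen.tcc
        ctc := (Sm.curried P.closed).twoVarAWFS P.quillen.ctc }
    unit_right := fun _ hX => (S.under (𝟙_ M)).W_whiskerLeft_cofReplCounit
      ((Sm.curried P.closed).twoVarAWFS P.quillen.ctc) (S.isCofibrant_sphere hc) hX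
    unit_left := fun _ hX => (S.under (𝟙_ M)).W_cofReplCounit_whiskerRight
      ((Sm.curried P.closed).twoVarAWFS P.quillen.tcc) (S.isCofibrant_sphere hc) hX }

lemma isSymmetric_monoidalAlgModel [SymmetricCategory M] {S : AlgModelStr M}
    {P : MonoidalAlgModel S} (hc : S.IsCofibrant (𝟙_ M)) (h : P.IsSymmetric) :
    letI := Sm.monoidalCategory P.closed
    letI := Sm.symmetricCategory P.closed
    (Sm.monoidalAlgModel P hc).IsSymmetric :=
  letI := Sm.monoidalCategory P.closed
  letI := Sm.symmetricCategory P.closed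
  { cc := fun i j => Sm.tensorS_braiding P.closed P.quillen.cc P.quillen.cc i j
      (h.cc (Coalg.ofUnder i) (Coalg.ofUnder j))
    tc := fun i j => Sm.tensorS_braiding P.closed P.quillen.tcc P.quillen.ctc i j
      (h.tc (Coalg.ofUnder i) (Coalg.ofUnder j)) }

lemma isMaximallyCoherent_monoidalAlgModel {S : AlgModelStr M}
    {P : MonoidalAlgModel S} (hc : S.IsCofibrant (𝟙_ M)) (h : P.IsMaximallyCoherent) :
    letI := Sm.monoidalCategory P.closed
    (Sm.monoidalAlgModel P hc).IsMaximallyCoherent :=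
  letI := Sm.monoidalCategory P.closed
  { left := fun i j => (Sm.curried P.closed).mapStr_tensorStr_left P.quillen.tcc P.quillen.cc
      S.ξ S.ξ i j (h.left (Coalg.ofUnder i) (Coalg.ofUnder j))
    right := fun i j => (Sm.curried P.closed).mapStr_tensorStr_right P.quillen.ctc P.quillen.cc
      S.ξ S.ξ i j (h.right (Coalg.ofUnder i) (Coalg.ofUnder j))
    top := fun i j => (Sm.curried P.closed).tensorStr_mapCoalg P.quillen.tcc P.quillen.ctc
      S.ξ S.ξ i j (h.top (Coalg.ofUnder i) (Coalg.ofUnder j)) }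

end

end SmashData

end AlgModel

theorem mainTheorem9 {M : Type u} [Category.{v} M] [HasLimits M] [HasColimits M]
    [MonoidalCategory M] (S : AlgModel.AlgModelStr M) (P : AlgModel.MonoidalAlgModel S)
    (ht : IsTerminal (𝟙_ M)) (hc : S.IsCofibrant (𝟙_ M)) :
    ∃ (mon : MonoidalCategory (Under (𝟙_ M)))
      (lax : (Under.forget (𝟙_ M)).LaxMonoidal)
      (P' : AlgModel.MonoidalAlgModel (S.under (𝟙_ M))),
      AlgModel.IsSmash ht ∧
      (∀ [SymmetricCategory M], P.IsSymmetric →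
        ∃ sym : SymmetricCategory (Under (𝟙_ M)),
          (∀ X Y : Under (𝟙_ M),
            Functor.LaxMonoidal.μ (Under.forget (𝟙_ M)) X Y ≫ (β_ X Y).hom.right =
              (β_ X.right Y.right).hom ≫ Functor.LaxMonoidal.μ (Under.forget (𝟙_ M)) Y X) ∧
          P'.IsSymmetric) ∧
      (P.IsMaximallyCoherent → P'.IsMaximallyCoherent) := by
  let Sm := AlgModel.smashData ht
  refine ⟨Sm.monoidalCategory P.closed, Sm.laxMonoidal P.closed, Sm.monoidalAlgModel P hc,
    Sm.isSmash P.closed, fun {_} h => ⟨Sm.symmetricCategory P.closed, Sm.quo_braidHom,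
      Sm.isSymmetric_monoidalAlgModel hc h⟩, Sm.isMaximallyCoherent_monoidalAlgModel hc⟩
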